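/- Let $\mathfrak g$ be a finite-dimensional simple Lie algebra over $\mathbb C$ of rank $\ell$, let $e\in\mathfrak g$ be nilpotent and let $\{e,h,f\}$ be an $\mathfrak{sl}_2$-triple containing $e$ (with $h=f=0$ if $e=0$). For $x\in\mathfrak g$ let $\mathfrak g^x$ be the centralizer of $x$ in $\mathfrak g$. Elements of $S(\mathfrak g)$ are regarded as polynomial functions on $\mathfrak g$ by means of the Killing form $\kappa$. For $P\in S(\mathfrak g)$, restrict $P$ to $e+\mathfrak g^f$ and regard the restriction as a polynomial function $y\mapsto P(e+y)$ on $\mathfrak g^f$; its nonzero homogeneous component of least degree is an element ${}^eP$ of $S((\mathfrak g^f)^*)= S(\mathfrak g^e)$, where $\mathfrak g^e$ is identified with $(\mathfrak g^f)^*$ by $x\mapsto\kappa(x,\cdot)$ (and ${}^eP=0$ if the restriction is zero). Let $P_1,\dots,P_\ell$ be homogeneous elements that generate the algebra $S(\mathfrak g)^{\mathfrak g}$ and are good for $e$, that is, $$\sum_{i=1}^{\ell}\deg {}^eP_i=\tfrac12(\dim\mathfrak g^e+\ell).$$ Let $(\mathfrak g^e)^*_{\rm sing}$ be the set of linear functions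 $\chi$ on $\mathfrak g^e$ whose stabilizer $\{x\in\mathfrak g^e:\chi([x,y])=0\text{ for all }y\in\mathfrak g^e\}$ does not have dimension $\ell$, and suppose that $(\mathfrak g^e)^*_{\rm sing}$ has codimension at least $2$ in $(\mathfrak g^e)^*$ (the empty set having codimension $\infty$). Put $\mathfrak q=\mathfrak g^e$, $\widehat{\mathfrak q}_-=\mathfrak q\otimes t^{-1}\mathbb C[t^{-1}]$ and $\widehat{\mathfrak q}_+=\mathfrak q[[t]]\oplus\mathbb C\mathbf 1$. Let $\widehat{\mathfrak q}_+$ act on $\widehat{\mathfrak q}_-\cong\widehat{\mathfrak q}/\widehat{\mathfrak q}_+$, where $\widehat{\mathfrak q}=\widehat{\mathfrak q}_-\oplus\widehat{\mathfrak q}_+$ is the affine Lie algebra of $\mathfrak q$ with central element $\mathbf 1$: for $a,x\in\mathfrak q$, $n\ge 0$ and $m\ge 1$, the element $at^n$ sends $xt^{-m}$ to $[a,x]t^{n-m}$ if $n<m$ and to $0$ otherwise, and $\mathbf 1$ acts by $0$. Let $\widehat{\mathfrak q}_+$ act on $S(\widehat{\mathfrak q}_-)$ by the derivations that extend this action. Let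 $T$ be the derivation of $S(\widehat{\mathfrak q}_-)$ with $T(xt^{-m})=m\,xt^{-m-1}$ for $x\in\mathfrak q$ and $m\ge1$, and regard $S(\mathfrak q)$ as a subalgebra of $S(\widehat{\mathfrak q}_-)$ by $x\mapsto xt^{-1}$. Then the invariant algebra $S(\widehat{\mathfrak q}_-)^{\widehat{\mathfrak q}_+}$ is a polynomial algebra in the variables $T^j({}^eP_i)$ with $1\le i\le\ell$ and $j\ge 0$: these elements are algebraically independent over $\mathbb C$ and generate $S(\widehat{\mathfrak q}_-)^{\widehat{\mathfrak q}_+}$. -/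

import Mathlib

namespace ArcInvariants

open scoped Polynomial

noncomputable section

/-! ### Symmetric algebras: degrees, derivations, invariants -/

section Sym

variable {M : Type*} [AddCommGroup M] [Module ℂ M]

/-- The algebra homomorphism `S(M) → S(M)[X]` with `x ↦ x X` for `x ∈ M`.
The coefficient of `X ^ n` in the image of `F` is the degree `n` component of `F`. -/
def gradingHom (M : Type*) [AddCommGroup M] [Module ℂ M] :
    SymmetricAlgebra ℂ M →ₐ[ℂ] (SymmetricAlgebra ℂ M)[X] :=
  SymmetricAlgebra.lift
    (((Polynomial.monomial (R := SymmetricAlgebra ℂ M) 1).restrictScalars ℂ) ∘ₗ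
      SymmetricAlgebra.ι ℂ M)

/-- The degree of an element of `S(M)`. -/
def symDegree (F : SymmetricAlgebra ℂ M) : ℕ := (gradingHom M F).natDegree

/-- The nonzero homogeneous component of least degree of `F ∈ S(M)` (and `0` if `F = 0`). -/
def initialForm (F : SymmetricAlgebra ℂ M) : SymmetricAlgebra ℂ M :=
  (gradingHom M F).trailingCoeff

/-- `F ∈ S(M)` is homogeneous of degree `n`: it lies in `Sⁿ(M)`, the span of all products of
`n` elements of `M`. -/
def IsHomogeneousOfDegree (F : SymmetricAlgebra ℂ M) (n : ℕ) : Prop :=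
  F ∈ (LinearMap.range (SymmetricAlgebra.ι ℂ M)) ^ n

/-- The homomorphism `S(M) → S(M)[ε]`, `x ↦ x + ε φ(x)`, for a linear endomorphism `φ` of `M`. -/
def dualHom (φ : M →ₗ[ℂ] M) :
    SymmetricAlgebra ℂ M →ₐ[ℂ] DualNumber (SymmetricAlgebra ℂ M) :=
  SymmetricAlgebra.lift
    ((TrivSqZeroExt.inlAlgHom ℂ (SymmetricAlgebra ℂ M) (SymmetricAlgebra ℂ M)).toLinearMap ∘ₗ
        SymmetricAlgebra.ι ℂ M +
      ((TrivSqZeroExt.inrHom (SymmetricAlgebra ℂ M) (SymmetricAlgebra ℂ M)).restrictScalars ℂ) ∘ₗ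
        SymmetricAlgebra.ι ℂ M ∘ₗ φ)

theorem fst_dualHom (φ : M →ₗ[ℂ] M) (F : SymmetricAlgebra ℂ M) :
    (dualHom φ F).fst = F := by
  have h : (TrivSqZeroExt.fstHom ℂ (SymmetricAlgebra ℂ M) (SymmetricAlgebra ℂ M)).comp
      (dualHom φ) = AlgHom.id ℂ _ := by
    apply SymmetricAlgebra.algHom_ext
    ext x
    simp [dualHom]
  exact DFunLike.congr_fun h F

/-- The derivation of the algebra `S(M)` that extends a linear endomorphism `φ` of `M`. -/
def symDer (φ : M →ₗ[ℂ] M) :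
    Derivation ℂ (SymmetricAlgebra ℂ M) (SymmetricAlgebra ℂ M) where
  toFun F := (dualHom φ F).snd
  map_add' a b := by simp
  map_smul' c a := by simp
  map_one_eq_zero' := by simp
  leibniz' a b := by simp [fst_dualHom, mul_comm]

theorem symDer_ι (φ : M →ₗ[ℂ] M) (x : M) :
    symDer φ (SymmetricAlgebra.ι ℂ M x) = SymmetricAlgebra.ι ℂ M (φ x) := by
  change (dualHom φ (SymmetricAlgebra.ι ℂ M x)).snd = _
  simp [dualHom]

/-- The algebra of invariants in `S(M)` of a family of linear operators on `M`, each acting on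
`S(M)` as a derivation: the elements annihilated by all of these derivations. -/
def symInvariants {A : Type*} (ρ : A → M →ₗ[ℂ] M) : Subalgebra ℂ (SymmetricAlgebra ℂ M) where
  carrier := {F | ∀ a, symDer (ρ a) F = 0}
  mul_mem' {F G} hF hG a := by simp [hF a, hG a]
  add_mem' {F G} hF hG a := by simp [hF a, hG a]
  algebraMap_mem' c a := by simp

end Sym

/-! ### Coadjoint stabilizers and codimension -/

section Coadjoint

variable {q : Type*} [LieRing q] [LieAlgebra ℂ q]

/-- The stabilizer `{x ∈ q | χ([x, y]) = 0 for all y ∈ q}` of `χ ∈ q*` for the coadjoint action. -/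
def coadjointStabilizer (χ : Module.Dual ℂ q) : Submodule ℂ q :=
  LinearMap.ker ((LieAlgebra.ad ℂ q : q →ₗ[ℂ] q →ₗ[ℂ] q).compr₂ χ)

/-- The linear functions on `q` whose stabilizer in `q` does not have dimension `l`. -/
def singularSet (q : Type*) [LieRing q] [LieAlgebra ℂ q] (l : ℕ) : Set (Module.Dual ℂ q) :=
  {χ | Module.finrank ℂ (coadjointStabilizer χ) ≠ l}

/-- The ideal of all `F ∈ S(q) = ℂ[q*]` that vanish on a set `Z ⊆ q*`; the value of `F` at `χ` is
its image under the algebra homomorphism `S(q) → ℂ` that extends `χ`. -/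
def vanishingIdeal (Z : Set (Module.Dual ℂ q)) : Ideal (SymmetricAlgebra ℂ q) :=
  ⨅ χ ∈ Z, RingHom.ker (SymmetricAlgebra.lift χ : SymmetricAlgebra ℂ q →ₐ[ℂ] ℂ)

/-- The codimension in `q*` of (the Zariski closure of) `Z`: the height of its ideal. It is `⊤` for
the empty set. -/
def codim (Z : Set (Module.Dual ℂ q)) : ℕ∞ := (vanishingIdeal Z).height

end Coadjoint

/-! ### Centralizers and the Slodowy slice -/

section Slice

variable {g : Type*} [LieRing g] [LieAlgebra ℂ g]

/-- The centralizer of `x` in `g`. -/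
def centralizer (x : g) : LieSubalgebra ℂ g where
  carrier := {y | ⁅x, y⁆ = 0}
  add_mem' {a b} ha hb := by
    change ⁅x, a⁆ = 0 at ha
    change ⁅x, b⁆ = 0 at hb
    change ⁅x, a + b⁆ = 0
    rw [lie_add, ha, hb, add_zero]
  zero_mem' := lie_zero x
  smul_mem' c a ha := by
    change ⁅x, a⁆ = 0 at ha
    change ⁅x, c • a⁆ = 0
    rw [lie_smul, ha, smul_zero]
  lie_mem' {a b} ha hb := by
    change ⁅x, a⁆ = 0 at ha
    change ⁅x, b⁆ = 0 at hb
    change ⁅x, ⁅a, b⁆⁆ = 0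
    rw [leibniz_lie, ha, hb, zero_lie, lie_zero, add_zero]

theorem mem_centralizer {x y : g} : y ∈ centralizer x ↔ ⁅x, y⁆ = 0 := Iff.rfl

/-- The relations of an `sl₂`-triple. If `e = 0` they force `h = f = 0`; if `e ≠ 0` they say that
`e, h, f` is a standard basis of a copy of `sl₂`. -/
structure IsTriple (e h f : g) : Prop where
  lie_h_e : ⁅h, e⁆ = (2 : ℂ) • e
  lie_h_f : ⁅h, f⁆ = -((2 : ℂ) • f)
  lie_e_f : ⁅e, f⁆ = h

theorem IsTriple.symm {e h f : g} (t : IsTriple e h f) : IsTriple f (-h) e where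
  lie_h_e := by rw [neg_lie, t.lie_h_f, neg_neg]
  lie_h_f := by rw [neg_lie, t.lie_h_e]
  lie_e_f := by rw [← lie_skew, t.lie_e_f]

/-- The linear map `g^e → (g^f)*`, `x ↦ κ(x, ·)`, where `κ` is the Killing form of `g`. -/
def killingPairing (e f : g) : centralizer e →ₗ[ℂ] Module.Dual ℂ (centralizer f) :=
  (killingForm ℂ g).domRestrict₁₂ (centralizer e).toSubmodule (centralizer f).toSubmodule


theorem IsTriple.lie_f_pow {e h f : g} (t : IsTriple e h f) (k : ℕ) (z : g) :
    ⁅f, ((LieAlgebra.ad ℂ g e) ^ (k + 1)) z⁆ =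
      ((LieAlgebra.ad ℂ g e) ^ (k + 1)) ⁅f, z⁆ -
        ((k : ℂ) + 1) • ((LieAlgebra.ad ℂ g e) ^ k) (⁅h, z⁆ + (k : ℂ) • z) := by
  have hfe : ∀ z : g, ⁅f, ⁅e, z⁆⁆ = ⁅e, ⁅f, z⁆⁆ - ⁅h, z⁆ := fun z ↦ by
    rw [leibniz_lie e f z, t.lie_e_f]; abel
  have hhe : ∀ z : g, ⁅h, ⁅e, z⁆⁆ = ⁅e, ⁅h, z⁆⁆ + (2 : ℂ) • ⁅e, z⁆ := fun z ↦ by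
    rw [leibniz_lie h e z, t.lie_h_e, smul_lie]; abel
  induction k generalizing z with
  | zero => simp [hfe]
  | succ k ih =>
    rw [pow_succ, Module.End.mul_apply, LieAlgebra.ad_apply, ih, hfe, hhe]
    have key : ⁅e, ⁅h, z⁆⁆ + (2 : ℂ) • ⁅e, z⁆ + (k : ℂ) • ⁅e, z⁆ =
        LieAlgebra.ad ℂ g e (⁅h, z⁆ + ((k : ℂ) + 2) • z) := by
      simp only [LieAlgebra.ad_apply, lie_add, lie_smul]; module
    rw [key, ← Module.End.mul_apply (_ ^ k), ← pow_succ, Module.End.mul_apply,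
      LieAlgebra.ad_apply]
    simp only [map_sub, map_add, map_smul]
    push_cast
    module

theorem IsTriple.exists_pow_eq_zero [FiniteDimensional ℂ g] {e h f : g} (t : IsTriple e h f) :
    ∃ k : ℕ, (LieAlgebra.ad ℂ g e) ^ k = 0 := by
  by_contra! contra
  let H := LieAlgebra.ad ℂ g h
  let E := LieAlgebra.ad ℂ g e
  have hHE : H * E = E * H + (2 : ℂ) • E := by
    ext z
    simp only [H, E, Module.End.mul_apply, LieAlgebra.ad_apply, LinearMap.add_apply,
      LinearMap.smul_apply]
    rw [leibniz_lie h e z, t.lie_h_e, smul_lie, add_comm]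
  have hpow : ∀ k : ℕ, H * E ^ k = E ^ k * H + (2 * (k : ℂ)) • E ^ k := by
    intro k
    induction k with
    | zero => simp
    | succ k ih =>
      rw [pow_succ, ← mul_assoc, ih, add_mul, mul_assoc (E ^ k) H E, hHE, mul_add,
        smul_mul_assoc, mul_smul_comm, ← mul_assoc]
      push_cast
      module
  have hinj : Function.Injective (fun k : ℕ ↦ 2 * (k : ℂ)) := fun a b hab ↦ by
    simpa using hab
  have aux (μ : Set.range (fun k : ℕ ↦ 2 * (k : ℂ))) :
      Module.End.HasEigenvector (R := ℂ) (M := Module.End ℂ g)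
        (LinearMap.mulLeft ℂ H - LinearMap.mulRight ℂ H) μ (E ^ μ.property.choose) := by
    refine ⟨?_, contra _⟩
    rw [Module.End.mem_eigenspace_iff, LinearMap.sub_apply, LinearMap.mulLeft_apply,
      LinearMap.mulRight_apply, hpow, add_sub_cancel_left]
    congr 1
    exact μ.property.choose_spec
  have _i := (Module.End.eigenvectors_linearIndependent _ _ _ aux).finite
  exact (Set.infinite_range_of_injective hinj) (Set.toFinite _)

theorem IsTriple.eq_zero_of_lie_eq_zero [FiniteDimensional ℂ g] {e h f : g}
    (t : IsTriple e h f) (z : g) (hz : ⁅e, ⁅f, z⁆⁆ = 0) : ⁅f, z⁆ = 0 := by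
  -- an eigenvector of `h` in `ker (ad e) ∩ im (ad f)` that is nonzero leads to a contradiction
  by_cases hh : h = 0
  · have : (2 : ℂ) • f = 0 := by
      have := t.lie_h_f
      rwa [hh, zero_lie, eq_comm, neg_eq_zero] at this
    have hf : f = 0 := by simpa using this
    simp [hf]
  have t' : IsSl2Triple h e f :=
    ⟨hh, t.lie_e_f, by rw [t.lie_h_e, two_smul, two_nsmul],
      by rw [t.lie_h_f, two_smul, two_nsmul]⟩
  have hhf : ∀ z : g, ⁅h, ⁅f, z⁆⁆ = ⁅f, ⁅h, z⁆⁆ - (2 : ℂ) • ⁅f, z⁆ := fun z ↦ by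
    rw [leibniz_lie h f z, t.lie_h_f, neg_lie, smul_lie]; abel
  have hhe : ∀ z : g, ⁅e, ⁅h, z⁆⁆ = ⁅h, ⁅e, z⁆⁆ - (2 : ℂ) • ⁅e, z⁆ := fun z ↦ by
    rw [leibniz_lie h e z, t.lie_h_e, smul_lie]; abel
  have main : ∀ (l k : ℕ) (z : g), ⁅e, ⁅f, z⁆⁆ = 0 → ⁅h, ⁅f, z⁆⁆ = (l : ℂ) • ⁅f, z⁆ →
      ((LieAlgebra.ad ℂ g e) ^ k) z = 0 → ⁅f, z⁆ = 0 := by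
    intro l k
    induction k with
    | zero => intro z _ _ h0; simp at h0; simp [h0]
    | succ k ih =>
      intro z h1 h2 h3
      have hf' : ⁅f, ⁅h, z⁆ + (k : ℂ) • z⁆ = ((l : ℂ) + 2 + k) • ⁅f, z⁆ := by
        have : ⁅f, ⁅h, z⁆⁆ = ⁅h, ⁅f, z⁆⁆ + (2 : ℂ) • ⁅f, z⁆ := by rw [hhf]; abel
        rw [lie_add, lie_smul, this, h2]; module
      have h4 := t.lie_f_pow k z
      rw [h3, lie_zero, pow_succ, Module.End.mul_apply, LieAlgebra.ad_apply, h1, map_zero,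
        zero_sub, eq_comm, neg_eq_zero, smul_eq_zero] at h4
      have h5 := h4.resolve_left (by exact_mod_cast Nat.succ_ne_zero k)
      have h6 := ih (⁅h, z⁆ + (k : ℂ) • z) (by rw [hf', lie_smul, h1, smul_zero])
        (by rw [hf', lie_smul, h2, smul_comm]) h5
      rw [hf', smul_eq_zero] at h6
      refine h6.resolve_left ?_
      exact_mod_cast (by omega : l + 2 + k ≠ 0)
  let U : Submodule ℂ g :=
    LinearMap.ker (LieAlgebra.ad ℂ g e) ⊓ LinearMap.range (LieAlgebra.ad ℂ g f)
  have hU : ∀ x ∈ U, LieAlgebra.ad ℂ g h x ∈ U := by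
    rintro x ⟨hx1, y, rfl⟩
    have hx1 : ⁅e, ⁅f, y⁆⁆ = 0 := hx1
    refine ⟨?_, ?_⟩
    · change ⁅e, ⁅h, ⁅f, y⁆⁆⁆ = 0
      rw [hhe, hx1]; simp
    · refine ⟨⁅h, y⁆ - (2 : ℂ) • y, ?_⟩
      simp only [LieAlgebra.ad_apply, lie_sub, lie_smul]
      rw [hhf]
  suffices U = ⊥ by
    have hmem : ⁅f, z⁆ ∈ U := ⟨hz, z, rfl⟩
    rw [this] at hmem
    simpa using hmem
  by_contra hne
  have : Nontrivial U := Submodule.nontrivial_iff_ne_bot.mpr hne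
  obtain ⟨μ, hμ⟩ := Module.End.exists_eigenvalue ((LieAlgebra.ad ℂ g h).restrict hU)
  obtain ⟨v, hv⟩ := hμ.exists_hasEigenvector
  have hv1 : ⁅h, (v : g)⁆ = μ • (v : g) := congrArg Subtype.val hv.apply_eq_smul
  have hv0 : (v : g) ≠ 0 := fun h ↦ hv.2 (Subtype.ext h)
  have hve : ⁅e, (v : g)⁆ = 0 := v.2.1
  obtain ⟨y, hy⟩ := v.2.2
  have hy : ⁅f, y⁆ = (v : g) := hy
  obtain ⟨l, rfl⟩ := (IsSl2Triple.HasPrimitiveVectorWith.exists_nat (R := ℂ)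
    (t := t') ⟨hv0, hv1, hve⟩)
  obtain ⟨k, hk⟩ := t.exists_pow_eq_zero
  refine hv0 (hy ▸ main l k y ?_ ?_ ?_)
  · rw [hy, hve]
  · rw [hy, hv1]
  · rw [hk]; simp

theorem killingPairing_injective [FiniteDimensional ℂ g] [LieAlgebra.IsSimple ℂ g] {e h f : g}
    (t : IsTriple e h f) : Function.Injective (killingPairing e f) := by
  have hnd := LieAlgebra.IsKilling.killingForm_nondegenerate ℂ g
  rw [injective_iff_map_eq_zero]
  intro x hx
  have hx' : ∀ y, ⁅f, y⁆ = 0 → killingForm ℂ g x y = 0 := fun y hy ↦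
    DFunLike.congr_fun hx ⟨y, hy⟩
  -- `(g^f)^⊥ = [f, g]` for the Killing form
  have hrefl : (killingForm ℂ g).IsRefl := (LieModule.traceForm_isSymm ℂ g g).isRefl
  have horth : (killingForm ℂ g).orthogonal (LinearMap.range (LieAlgebra.ad ℂ g f)) ≤
      LinearMap.ker (LieAlgebra.ad ℂ g f) := by
    intro y hy
    rw [LinearMap.mem_ker, LieAlgebra.ad_apply]
    apply hnd.2
    intro w
    have := hy ⁅f, w⁆ ⟨w, rfl⟩
    have h2 := LieModule.traceForm_apply_lie_apply' ℂ g g f w y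
    change killingForm ℂ g ⁅f, w⁆ y = 0 at this
    rw [this, eq_comm, neg_eq_zero] at h2
    exact h2
  have hxr : (x : g) ∈ LinearMap.range (LieAlgebra.ad ℂ g f) := by
    rw [← LinearMap.BilinForm.orthogonal_orthogonal hnd hrefl
      (LinearMap.range (LieAlgebra.ad ℂ g f))]
    intro y hy
    have := hx' y (horth hy)
    rw [← LieModule.traceForm_comm] at this
    exact this
  obtain ⟨z, hz⟩ := hxr
  have hz : ⁅f, z⁆ = (x : g) := hz
  have hxe : ⁅e, (x : g)⁆ = 0 := x.2
  have := t.eq_zero_of_lie_eq_zero z (by rw [hz, hxe])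
  exact Subtype.ext (hz ▸ this)

theorem killingPairing_bijective [FiniteDimensional ℂ g] [LieAlgebra.IsSimple ℂ g] {e h f : g}
    (t : IsTriple e h f) : Function.Bijective (killingPairing e f) := by
  have h1 := LinearMap.finrank_le_finrank_of_injective (killingPairing_injective t)
  have h2 := LinearMap.finrank_le_finrank_of_injective (killingPairing_injective t.symm)
  rw [Subspace.dual_finrank_eq] at h1 h2
  refine ⟨killingPairing_injective t,
    (LinearMap.injective_iff_surjective_of_finrank_eq_finrank ?_).mp
      (killingPairing_injective t)⟩
  rw [Subspace.dual_finrank_eq]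
  exact le_antisymm h1 h2

/-- The isomorphism `g^e ≃ (g^f)*` given by the Killing form. -/
def killingEquiv [FiniteDimensional ℂ g] [LieAlgebra.IsSimple ℂ g] {e h f : g}
    (t : IsTriple e h f) : centralizer e ≃ₗ[ℂ] Module.Dual ℂ (centralizer f) :=
  LinearEquiv.ofBijective (killingPairing e f) (killingPairing_bijective t)

/-- Restriction of polynomial functions to the Slodowy slice. An element of `S(g)` is a polynomial
function on `g` through the Killing form `κ` (`x ∈ g` is the function `κ(x, ·)`). The slice `e + g^f`
is identified with `g^f` by `e + y ↦ y`, so that its algebra of polynomial functions is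
`S((g^f)*)`, and the restriction of `κ(x, ·)` is `y ↦ κ(x, e) + κ(x, y)`. -/
def sliceRestriction (e f : g) :
    SymmetricAlgebra ℂ g →ₐ[ℂ] SymmetricAlgebra ℂ (Module.Dual ℂ (centralizer f)) :=
  SymmetricAlgebra.lift
    ((Algebra.linearMap ℂ (SymmetricAlgebra ℂ (Module.Dual ℂ (centralizer f)))) ∘ₗ
        (killingForm ℂ g).flip e +
      SymmetricAlgebra.ι ℂ (Module.Dual ℂ (centralizer f)) ∘ₗ
        (killingForm ℂ g).domRestrict₂ (centralizer f).toSubmodule)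

/-- The element `ᵉP ∈ S(g^e)`: the component of least degree of the restriction of `P` to
`e + g^f`, moved from `S((g^f)*)` to `S(g^e)` by the isomorphism `g^e ≃ (g^f)*`. -/
def sliceInitial [FiniteDimensional ℂ g] [LieAlgebra.IsSimple ℂ g] {e h f : g}
    (t : IsTriple e h f) (P : SymmetricAlgebra ℂ g) : SymmetricAlgebra ℂ (centralizer e) :=
  SymmetricAlgebra.lift
    (SymmetricAlgebra.ι ℂ (centralizer e) ∘ₗ (killingEquiv t).symm.toLinearMap)
    (initialForm (sliceRestriction e f P))

/-- `S(g)^g`. -/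
def adjointInvariants (g : Type*) [LieRing g] [LieAlgebra ℂ g] :
    Subalgebra ℂ (SymmetricAlgebra ℂ g) :=
  symInvariants (fun x : g ↦ LieAlgebra.ad ℂ g x)

/-- `P₁, …, P_ℓ`, with `ℓ` the rank of `g`, is a good generating system of `S(g)^g` for `e`. -/
structure IsGoodGeneratingSystem [FiniteDimensional ℂ g] [LieAlgebra.IsSimple ℂ g] {e h f : g}
    (t : IsTriple e h f) (P : Fin (LieAlgebra.rank ℂ g) → SymmetricAlgebra ℂ g) : Prop where
  homogeneous : ∀ i, ∃ n, IsHomogeneousOfDegree (P i) n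
  generates : Algebra.adjoin ℂ (Set.range P) = adjointInvariants g
  good : ((∑ i, symDegree (sliceInitial t (P i)) : ℕ) : ℚ) =
    ((Module.finrank ℂ (centralizer e) : ℚ) + (LieAlgebra.rank ℂ g : ℚ)) / 2

end Slice

/-! ### The affine setting -/

section Affine

variable {q : Type*} [LieRing q] [LieAlgebra ℂ q]

/-- `q̂₋ = q ⊗ t⁻¹ℂ[t⁻¹]`: `Finsupp.single k x` is `x t^(-(k + 1))`. -/
abbrev AffineNeg (q : Type*) [LieRing q] [LieAlgebra ℂ q] : Type _ := ℕ →₀ q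

/-- `q̂₊ = q[[t]] ⊕ ℂ𝟏`: the pair `(a, c)` is `∑ₙ (a n) tⁿ + c 𝟏`. -/
abbrev AffinePos (q : Type*) [LieRing q] [LieAlgebra ℂ q] : Type _ := (ℕ → q) × ℂ

/-- The action of `q̂₊` on `q̂₋`, identified with the quotient module `q̂/q̂₊` of the affine
Lie algebra `q̂`. In `q̂`, the bracket of `a tⁿ` and `x t^(-m)` is `[a, x] t^(n - m)` plus a multiple
of the central element `𝟏`; modulo `q̂₊` it is `[a, x] t^(n - m)` if `n < m`, and `0` otherwise.
The central element acts by `0`. With `m = k + 1` and `n ≤ k`, `t^(n - m) = t^(-((k - n) + 1))`. -/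
def affineAction (a : AffinePos q) : AffineNeg q →ₗ[ℂ] AffineNeg q :=
  Finsupp.lsum ℂ fun k ↦ ∑ n ∈ Finset.range (k + 1),
    Finsupp.lsingle (k - n) ∘ₗ (LieAlgebra.ad ℂ q (a.1 n))

theorem affineAction_single (a : AffinePos q) (k : ℕ) (x : q) :
    affineAction a (Finsupp.single k x) =
      ∑ n ∈ Finset.range (k + 1), Finsupp.single (k - n) ⁅a.1 n, x⁆ := by
  simp [affineAction]

/-- `S(q̂₋)^{q̂₊}`. -/
def affineInvariants (q : Type*) [LieRing q] [LieAlgebra ℂ q] :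
    Subalgebra ℂ (SymmetricAlgebra ℂ (AffineNeg q)) :=
  symInvariants (fun a : AffinePos q ↦ affineAction a)

/-- The linear map `x t^(-m) ↦ m x t^(-m - 1)` on `q̂₋`. -/
def translationLin (q : Type*) [LieRing q] [LieAlgebra ℂ q] : AffineNeg q →ₗ[ℂ] AffineNeg q :=
  Finsupp.lsum ℂ fun k ↦ ((k : ℂ) + 1) • Finsupp.lsingle (k + 1)

theorem translationLin_single (k : ℕ) (x : q) :
    translationLin q (Finsupp.single k x) = ((k : ℂ) + 1) • Finsupp.single (k + 1) x := by
  simp [translationLin]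

/-- The translation operator `T`: the derivation of `S(q̂₋)` with
`T (x t^(-m)) = m x t^(-m - 1)`. -/
def translation (q : Type*) [LieRing q] [LieAlgebra ℂ q] :
    Derivation ℂ (SymmetricAlgebra ℂ (AffineNeg q)) (SymmetricAlgebra ℂ (AffineNeg q)) :=
  symDer (translationLin q)

/-- The embedding `S(q) → S(q̂₋)` with `x ↦ x t⁻¹`. -/
def arcEmbedding (q : Type*) [LieRing q] [LieAlgebra ℂ q] :
    SymmetricAlgebra ℂ q →ₐ[ℂ] SymmetricAlgebra ℂ (AffineNeg q) :=
  SymmetricAlgebra.lift (SymmetricAlgebra.ι ℂ (AffineNeg q) ∘ₗ Finsupp.lsingle 0)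

end Affine

end

end ArcInvariants

/-! Write q for the centralizer of e, F_i for the initial forms and M for the Poisson matrix of q,
with entries [b_i, b_j]. Everything rests on one fact about one-forms on q*: those killed by M form
a free module with basis dF_1, ..., dF_ℓ (`HasFreeKernel`).

This fact passes to the arc space of q*. The element b_a t^n kills the variables of level below n
and acts on level n through M. So the top level m of a one-form that vanishes on all these vector
fields is a combination of the dF_i, and subtracting a combination of the d(T^m F_i) lowers the
level (`HasFreeKernel.arc_form`). In particular dG is a combination of the d(T^j F_i) for every
invariant G. The coefficients are unique, hence invariant; Euler's formula recovers G from them, and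
induction on the degree puts G in the algebra generated by the T^j F_i. Independence of the
differentials also gives algebraic independence.

Freeness is derived from g. Let A be the Poisson matrix of g and J the Jacobian matrix of the P_i.
No prime p divides all maximal minors of J: such a p would be a semi-invariant, hence an invariant
H(P) since g is perfect, and a tangent space argument along p = 0 shows that J has full rank there
(`IsLinearAction.exists_not_dvd_det`). Not all of these minors vanish, as the trace invariants show
on a Cartan subalgebra. Since J A = 0, it follows that det(A + Uᵀ V) = c det(J Uᵀ) det(J Vᵀ) with
one fixed c.

Restrict this identity to e + X y and compare powers of X. The block of A along q is X M, and the
complementary block is invertible at X = 0. The condition on the degrees of a good system says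
exactly that the powers of X on the two sides agree. After cancelling them, X = 0 gives the same
identity for M and the Jacobian matrix of the F_i (`IsSliceMatrix.det_identity`). The codimension
hypothesis says that no prime divides all det(M + Uᵀ V), so the minors of the Jacobian matrix of the
F_i have no common prime factor either, and Cramer's rule gives the free kernel. -/

namespace ArcInvariants

open scoped Polynomial

/-! ### Derivations of polynomial rings -/

section PolynomialDerivations

open MvPolynomial

variable {R σ : Type*} [CommRing R]

/-- Both sides are derivations that agree on the variables of `f`. The freedom in `s` lets one
finite index set serve several polynomials in infinitely many variables. -/
theorem derivation_eq_sum_pderiv {M : Type*} [AddCommGroup M] [Module R M]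
    [Module (MvPolynomial σ R) M] [IsScalarTower R (MvPolynomial σ R) M]
    (D : Derivation R (MvPolynomial σ R) M) (f : MvPolynomial σ R) (s : Finset σ)
    (hs : f.vars ⊆ s) : D f = ∑ u ∈ s, pderiv u f • D (X u) := by
  classical
  let G : σ → Derivation R (MvPolynomial σ R) M := fun u ↦
    (LinearMap.toSpanSingleton (MvPolynomial σ R) M (D (X u))).compDer (pderiv u)
  have hG : ∀ g, (∑ u ∈ s, G u) g = ∑ u ∈ s, pderiv u g • D (X u) := by
    intro g
    have := congrFun (map_sum (Derivation.coeFnAddMonoidHom (R := R)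
      (A := MvPolynomial σ R) (M := M)) G s) g
    rw [Finset.sum_apply] at this
    exact this
  rw [← hG]
  apply derivation_eq_of_forall_mem_vars
  intro i hi
  rw [hG, Finset.sum_eq_single i]
  · simp
  · intro j _ hj
    simp [pderiv_X_of_ne hj.symm]
  · exact fun h ↦ absurd (hs hi) h

/-- The commutator of `pderiv i` and `D` is again a derivation, so it is determined by its values on
the variables. This is the formula for the Lie derivative of a differential. -/
theorem derivation_pderiv (D : Derivation R (MvPolynomial σ R) (MvPolynomial σ R))
    (f : MvPolynomial σ R) (s : Finset σ) (hs : f.vars ⊆ s) (i : σ) :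
    D (pderiv i f) = pderiv i (D f) - ∑ u ∈ s, pderiv u f * pderiv i (D (X u)) := by
  classical
  let δ : Derivation R (MvPolynomial σ R) (MvPolynomial σ R) := ⁅pderiv (R := R) i, D⁆
  have h' : ∀ u, δ (X u) = pderiv i (D (X u)) := by
    intro u
    simp only [δ]
    rw [Derivation.commutator_apply, pderiv_X]
    simp [Pi.single_apply, apply_ite D]
  have h : δ f = _ := derivation_eq_sum_pderiv δ f s hs
  simp only [h', smul_eq_mul] at h
  simp only [δ] at h
  rw [Derivation.commutator_apply] at h
  rw [← h]
  ring

theorem eq_C_of_forall_pderiv_eq_zero [CharZero R] [NoZeroDivisors R] {f : MvPolynomial σ R}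
    (h : ∀ i, pderiv i f = 0) : f = C (coeff 0 f) := by
  classical
  ext m
  rw [coeff_C]
  split_ifs with hm
  · rw [hm]
  · obtain ⟨i, hi⟩ : ∃ i, m i ≠ 0 := by
      by_contra! hc
      exact hm (Finsupp.ext fun i ↦ (hc i).symm)
    have h1 := congrArg (coeff (m - Finsupp.single i 1)) (h i)
    rw [coeff_pderiv, coeff_zero, mul_eq_zero] at h1
    have h2 : m - Finsupp.single i 1 + Finsupp.single i 1 = m := by
      apply tsub_add_cancel_of_le
      rw [Finsupp.single_le_iff]
      omega
    rw [h2] at h1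
    exact h1.resolve_right (Nat.cast_add_one_ne_zero _)

theorem totalDegree_pderiv_add_one_le {f : MvPolynomial σ R} {i : σ} (h : pderiv i f ≠ 0) :
    (pderiv i f).totalDegree + 1 ≤ f.totalDegree := by
  classical
  have key : ∀ m ∈ (pderiv i f).support, m.degree + 1 ≤ f.totalDegree := by
    intro m hm
    rw [mem_support_iff, coeff_pderiv] at hm
    have h1 : m + Finsupp.single i 1 ∈ f.support := by
      rw [mem_support_iff]
      exact left_ne_zero_of_mul hm
    have := le_totalDegree h1
    have h2 : (m + Finsupp.single i 1).degree = m.degree + 1 := by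
      simp
    rw [← h2]
    exact this
  obtain ⟨m, hm⟩ := support_nonempty.mpr h
  have h1 := key m hm
  have h2 : (pderiv i f).totalDegree ≤ f.totalDegree - 1 := by
    refine Finset.sup_le fun m hm ↦ ?_
    have := key m hm
    have h3 : (m.sum fun _ e ↦ e) = m.degree := rfl
    omega
  omega

/-- A partial derivative has smaller degree, so it is divisible by `p` only if it is zero. -/
theorem exists_pderiv_not_dvd [CharZero R] [IsDomain R] {p : MvPolynomial σ R}
    (hp : p ≠ C (coeff 0 p)) : ∃ i, ¬ p ∣ pderiv i p := by
  by_contra! hc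
  apply hp
  apply eq_C_of_forall_pderiv_eq_zero
  intro i
  by_contra hi
  obtain ⟨q, hq⟩ := hc i
  have h1 := totalDegree_pderiv_add_one_le hi
  have hq0 : q ≠ 0 := by rintro rfl; simp [hq] at hi
  have hp0 : p ≠ 0 := by rintro rfl; simp at hi
  rw [hq, totalDegree_mul_of_isDomain hp0 hq0] at h1
  omega

theorem totalDegree_derivation_le (D : Derivation R (MvPolynomial σ R) (MvPolynomial σ R))
    (hD : ∀ i, (D (X i)).totalDegree ≤ 1) (f : MvPolynomial σ R) :
    (D f).totalDegree ≤ f.totalDegree := by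
  rw [derivation_eq_sum_pderiv D f f.vars le_rfl]
  refine totalDegree_finsetSum_le fun i _ ↦ ?_
  by_cases h : pderiv i f = 0
  · simp [h]
  · have h1 := totalDegree_pderiv_add_one_le h
    refine (totalDegree_mul _ _).trans ?_
    have := hD i
    omega

/-- First order Taylor expansion along a homomorphism to dual numbers. -/
theorem snd_ringHom_dualNumber {A : Type*} [CommRing A] [Fintype σ]
    (Θ : MvPolynomial σ R →+* DualNumber A) (hC : ∀ r, (Θ (C r)).snd = 0)
    (f : MvPolynomial σ R) :
    (Θ f).snd = ∑ i, (Θ (X i)).snd * (Θ (pderiv i f)).fst := by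
  classical
  induction f using MvPolynomial.induction_on with
  | C r => simp [hC]
  | add p q hp hq => simp [hp, hq, mul_add, Finset.sum_add_distrib]
  | mul_X p j hp =>
    simp only [map_mul, TrivSqZeroExt.snd_mul, hp, Derivation.leibniz, pderiv_X, smul_eq_mul,
      map_add, TrivSqZeroExt.fst_add, TrivSqZeroExt.fst_mul, mul_add, Finset.sum_add_distrib]
    have h1 : ∀ i, (Θ ((Pi.single i (1 : MvPolynomial σ R) : σ → MvPolynomial σ R) j)).fst =
        if i = j then 1 else 0 := by
      intro i
      rw [Pi.single_apply]
      by_cases h : j = i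
      · simp [h]
      · simp [h, Ne.symm h]
    simp only [h1, mul_ite, mul_one, mul_zero, Finset.sum_ite_eq', Finset.mem_univ, if_true,
      MulOpposite.smul_eq_mul_unop, MulOpposite.unop_op, Finset.sum_mul]
    refine congrArg₂ (· + ·) ?_ (Finset.sum_congr rfl fun i _ ↦ by ring)
    ring

end PolynomialDerivations

/-! ### Determinants -/

section Determinants

open Matrix

variable {R n m : Type*} [CommRing R] [Fintype n] [DecidableEq n] [Fintype m] [DecidableEq m]

/-- Adding a product of small matrices to a matrix with kernel `J` on both sides. -/
theorem det_add_transpose_mul (A : Matrix n n R) (J U U₀ V V₀ : Matrix m n R) (hl : J * A = 0)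
    (hr : A * Jᵀ = 0) (hU : J * U₀ᵀ = 1) (hV : J * V₀ᵀ = 1) :
    (A + Uᵀ * V).det = (A + U₀ᵀ * V₀).det * (J * Uᵀ).det * (J * Vᵀ).det := by
  have hV' : V₀ * Jᵀ = 1 := by
    rw [← transpose_inj, transpose_mul, transpose_transpose, hV, transpose_one]
  -- The left factor turns `U₀` into `U` without changing `A`, because `J * A = 0` and `J * U₀ᵀ =
  -- 1`; the right factor does the same for `V`. Both factors have small determinants by Sylvester's
  -- identity.
  have h : A + Uᵀ * V = (1 + (Uᵀ - U₀ᵀ) * J) * (A + U₀ᵀ * V₀) * (1 + Jᵀ * (V - V₀)) := by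
    have h1 : (1 + (Uᵀ - U₀ᵀ) * J) * (A + U₀ᵀ * V₀) = A + Uᵀ * V₀ := by
      rw [add_mul, one_mul, mul_add (_ * J), Matrix.mul_assoc _ J A, hl, Matrix.mul_zero,
        ← Matrix.mul_assoc _ _ V₀, Matrix.mul_assoc _ J, hU, Matrix.mul_one, Matrix.sub_mul]
      abel
    rw [h1, mul_add, mul_one, add_mul, ← Matrix.mul_assoc A, hr, Matrix.zero_mul,
      ← Matrix.mul_assoc _ Jᵀ, Matrix.mul_assoc _ V₀, hV', Matrix.mul_one, Matrix.mul_sub]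
    abel
  have e1 : (1 + (Uᵀ - U₀ᵀ) * J).det = (J * Uᵀ).det := by
    rw [Matrix.det_one_add_mul_comm, Matrix.mul_sub, hU, add_sub_cancel]
  have e2 : (1 + Jᵀ * (V - V₀)).det = (J * Vᵀ).det := by
    rw [Matrix.det_one_add_mul_comm, Matrix.sub_mul, hV', add_sub_cancel, ← det_transpose,
      transpose_mul, transpose_transpose]
  rw [h, det_mul, det_mul, e1, e2]
  ring

theorem derivation_prod {S ι : Type*} [CommRing S] [Algebra R S] [DecidableEq ι]
    (D : Derivation R S S) (s : Finset ι) (f : ι → S) :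
    D (∏ i ∈ s, f i) = ∑ i ∈ s, (∏ j ∈ s.erase i, f j) * D (f i) := by
  induction s using Finset.induction_on with
  | empty => simp
  | insert a s ha ih =>
    rw [Finset.prod_insert ha, Derivation.leibniz, ih, Finset.sum_insert ha,
      Finset.erase_insert ha, smul_eq_mul, smul_eq_mul, add_comm, Finset.mul_sum]
    congr 1
    refine Finset.sum_congr rfl fun i hi ↦ ?_
    have hia : i ≠ a := fun h ↦ ha (h ▸ hi)
    rw [Finset.erase_insert_of_ne hia.symm, Finset.prod_insert (by simp [ha])]
    ring

/-- A derivation of a determinant, column by column. -/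
theorem derivation_det {S : Type*} [CommRing S] [Algebra R S] (D : Derivation R S S)
    (A : Matrix n n S) :
    D A.det = ∑ c, (A.updateCol c fun r ↦ D (A r c)).det := by
  simp only [det_apply, map_sum]
  rw [Finset.sum_comm]
  refine Finset.sum_congr rfl fun τ _ ↦ ?_
  have h1 : D (Equiv.Perm.sign τ • ∏ i, A (τ i) i) =
      Equiv.Perm.sign τ • D (∏ i, A (τ i) i) := by
    rw [Units.smul_def, Units.smul_def, map_zsmul]
  rw [h1, derivation_prod, Finset.smul_sum]
  refine Finset.sum_congr rfl fun c _ ↦ ?_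
  congr 1
  rw [← Finset.mul_prod_erase _ _ (Finset.mem_univ c), updateCol_self, mul_comm]
  congr 1
  refine Finset.prod_congr rfl fun j hj ↦ ?_
  rw [updateCol_ne (Finset.ne_of_mem_erase hj)]

end Determinants

end ArcInvariants

namespace ArcInvariants

/-! ### Homogeneous components and algebraic independence -/

section Homogeneous

open MvPolynomial

variable {σ : Type*}

theorem homogeneousComponent_mul_of_isHomogeneous {R : Type*} [CommRing R]
    (f : MvPolynomial σ R) {g : MvPolynomial σ R} {e : ℕ} (hg : g.IsHomogeneous e) (n : ℕ) :
    homogeneousComponent n (f * g) =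
      if e ≤ n then homogeneousComponent (n - e) f * g else 0 := by
  have h : f * g = ∑ i ∈ Finset.range (f.totalDegree + 1), homogeneousComponent i f * g := by
    rw [← Finset.sum_mul, sum_homogeneousComponent]
  rw [h, map_sum]
  have h1 : ∀ i, homogeneousComponent n (homogeneousComponent i f * g) =
      if i + e = n then homogeneousComponent i f * g else 0 := fun i ↦ by
    rw [homogeneousComponent_of_mem
      (((homogeneousComponent_isHomogeneous i f).mul hg : (_ * g).IsHomogeneous (i + e)))]
    simp [eq_comm]
  simp only [h1]
  split_ifs with he
  · by_cases hn : n - e < f.totalDegree + 1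
    · rw [Finset.sum_eq_single (n - e)]
      · rw [if_pos (by omega)]
      · intro i _ hi
        rw [if_neg (by omega)]
      · intro h; simp at h; omega
    · rw [homogeneousComponent_eq_zero _ _ (by omega), zero_mul]
      refine Finset.sum_eq_zero fun i hi ↦ ?_
      simp at hi
      rw [if_neg (by omega)]
  · refine Finset.sum_eq_zero fun i _ ↦ ?_
    rw [if_neg (by omega)]

theorem isHomogeneous_derivation {R : Type*} [CommRing R]
    (D : Derivation R (MvPolynomial σ R) (MvPolynomial σ R))
    (hD : ∀ i, (D (X i)).IsHomogeneous 1) {f : MvPolynomial σ R} {n : ℕ}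
    (hf : f.IsHomogeneous n) : (D f).IsHomogeneous n := by
  rcases Nat.eq_zero_or_pos n with rfl | hn
  · rw [← totalDegree_zero_iff_isHomogeneous, totalDegree_eq_zero_iff_eq_C] at hf
    rw [hf, derivation_C]
    exact isHomogeneous_zero _ _ _
  · rw [derivation_eq_sum_pderiv D f f.vars le_rfl]
    refine IsHomogeneous.sum _ _ _ fun i _ ↦ ?_
    have := (hf.pderiv (i := i)).mul (hD i)
    rwa [Nat.sub_add_cancel hn] at this

theorem derivation_homogeneousComponent_eq_zero {R : Type*} [CommRing R]
    (D : Derivation R (MvPolynomial σ R) (MvPolynomial σ R))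
    (hD : ∀ i, (D (X i)).IsHomogeneous 1) {f : MvPolynomial σ R} (hf : D f = 0) (n : ℕ) :
    D (homogeneousComponent n f) = 0 := by
  have h := congrArg (homogeneousComponent n) hf
  rw [map_zero, ← sum_homogeneousComponent f, map_sum, map_sum] at h
  have h1 : ∀ i, homogeneousComponent n (D (homogeneousComponent i f)) =
      if n = i then D (homogeneousComponent i f) else 0 := fun i ↦
    homogeneousComponent_of_mem
      (isHomogeneous_derivation D hD (homogeneousComponent_isHomogeneous i f))
  simp only [h1, Finset.sum_ite_eq, Finset.mem_range] at h
  split_ifs at h with hn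
  · exact h
  · rw [homogeneousComponent_eq_zero _ _ (by omega), map_zero]

/-- The derivation that fixes every variable multiplies a monomial by its degree: this is Euler's
formula, over any finite set containing the variables. -/
theorem sum_X_mul_pderiv_of_subset {R : Type*} [CommRing R] {f : MvPolynomial σ R} {n : ℕ}
    (hf : f.IsHomogeneous n) (s : Finset σ) (hs : f.vars ⊆ s) :
    ∑ u ∈ s, X u * pderiv u f = n • f := by
  have h := derivation_eq_sum_pderiv (mkDerivation R (X : σ → MvPolynomial σ R)) f s hs
  simp only [mkDerivation_X, smul_eq_mul] at h
  simp only [mul_comm (X _)]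
  rw [← h]
  conv_lhs => rw [f.as_sum]
  conv_rhs => rw [f.as_sum]
  rw [map_sum, Finset.smul_sum]
  refine Finset.sum_congr rfl fun m hm ↦ ?_
  rw [mkDerivation_monomial]
  have hm' : m.degree = n := by
    by_contra hc
    exact (mem_support_iff.mp hm) (hf.coeff_eq_zero hc)
  have h2 : ∀ i ∈ m.support, (monomial (m - Finsupp.single i 1)) ((m i : R)) • (X i) =
      (monomial m (m i : R) : MvPolynomial σ R) := by
    intro i hi
    rw [smul_eq_mul, X, monomial_mul, mul_one]
    congr 2
    apply tsub_add_cancel_of_le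
    rw [Finsupp.single_le_iff]
    have := Finsupp.mem_support_iff.mp hi
    omega
  rw [Finsupp.sum, Finset.sum_congr rfl h2, ← map_sum, ← Nat.cast_sum, smul_monomial,
    ← map_nsmul]
  congr 1
  rw [← hm', Finsupp.degree, smul_eq_mul, nsmul_eq_mul, mul_comm]
  rfl

theorem mem_of_pderiv_eq_zero_of_notMem {R : Type*} [CommRing R] [CharZero R]
    [NoZeroDivisors R] {f : MvPolynomial σ R} {s : Finset σ}
    (h : ∀ u, u ∉ s → pderiv u f = 0) : f.vars ⊆ s := by
  intro u hu
  by_contra hus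
  obtain ⟨m, hm, hmu⟩ := (mem_vars_iff_mem_support u).mp hu
  have h1 := congrArg (coeff (m - Finsupp.single u 1)) (h u hus)
  rw [coeff_pderiv, coeff_zero, mul_eq_zero] at h1
  have h2 : m - Finsupp.single u 1 + Finsupp.single u 1 = m := by
    apply tsub_add_cancel_of_le
    rw [Finsupp.single_le_iff]
    have := Finsupp.mem_support_iff.mp hmu
    omega
  rw [h2] at h1
  exact (mem_support_iff.mp hm) (h1.resolve_right (Nat.cast_add_one_ne_zero _))

theorem derivation_aeval {R A α : Type*} [CommRing R] [CommRing A] [Algebra R A]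
    (D : Derivation R A A) (x : α → A) (p : MvPolynomial α R) :
    D (aeval x p) = ∑ a ∈ p.vars, aeval x (pderiv a p) * D (x a) := by
  let φ : MvPolynomial α R →ₐ[R] A := aeval x
  -- With `A` an algebra over the polynomial ring through `x`, the composite of `D` with the
  -- evaluation is a derivation of the polynomial ring, determined by its values on the variables.
  let : Algebra (MvPolynomial α R) A := φ.toRingHom.toAlgebra
  have : IsScalarTower R (MvPolynomial α R) A := by
    refine IsScalarTower.of_algebraMap_eq fun r ↦ ?_
    change _ = φ (algebraMap R _ r)
    rw [φ.commutes]
  have h := derivation_eq_sum_pderiv (D.compAlgebraMap (MvPolynomial α R)) p p.vars le_rfl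
  have h1 : ∀ q : MvPolynomial α R, D.compAlgebraMap (MvPolynomial α R) q = D (φ q) :=
    fun _ ↦ rfl
  simp only [h1] at h
  rw [h]
  refine Finset.sum_congr rfl fun a _ ↦ ?_
  rw [Algebra.smul_def]
  change φ _ * D (φ (X a)) = _
  simp [φ]

/-- Elements with linearly independent differentials are algebraically independent. -/
theorem algebraicIndependent_of_pderiv {α R : Type*} [CommRing R] [CharZero R] [IsDomain R]
    (x : α → MvPolynomial σ R)
    (h : ∀ (s : Finset α) (c : α → MvPolynomial σ R),
      (∀ u, ∑ a ∈ s, c a * pderiv u (x a) = 0) → ∀ a ∈ s, c a = 0) :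
    AlgebraicIndependent R x := by
  rw [algebraicIndependent_iff]
  -- Induction on the degree of a relation: differentiating it gives a relation between the
  -- differentials, so its partial derivatives are relations of smaller degree and vanish.
  suffices H : ∀ (n : ℕ) (p : MvPolynomial α R), p.totalDegree < n → aeval x p = 0 → p = 0 from
    fun p ↦ H _ p (Nat.lt_succ_self _)
  intro n
  induction n with
  | zero => intro p hp; omega
  | succ n ih =>
    intro p hp h0
    have h1 := h p.vars (fun a ↦ aeval x (pderiv a p)) fun u ↦ by
      rw [← derivation_aeval, h0, map_zero]
    have h2 : ∀ a, pderiv a p = 0 := by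
      intro a
      by_cases ha : a ∈ p.vars
      · by_contra hne
        have := totalDegree_pderiv_add_one_le hne
        exact hne (ih _ (by omega) (h1 a ha))
      · exact pderiv_eq_zero_of_notMem_vars ha
    rw [eq_C_of_forall_pderiv_eq_zero h2] at h0 ⊢
    rw [aeval_C] at h0
    have : coeff 0 p = 0 := (map_eq_zero_iff _
      (by rw [algebraMap_eq]; exact C_injective σ R)).mp h0
    rw [this, map_zero]

end Homogeneous

end ArcInvariants

namespace ArcInvariants

noncomputable section

/-! ### Invariants of arcs -/

section Arcs

open MvPolynomial

variable {ι κ : Type*}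

theorem coeff_mul_C' {R : Type*} [CommRing R] (m : ι →₀ ℕ) (p : MvPolynomial ι R) (r : R) :
    coeff m (p * C r) = coeff m p * r := by
  rw [mul_comm, coeff_C_mul, mul_comm]

/-- The embedding of the polynomial functions into the functions on the arc space. -/
def arcBase (ι : Type*) : MvPolynomial ι ℂ →ₐ[ℂ] MvPolynomial (ℕ × ι) ℂ :=
  rename fun k ↦ (0, k)

/-- The translation derivation in coordinates. -/
def arcShift (ι : Type*) :
    Derivation ℂ (MvPolynomial (ℕ × ι) ℂ) (MvPolynomial (ℕ × ι) ℂ) :=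
  mkDerivation ℂ fun s ↦ C ((s.1 : ℂ) + 1) * X (s.1 + 1, s.2)

theorem arcShift_X (s : ℕ × ι) :
    arcShift ι (X s) = C ((s.1 : ℂ) + 1) * X (s.1 + 1, s.2) := mkDerivation_X ..

/-- The shift sends the variable of level p - 1 to p times that of level p, which gives the
commutator of the two derivations. For p = 0 the coefficient vanishes, so the truncated p - 1 is
harmless. -/
theorem pderiv_arcShift (p : ℕ) (k : ι) (G : MvPolynomial (ℕ × ι) ℂ) :
    pderiv (p, k) (arcShift ι G) =
      arcShift ι (pderiv (p, k) G) + (p : ℂ) • pderiv (p - 1, k) G := by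
  classical
  let δ : Derivation ℂ (MvPolynomial (ℕ × ι) ℂ) (MvPolynomial (ℕ × ι) ℂ) :=
    ⁅pderiv (R := ℂ) (p, k), arcShift ι⁆
  have h : δ = (p : ℂ) • pderiv (p - 1, k) := by
    apply derivation_ext
    rintro ⟨i, j⟩
    simp only [δ]
    rw [Derivation.commutator_apply, arcShift_X, pderiv_C_mul, pderiv_X, pderiv_X,
      Derivation.smul_apply, pderiv_X]
    have h0 : arcShift ι ((Pi.single (p, k) (1 : MvPolynomial (ℕ × ι) ℂ) :
        ℕ × ι → MvPolynomial (ℕ × ι) ℂ) (i, j)) = 0 := by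
      rw [Pi.single_apply]
      split_ifs <;> simp
    rw [h0, sub_zero]
    simp only [Pi.single_apply, Prod.mk.injEq]
    rcases p with _ | p
    · simp
    · by_cases hi : i = p
      · subst hi
        by_cases hj : j = k
        · simp [hj, smul_eq_C_mul]
        · simp [hj]
      · simp [hi]
  have := DFunLike.congr_fun h G
  simp only [δ] at this
  rw [Derivation.commutator_apply, Derivation.smul_apply] at this
  rw [← this]
  ring

theorem pderiv_arcBase_zero (k : ι) (f : MvPolynomial ι ℂ) :
    pderiv (0, k) (arcBase ι f) = arcBase ι (pderiv k f) :=
  pderiv_rename (f := fun k : ι ↦ ((0 : ℕ), k)) (fun _ _ h ↦ (Prod.mk.inj h).2) ..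

theorem pderiv_arcBase_succ (p : ℕ) (k : ι) (f : MvPolynomial ι ℂ) :
    pderiv (p + 1, k) (arcBase ι f) = 0 := by
  classical
  apply pderiv_eq_zero_of_notMem_vars
  intro h
  have := vars_rename _ _ h
  simp at this

theorem pderiv_iterate_of_lt (f : MvPolynomial ι ℂ) (j p : ℕ) (h : j < p) (k : ι) :
    pderiv (p, k) ((arcShift ι)^[j] (arcBase ι f)) = 0 := by
  induction j generalizing p with
  | zero =>
    obtain ⟨p, rfl⟩ := Nat.exists_eq_succ_of_ne_zero h.ne'
    exact pderiv_arcBase_succ ..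
  | succ j ih =>
    rw [Function.iterate_succ_apply', pderiv_arcShift, ih p (by omega), map_zero,
      ih (p - 1) (by omega), smul_zero, add_zero]

/-- Each shift raises the top level by one and contributes one factor of the factorial. These are
the diagonal blocks of the triangular system formed by the differentials of the translates. -/
theorem pderiv_iterate_self (f : MvPolynomial ι ℂ) (j : ℕ) (k : ι) :
    pderiv (j, k) ((arcShift ι)^[j] (arcBase ι f)) =
      (j.factorial : ℂ) • arcBase ι (pderiv k f) := by
  induction j with
  | zero => simp [pderiv_arcBase_zero]
  | succ j ih =>
    rw [Function.iterate_succ_apply', pderiv_arcShift, pderiv_iterate_of_lt _ _ _ (by omega),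
      map_zero, zero_add, Nat.add_sub_cancel, ih, smul_smul, Nat.factorial_succ]
    push_cast
    rfl

theorem isHomogeneous_iterate {f : MvPolynomial ι ℂ} {n : ℕ} (hf : f.IsHomogeneous n) (j : ℕ) :
    ((arcShift ι)^[j] (arcBase ι f)).IsHomogeneous n := by
  induction j with
  | zero => exact hf.rename_isHomogeneous
  | succ j ih =>
    rw [Function.iterate_succ_apply']
    refine isHomogeneous_derivation _ (fun s ↦ ?_) ih
    rw [arcShift_X]
    exact (isHomogeneous_X _ _).C_mul _

/-- The variables of level `0` against those of positive level. -/
def arcLevelEquiv (ι : Type*) : ℕ × ι ≃ (ℕ × ι) ⊕ ι where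
  toFun s := match s with
    | (0, k) => Sum.inr k
    | (p + 1, k) => Sum.inl (p, k)
  invFun s := match s with
    | Sum.inr k => (0, k)
    | Sum.inl (p, k) => (p + 1, k)
  left_inv s := by rcases s with ⟨_ | p, k⟩ <;> rfl
  right_inv s := by rcases s with ⟨p, k⟩ | k <;> rfl

/-- Functions on the arc space as polynomials over the ring of functions of level `0`. -/
def arcLevelAlgEquiv (ι : Type*) :
    MvPolynomial (ℕ × ι) ℂ ≃ₐ[ℂ] MvPolynomial (ℕ × ι) (MvPolynomial ι ℂ) :=
  (renameEquiv ℂ (arcLevelEquiv ι)).trans (sumAlgEquiv ℂ (ℕ × ι) ι)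

theorem arcLevelAlgEquiv_arcBase (f : MvPolynomial ι ℂ) :
    arcLevelAlgEquiv ι (arcBase ι f) = C f := by
  have h : (arcLevelAlgEquiv ι).toAlgHom.comp (arcBase ι) =
      IsScalarTower.toAlgHom ℂ (MvPolynomial ι ℂ)
        (MvPolynomial (ℕ × ι) (MvPolynomial ι ℂ)) := by
    apply MvPolynomial.algHom_ext
    intro k
    simp [arcLevelAlgEquiv, arcBase, arcLevelEquiv]
  exact DFunLike.congr_fun h f

/-- The data of a Lie algebra acting on a polynomial ring such that the kernel of the action on
one-forms is freely generated by the differentials of the `F i`. -/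
structure HasFreeKernel [Fintype ι] [Fintype κ] (M : ι → ι → MvPolynomial ι ℂ)
    (F : κ → MvPolynomial ι ℂ) : Prop where
  exists_of_kernel : ∀ v : ι → MvPolynomial ι ℂ, (∀ a, ∑ k, v k * M a k = 0) →
    ∃ c : κ → MvPolynomial ι ℂ, ∀ k, v k = ∑ i, c i * pderiv k (F i)
  independent : ∀ c : κ → MvPolynomial ι ℂ, (∀ k, ∑ i, c i * pderiv k (F i) = 0) → c = 0

variable [Fintype ι] [Fintype κ] {M : ι → ι → MvPolynomial ι ℂ} {F : κ → MvPolynomial ι ℂ}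

/-- The equations have coefficients of level 0, so they can be solved separately for each monomial
in the variables of positive level. -/
theorem HasFreeKernel.arc_exists (h : HasFreeKernel M F) (v : ι → MvPolynomial (ℕ × ι) ℂ)
    (hv : ∀ a, ∑ k, v k * arcBase ι (M a k) = 0) :
    ∃ c : κ → MvPolynomial (ℕ × ι) ℂ,
      ∀ k, v k = ∑ i, c i * arcBase ι (pderiv k (F i)) := by
  classical
  let Φ := arcLevelAlgEquiv ι
  have h1 : ∀ m, ∃ c : κ → MvPolynomial ι ℂ,
      ∀ k, coeff m (Φ (v k)) = ∑ i, c i * pderiv k (F i) := by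
    intro m
    apply h.exists_of_kernel
    intro a
    have := congrArg (fun f ↦ coeff m (Φ f)) (hv a)
    simpa [Φ, arcLevelAlgEquiv_arcBase, coeff_sum, coeff_mul_C'] using this
  choose c hc using h1
  let S : Finset ((ℕ × ι) →₀ ℕ) := Finset.univ.biUnion fun k ↦ (Φ (v k)).support
  refine ⟨fun i ↦ Φ.symm (∑ m ∈ S, monomial m (c m i)), fun k ↦ ?_⟩
  apply Φ.injective
  ext1 m
  simp only [map_sum, map_mul, AlgEquiv.apply_symm_apply]
  simp only [Φ, arcLevelAlgEquiv_arcBase, coeff_sum, coeff_mul_C']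
  by_cases hm : m ∈ S
  · change coeff m (Φ (v k)) = _
    rw [hc]
    refine Finset.sum_congr rfl fun i _ ↦ ?_
    simp [coeff_monomial, hm]
  · have h2 : coeff m (Φ (v k)) = 0 := by
      by_contra hne
      exact hm (Finset.mem_biUnion.mpr ⟨k, Finset.mem_univ _, mem_support_iff.mpr hne⟩)
    change coeff m (Φ (v k)) = _
    rw [h2]
    symm
    refine Finset.sum_eq_zero fun i _ ↦ ?_
    simp [coeff_monomial, hm]

theorem HasFreeKernel.arc_independent (h : HasFreeKernel M F)
    (c : κ → MvPolynomial (ℕ × ι) ℂ)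
    (hc : ∀ k, ∑ i, c i * arcBase ι (pderiv k (F i)) = 0) : c = 0 := by
  let Φ := arcLevelAlgEquiv ι
  funext i
  apply Φ.injective
  ext1 m
  have := h.independent (fun i ↦ coeff m (Φ (c i))) fun k ↦ by
    have := congrArg (fun f ↦ coeff m (Φ f)) (hc k)
    simpa [Φ, arcLevelAlgEquiv_arcBase, coeff_sum, coeff_mul_C'] using this
  simpa using congrFun this i

/-- At the highest level only the translates with the largest j contribute, each through m! times
the differential of `F i`; so their coefficients vanish, and one descends. -/
theorem HasFreeKernel.arc_triangular (h : HasFreeKernel M F) (m : ℕ)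
    (c : ℕ → κ → MvPolynomial (ℕ × ι) ℂ)
    (hc : ∀ u, ∑ j ∈ Finset.range m, ∑ i,
      c j i * pderiv u ((arcShift ι)^[j] (arcBase ι (F i))) = 0) :
    ∀ j < m, ∀ i, c j i = 0 := by
  induction m with
  | zero => intro j hj; omega
  | succ m ih =>
    have h1 : c m = 0 := by
      apply h.arc_independent
      intro k
      have h2 := hc (m, k)
      rw [Finset.sum_range_succ, Finset.sum_eq_zero, zero_add] at h2
      · simp only [pderiv_iterate_self, mul_smul_comm, ← Finset.smul_sum] at h2
        exact (smul_eq_zero.mp h2).resolve_left (by exact_mod_cast m.factorial_ne_zero)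
      · intro j hj
        refine Finset.sum_eq_zero fun i _ ↦ ?_
        rw [pderiv_iterate_of_lt _ _ _ (Finset.mem_range.mp hj), mul_zero]
    intro j hj i
    rcases Nat.lt_succ_iff_lt_or_eq.mp hj with hj | rfl
    · refine ih (fun u ↦ ?_) j hj i
      have h2 := hc u
      rw [Finset.sum_range_succ, h1] at h2
      simpa using h2
    · rw [h1]; rfl

theorem vars_iterate_subset (f : MvPolynomial ι ℂ) (j : ℕ) :
    ((arcShift ι)^[j] (arcBase ι f)).vars ⊆ Finset.range (j + 1) ×ˢ Finset.univ := by
  apply mem_of_pderiv_eq_zero_of_notMem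
  rintro ⟨p, k⟩ hu
  apply pderiv_iterate_of_lt
  simp at hu
  omega

/-! ### One-forms and invariants on the arc space -/

/-- A family of derivations of the functions on the arc space that acts through `M` on the
leading level and annihilates the translates of the `F i`. -/
structure IsArcAction (M : ι → ι → MvPolynomial ι ℂ) (F : κ → MvPolynomial ι ℂ)
    (δ : ℕ → ι → Derivation ℂ (MvPolynomial (ℕ × ι) ℂ) (MvPolynomial (ℕ × ι) ℂ)) : Prop where
  homogeneous : ∀ n a s, (δ n a (X s)).IsHomogeneous 1
  eq_zero : ∀ n a p k, p < n → δ n a (X (p, k)) = 0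
  leading : ∀ n a k, δ n a (X (n, k)) = arcBase ι (M a k)
  invariant : ∀ n a j i, δ n a ((arcShift ι)^[j] (arcBase ι (F i))) = 0

variable {δ : ℕ → ι → Derivation ℂ (MvPolynomial (ℕ × ι) ℂ) (MvPolynomial (ℕ × ι) ℂ)}

/-- The derivations of level m see only the component of `ω` of level m, and see it through `M`.
That component is thus a combination of the dF_i and can be removed with the m-th translates. -/
theorem HasFreeKernel.arc_form (h : HasFreeKernel M F) (hδ : IsArcAction M F δ) (m : ℕ)
    (ω : ℕ × ι → MvPolynomial (ℕ × ι) ℂ) (h0 : ∀ p k, m ≤ p → ω (p, k) = 0)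
    (hω : ∀ n a, ∑ u ∈ Finset.range m ×ˢ Finset.univ, ω u * δ n a (X u) = 0) :
    ∃ c : ℕ → κ → MvPolynomial (ℕ × ι) ℂ, ∀ u, ω u = ∑ j ∈ Finset.range m, ∑ i,
      c j i * pderiv u ((arcShift ι)^[j] (arcBase ι (F i))) := by
  induction m generalizing ω with
  | zero => exact ⟨0, fun u ↦ by simp [h0 u.1 u.2 (Nat.zero_le _)]⟩
  | succ m ih =>
    obtain ⟨c₀, hc₀⟩ := h.arc_exists (fun k ↦ ω (m, k)) fun a ↦ by
      have h1 := hω m a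
      rw [Finset.sum_product, Finset.sum_range_succ, Finset.sum_eq_zero, zero_add] at h1
      · simpa only [hδ.leading] using h1
      · intro p hp
        refine Finset.sum_eq_zero fun k _ ↦ ?_
        rw [hδ.eq_zero _ _ _ _ (Finset.mem_range.mp hp), mul_zero]
    have hm : (m.factorial : ℂ) ≠ 0 := by exact_mod_cast m.factorial_ne_zero
    -- The level m part of d(T^m F_i) is m! dF_i, hence the division.
    let c₁ : κ → MvPolynomial (ℕ × ι) ℂ := fun i ↦ (m.factorial : ℂ)⁻¹ • c₀ i
    let ω' : ℕ × ι → MvPolynomial (ℕ × ι) ℂ := fun u ↦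
      ω u - ∑ i, c₁ i * pderiv u ((arcShift ι)^[m] (arcBase ι (F i)))
    have hm' : ∀ k, ω' (m, k) = 0 := by
      intro k
      simp only [ω', c₁, pderiv_iterate_self]
      rw [hc₀ k, sub_eq_zero]
      refine Finset.sum_congr rfl fun i _ ↦ ?_
      rw [smul_mul_smul_comm, inv_mul_cancel₀ hm, one_smul]
    obtain ⟨c, hc⟩ := ih ω' (fun p k hp ↦ by
        rcases hp.eq_or_lt with rfl | hp
        · exact hm' k
        · simp only [ω']
          rw [h0 p k hp, zero_sub, neg_eq_zero]
          refine Finset.sum_eq_zero fun i _ ↦ ?_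
          rw [pderiv_iterate_of_lt _ _ _ hp, mul_zero])
      fun n a ↦ by
        -- The subtracted differentials pair to zero with every `δ n a`, because the translates are
        -- invariant.
        have h1 : ∑ u ∈ Finset.range (m + 1) ×ˢ Finset.univ, ω' u * δ n a (X u) = 0 := by
          simp only [ω', sub_mul, Finset.sum_sub_distrib]
          rw [hω, zero_sub, neg_eq_zero]
          simp only [Finset.sum_mul]
          rw [Finset.sum_comm]
          refine Finset.sum_eq_zero fun i _ ↦ ?_
          simp only [mul_assoc]
          rw [← Finset.mul_sum]
          have := derivation_eq_sum_pderiv (δ n a) _ _ (vars_iterate_subset (F i) m)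
          simp only [smul_eq_mul] at this
          rw [← this, hδ.invariant, mul_zero]
        rw [Finset.sum_product, Finset.sum_range_succ] at h1
        simpa [hm', Finset.sum_product] using h1
    refine ⟨fun j ↦ if j = m then c₁ else c j, fun u ↦ ?_⟩
    rw [Finset.sum_range_succ]
    beta_reduce
    rw [if_pos rfl]
    have h2 : ω u = ω' u + ∑ i, c₁ i * pderiv u ((arcShift ι)^[m] (arcBase ι (F i))) := by
      simp only [ω']; ring
    rw [h2, hc]
    congr 1
    refine Finset.sum_congr rfl fun j hj ↦ ?_
    rw [if_neg (Finset.mem_range.mp hj).ne]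

/-- The differential of an invariant is a combination, with invariant coefficients, of the
differentials of the translates of the `F i`. -/
theorem HasFreeKernel.arc_coeff_invariant (h : HasFreeKernel M F) (hδ : IsArcAction M F δ) (m : ℕ)
    {G : MvPolynomial (ℕ × ι) ℂ} (hG : ∀ n a, δ n a G = 0)
    (c : ℕ → κ → MvPolynomial (ℕ × ι) ℂ)
    (hc : ∀ u, pderiv u G = ∑ j ∈ Finset.range m, ∑ i,
      c j i * pderiv u ((arcShift ι)^[j] (arcBase ι (F i)))) (n : ℕ) (a : ι) :
    ∀ j < m, ∀ i, δ n a (c j i) = 0 := by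
  apply h.arc_triangular m (fun j i ↦ δ n a (c j i))
  intro u
  classical
  -- One finite set for `G` and all translates involved. The error made in moving `δ n a` past
  -- `pderiv u` is linear in the differential, so it is the same for dG and for its expansion; what
  -- remains is a relation between the differentials with coefficients `δ n a (c j i)`.
  let S : Finset (ℕ × ι) := G.vars ∪ Finset.range (m + 1) ×ˢ Finset.univ
  have h1 : δ n a (pderiv u G) = -∑ v ∈ S, pderiv v G * pderiv u (δ n a (X v)) := by
    rw [derivation_pderiv _ _ S Finset.subset_union_left, hG, map_zero, zero_sub]
  have h2 : ∀ j ∈ Finset.range m, ∀ i,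
      δ n a (pderiv u ((arcShift ι)^[j] (arcBase ι (F i)))) =
      -∑ v ∈ S, pderiv v ((arcShift ι)^[j] (arcBase ι (F i))) * pderiv u (δ n a (X v)) := by
    intro j hj i
    rw [derivation_pderiv _ _ S, hδ.invariant, map_zero, zero_sub]
    refine (vars_iterate_subset _ _).trans (Finset.Subset.trans ?_ Finset.subset_union_right)
    refine Finset.product_subset_product_left (Finset.range_subset_range.mpr ?_)
    have := Finset.mem_range.mp hj
    omega
  have h3 := h1
  rw [hc u, map_sum] at h3
  simp only [map_sum, Derivation.leibniz, smul_eq_mul, Finset.sum_add_distrib] at h3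
  have h4 : ∑ j ∈ Finset.range m, ∑ i,
      c j i * δ n a (pderiv u ((arcShift ι)^[j] (arcBase ι (F i)))) =
      -∑ v ∈ S, pderiv v G * pderiv u (δ n a (X v)) := by
    have h5 : ∀ j ∈ Finset.range m, ∑ i,
        c j i * δ n a (pderiv u ((arcShift ι)^[j] (arcBase ι (F i)))) =
        -∑ v ∈ S, (∑ i, c j i * pderiv v ((arcShift ι)^[j] (arcBase ι (F i)))) *
          pderiv u (δ n a (X v)) := by
      intro j hj
      simp only [h2 j hj, mul_neg, Finset.sum_neg_distrib, Finset.mul_sum, Finset.sum_mul]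
      rw [Finset.sum_comm]
      simp only [mul_assoc]
    rw [Finset.sum_congr rfl h5, Finset.sum_neg_distrib, Finset.sum_comm]
    simp only [hc, Finset.sum_mul]
  rw [h4, add_eq_left] at h3
  rw [← h3]
  refine Finset.sum_congr rfl fun j _ ↦ Finset.sum_congr rfl fun i _ ↦ mul_comm _ _

/-- Euler's formula writes n G as a sum of invariants of smaller degree times translates, which
allows induction on n. -/
theorem HasFreeKernel.arc_mem_adjoin_of_isHomogeneous (h : HasFreeKernel M F)
    (hδ : IsArcAction M F δ) (d : κ → ℕ) (hF : ∀ i, (F i).IsHomogeneous (d i))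
    (hd : ∀ i, 0 < d i) (n : ℕ) (G : MvPolynomial (ℕ × ι) ℂ) (hGn : G.IsHomogeneous n)
    (hG : ∀ n a, δ n a G = 0) :
    G ∈ Algebra.adjoin ℂ (Set.range fun p : κ × ℕ ↦
      (arcShift ι)^[p.2] (arcBase ι (F p.1))) := by
  induction n using Nat.strong_induction_on generalizing G with
  | _ n ih =>
  rcases Nat.eq_zero_or_pos n with rfl | hn
  · rw [← totalDegree_zero_iff_isHomogeneous, totalDegree_eq_zero_iff_eq_C] at hGn
    rw [hGn]
    exact Subalgebra.algebraMap_mem _ _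
  obtain ⟨m, hm⟩ : ∃ m, ∀ u ∈ G.vars, u.1 < m := by
    refine ⟨(G.vars.sup fun u ↦ u.1) + 1, fun u hu ↦ ?_⟩
    have := Finset.le_sup (f := fun u : ℕ × ι ↦ u.1) hu
    omega
  have hvars : G.vars ⊆ Finset.range m ×ˢ Finset.univ := fun u hu ↦ by
    simp [hm u hu]
  obtain ⟨c, hc⟩ := h.arc_form hδ m (fun u ↦ pderiv u G)
    (fun p k hp ↦ pderiv_eq_zero_of_notMem_vars fun hu ↦ absurd (hm _ hu) (by simpa using hp))
    fun k a ↦ by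
      have := derivation_eq_sum_pderiv (δ k a) G _ hvars
      simp only [smul_eq_mul] at this
      rw [← this, hG]
  -- Only the part of degree n - d_i of a coefficient contributes to dG; the case distinction guards
  -- against truncated subtraction.
  let c' : ℕ → κ → MvPolynomial (ℕ × ι) ℂ := fun j i ↦
    if d i ≤ n then homogeneousComponent (n - d i) (c j i) else 0
  have hc' : ∀ u, pderiv u G = ∑ j ∈ Finset.range m, ∑ i,
      c' j i * pderiv u ((arcShift ι)^[j] (arcBase ι (F i))) := by
    intro u
    have h1 := congrArg (homogeneousComponent (n - 1)) (hc u)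
    rw [homogeneousComponent_of_mem hGn.pderiv, if_pos rfl] at h1
    rw [h1, map_sum]
    refine Finset.sum_congr rfl fun j _ ↦ ?_
    rw [map_sum]
    refine Finset.sum_congr rfl fun i _ ↦ ?_
    rw [homogeneousComponent_mul_of_isHomogeneous _ (isHomogeneous_iterate (hF i) j).pderiv]
    have := hd i
    simp only [c']
    by_cases hi : d i ≤ n
    · rw [if_pos (by omega), if_pos hi]
      congr 3
      omega
    · rw [if_neg (by omega), if_neg hi, zero_mul]
  have hmem : ∀ j < m, ∀ i, c' j i ∈ Algebra.adjoin ℂ (Set.range fun p : κ × ℕ ↦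
      (arcShift ι)^[p.2] (arcBase ι (F p.1))) := by
    intro j hj i
    by_cases hi : d i ≤ n
    · refine ih (n - d i) (by have := hd i; omega) _ ?_
        fun k a ↦ h.arc_coeff_invariant hδ m hG c' hc' k a j hj i
      simp only [c', if_pos hi]
      exact homogeneousComponent_isHomogeneous _ _
    · simp only [c', if_neg hi]
      exact Subalgebra.zero_mem _
  have hE := sum_X_mul_pderiv_of_subset hGn (Finset.range (m + 1) ×ˢ Finset.univ)
    (hvars.trans (Finset.product_subset_product_left (Finset.range_subset_range.mpr (by omega))))
  have hEu : n • G = ∑ j ∈ Finset.range m, ∑ i,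
      c' j i * (d i • (arcShift ι)^[j] (arcBase ι (F i))) := by
    rw [← hE]
    simp only [hc', Finset.mul_sum]
    rw [Finset.sum_comm]
    refine Finset.sum_congr rfl fun j hj ↦ ?_
    rw [Finset.sum_comm]
    refine Finset.sum_congr rfl fun i _ ↦ ?_
    rw [← sum_X_mul_pderiv_of_subset (isHomogeneous_iterate (hF i) j)
      (Finset.range (m + 1) ×ˢ Finset.univ) ((vars_iterate_subset _ _).trans
        (Finset.product_subset_product_left (Finset.range_subset_range.mpr
          (by have := Finset.mem_range.mp hj; omega)))), Finset.mul_sum]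
    refine Finset.sum_congr rfl fun u _ ↦ by ring
  have hnG : n • G ∈ Algebra.adjoin ℂ (Set.range fun p : κ × ℕ ↦
      (arcShift ι)^[p.2] (arcBase ι (F p.1))) := by
    rw [hEu]
    refine Subalgebra.sum_mem _ fun j hj ↦ Subalgebra.sum_mem _ fun i _ ↦ ?_
    refine Subalgebra.mul_mem _ (hmem j (Finset.mem_range.mp hj) i) (Subalgebra.nsmul_mem _ ?_ _)
    exact Algebra.subset_adjoin ⟨(i, j), rfl⟩
  have : G = (n : ℂ)⁻¹ • (n • G) := by
    rw [← Nat.cast_smul_eq_nsmul ℂ, smul_smul, inv_mul_cancel₀ (by exact_mod_cast hn.ne'),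
      one_smul]
  rw [this]
  exact Subalgebra.smul_mem _ hnG _

theorem HasFreeKernel.arc_mem_adjoin (h : HasFreeKernel M F)
    (hδ : IsArcAction M F δ) (d : κ → ℕ) (hF : ∀ i, (F i).IsHomogeneous (d i))
    (hd : ∀ i, 0 < d i) (G : MvPolynomial (ℕ × ι) ℂ) (hG : ∀ n a, δ n a G = 0) :
    G ∈ Algebra.adjoin ℂ (Set.range fun p : κ × ℕ ↦
      (arcShift ι)^[p.2] (arcBase ι (F p.1))) := by
  rw [← sum_homogeneousComponent G]
  refine Subalgebra.sum_mem _ fun i _ ↦ ?_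
  exact h.arc_mem_adjoin_of_isHomogeneous hδ d hF hd i _
    (homogeneousComponent_isHomogeneous _ _)
    fun n a ↦ derivation_homogeneousComponent_eq_zero _ (hδ.homogeneous n a) (hG n a) i

theorem HasFreeKernel.arc_algebraicIndependent (h : HasFreeKernel M F) :
    AlgebraicIndependent ℂ fun p : κ × ℕ ↦ (arcShift ι)^[p.2] (arcBase ι (F p.1)) := by
  classical
  apply algebraicIndependent_of_pderiv
  intro s c hc
  obtain ⟨m, hm⟩ : ∃ m, ∀ u ∈ s, u.2 < m := by
    refine ⟨(s.sup fun u ↦ u.2) + 1, fun u hu ↦ ?_⟩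
    have := Finset.le_sup (f := fun u : κ × ℕ ↦ u.2) hu
    omega
  have h1 := h.arc_triangular m (fun j i ↦ if (i, j) ∈ s then c (i, j) else 0) fun u ↦ by
    refine Eq.trans ?_ (hc u)
    rw [Finset.sum_comm, ← Finset.sum_product',
      ← Finset.sum_subset (s₁ := s)]
    · refine Finset.sum_congr rfl fun a ha ↦ ?_
      simp [ha]
    · intro a ha
      simp [hm a ha]
    · intro a _ ha
      simp [ha]
  intro a ha
  simpa [ha] using h1 a.2 (hm a ha) a.1

end Arcs

end

end ArcInvariants

namespace ArcInvariants

open scoped Polynomial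

noncomputable section

/-! ### Coprime minors -/

section CoprimeMinors

open Matrix

/-- Strip the prime factors of `d` one at a time: each fails to divide some `s`, so it divides `a`
and can be cancelled. -/
theorem dvd_of_forall_dvd_mul {R : Type*} [CommRing R] [IsDomain R] [UniqueFactorizationMonoid R]
    (S : Set R) (hS : ∀ p, Prime p → ∃ s ∈ S, ¬ p ∣ s) {d a : R} (hd : d ≠ 0)
    (h : ∀ s ∈ S, d ∣ s * a) : d ∣ a := by
  induction d using UniqueFactorizationMonoid.induction_on_prime generalizing a with
  | h₁ => exact absurd rfl hd
  | h₂ x hx => exact hx.dvd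
  | h₃ b p hb hp ih =>
    obtain ⟨s, hs, hps⟩ := hS p hp
    obtain ⟨a', rfl⟩ : p ∣ a :=
      (hp.dvd_or_dvd ((dvd_mul_right p b).trans (h s hs))).resolve_left hps
    refine mul_dvd_mul_left p (ih hb fun s hs ↦ ?_)
    have := h s hs
    rw [mul_left_comm] at this
    exact (mul_dvd_mul_iff_left hp.ne_zero).mp this

variable {n m : Type*} [Fintype n] [DecidableEq n] [Fintype m] [DecidableEq m]

/-- Over the fraction field `U₁` can be normalized to some `U₀` with `J * U₀ᵀ = 1`, and the
factorization of `det_add_transpose_mul` applies to all pairs. Clearing the unknown factor leaves an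
identity without denominators. -/
theorem det_sq_mul_det_add {T : Type*} [CommRing T] [IsDomain T] (A : Matrix n n T)
    (J U U₁ V : Matrix m n T) (hl : J * A = 0) (hr : A * Jᵀ = 0) (hU : (J * U₁ᵀ).det ≠ 0) :
    (J * U₁ᵀ).det ^ 2 * (A + Uᵀ * V).det =
      (A + U₁ᵀ * U₁).det * (J * Uᵀ).det * (J * Vᵀ).det := by
  let K := FractionRing T
  let f : T →+* K := algebraMap T K
  have hf : Function.Injective f := IsFractionRing.injective T K
  have hG : IsUnit (J.map f * (U₁.map f)ᵀ).det := by
    rw [isUnit_iff_ne_zero, ← transpose_map, ← Matrix.map_mul, ← RingHom.mapMatrix_apply,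
      ← RingHom.map_det]
    exact (map_ne_zero_iff f hf).mpr hU
  let U₀ : Matrix m n K := ((U₁.map f)ᵀ * (J.map f * (U₁.map f)ᵀ)⁻¹)ᵀ
  have hU₀ : J.map f * U₀ᵀ = 1 := by
    rw [transpose_transpose, ← Matrix.mul_assoc, mul_nonsing_inv _ hG]
  have hl' : J.map f * A.map f = 0 := by
    rw [← Matrix.map_mul, hl, Matrix.map_zero _ (map_zero f)]
  have hr' : A.map f * (J.map f)ᵀ = 0 := by
    rw [← transpose_map, ← Matrix.map_mul, hr, Matrix.map_zero _ (map_zero f)]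
  have key : ∀ U V : Matrix m n T, f (A + Uᵀ * V).det =
      (A.map f + U₀ᵀ * U₀).det * f (J * Uᵀ).det * f (J * Vᵀ).det := by
    intro U V
    have := det_add_transpose_mul (A.map f) (J.map f) (U.map f) U₀ (V.map f) U₀ hl' hr' hU₀ hU₀
    simp only [RingHom.map_det, RingHom.mapMatrix_apply, Matrix.map_mul, transpose_map,
      Matrix.map_add f (map_add f)]
    exact this
  apply hf
  simp only [map_mul, map_pow, key]
  ring

variable {R : Type*} [CommRing R] [IsDomain R] [UniqueFactorizationMonoid R]

/-- If the maximal minors of a matrix `J` annihilated by `A` have no common factor, the minors of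
`A` of complementary size are products of those of `J` with one fixed element. -/
theorem exists_det_add_eq_mul (A : Matrix n n R) (J : Matrix m n R) (hl : J * A = 0)
    (hr : A * Jᵀ = 0) (hex : ∃ U : Matrix m n R, (J * Uᵀ).det ≠ 0)
    (hcop : ∀ p : R, Prime p → ∃ U : Matrix m n R, ¬ p ∣ (J * Uᵀ).det) :
    ∃ c : R, ∀ U V : Matrix m n R[X], (A.map Polynomial.C + Uᵀ * V).det =
      Polynomial.C c * (J.map Polynomial.C * Uᵀ).det * (J.map Polynomial.C * Vᵀ).det := by
  obtain ⟨U₁, hU₁⟩ := hex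
  -- The required constant is this quotient. Multiplied by the square of any other minor, the
  -- dividend becomes divisible by the square of the minor of `U₁`, and these squares have no common
  -- prime factor.
  obtain ⟨c, hc⟩ : (J * U₁ᵀ).det ^ 2 ∣ (A + U₁ᵀ * U₁).det := by
    refine dvd_of_forall_dvd_mul (Set.range fun U : Matrix m n R ↦ (J * Uᵀ).det ^ 2)
      (fun p hp ↦ ?_) (pow_ne_zero 2 hU₁) ?_
    · obtain ⟨U, hU⟩ := hcop p hp
      exact ⟨_, ⟨U, rfl⟩, fun h ↦ hU (hp.dvd_of_dvd_pow h)⟩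
    · rintro _ ⟨U, rfl⟩
      refine ⟨(A + Uᵀ * U).det, ?_⟩
      rw [det_sq_mul_det_add A J U U₁ U hl hr hU₁]
      ring
  refine ⟨c, fun U V ↦ ?_⟩
  have hC : ∀ M : Matrix m m R, (M.map Polynomial.C).det = Polynomial.C M.det := fun M ↦ by
    rw [RingHom.map_det, RingHom.mapMatrix_apply]
  have hC' : ∀ M : Matrix n n R, (M.map Polynomial.C).det = Polynomial.C M.det := fun M ↦ by
    rw [RingHom.map_det, RingHom.mapMatrix_apply]
  have hd : (J.map Polynomial.C * (U₁.map Polynomial.C)ᵀ).det = Polynomial.C (J * U₁ᵀ).det := by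
    rw [← hC, ← transpose_map, ← Matrix.map_mul]
  have h := det_sq_mul_det_add (A.map Polynomial.C) (J.map Polynomial.C) U
    (U₁.map Polynomial.C) V (by rw [← Matrix.map_mul, hl, Matrix.map_zero _ (map_zero _)])
    (by rw [← transpose_map, ← Matrix.map_mul, hr, Matrix.map_zero _ (map_zero _)])
    (by rw [hd]; simpa using hU₁)
  have ha : (A.map Polynomial.C + (U₁.map Polynomial.C)ᵀ * U₁.map Polynomial.C).det =
      Polynomial.C ((J * U₁ᵀ).det ^ 2 * c) := by
    rw [← hc, ← hC', ← transpose_map, ← Matrix.map_mul,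
      ← Matrix.map_add _ (map_add Polynomial.C)]
  rw [hd, ha, map_mul, map_pow] at h
  have h0 : (Polynomial.C (J * U₁ᵀ).det) ^ 2 ≠ 0 := pow_ne_zero 2 (by simpa using hU₁)
  apply mul_left_cancel₀ h0
  rw [h]
  ring

/-- The kernel of a matrix `A` is freely generated by the rows of `J` if the maximal minors of `J`
have no common factor and control the minors of `A` of complementary size. -/
theorem exists_eq_mulVec_of_mulVec_eq_zero (A : Matrix n n R) (J : Matrix m n R)
    (hr : A * Jᵀ = 0)
    (𝒰 : Set (Matrix m n R)) (h𝒰 : ∀ U ∈ 𝒰, (J * Uᵀ).det ≠ 0 → (A + Uᵀ * U).det ≠ 0)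
    (hex : ∃ U ∈ 𝒰, (J * Uᵀ).det ≠ 0)
    (hcop : ∀ p : R, Prime p → ∃ U ∈ 𝒰, ¬ p ∣ (J * Uᵀ).det) (v : n → R) (hv : A *ᵥ v = 0) :
    ∃ c : m → R, v = Jᵀ *ᵥ c := by
  have hJ : ∀ a : m → R, Jᵀ *ᵥ a = 0 → a = 0 := by
    intro a ha
    obtain ⟨U, -, hU⟩ := hex
    apply eq_zero_of_mulVec_eq_zero (M := U * Jᵀ)
    · rwa [← det_transpose, transpose_mul, transpose_transpose]
    · rw [← mulVec_mulVec, ha, mulVec_zero]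
  -- Cramer's rule: the difference of the two sides is killed by `A` and by `U`, hence by the
  -- nonsingular matrix A + Uᵀ U.
  have key : ∀ U ∈ 𝒰, (J * Uᵀ).det ≠ 0 →
      (J * Uᵀ).det • v = Jᵀ *ᵥ ((U * Jᵀ).adjugate *ᵥ (U *ᵥ v)) := by
    intro U hmem hU
    have hG : (U * Jᵀ).det = (J * Uᵀ).det := by
      rw [← det_transpose, transpose_mul, transpose_transpose]
    rw [← sub_eq_zero]
    apply eq_zero_of_mulVec_eq_zero (h𝒰 U hmem hU)
    rw [add_mulVec, mulVec_sub, mulVec_smul, hv, mulVec_mulVec, hr, zero_mulVec, smul_zero,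
      sub_zero, zero_add, ← mulVec_mulVec, mulVec_sub, mulVec_mulVec _ U, mulVec_mulVec _ (U * Jᵀ),
      mul_adjugate, hG, mulVec_smul, smul_mulVec, one_mulVec, sub_self, mulVec_zero]
  obtain ⟨U₁, hm₁, hU₁⟩ := hex
  -- Comparing the Cramer expressions of `v` for `U` and `U₁` shows that the minor of `U₁` divides
  -- the minor of `U` times the coefficient, for every `U`; coprimality removes the second factor.
  have hdvd : ∀ i, (J * U₁ᵀ).det ∣ ((U₁ * Jᵀ).adjugate *ᵥ (U₁ *ᵥ v)) i := by
    intro i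
    refine dvd_of_forall_dvd_mul ((fun U ↦ (J * Uᵀ).det) '' 𝒰) (fun p hp ↦ ?_) hU₁ ?_
    · obtain ⟨U, hU, hpU⟩ := hcop p hp
      exact ⟨_, ⟨U, hU, rfl⟩, hpU⟩
    · rintro _ ⟨U, hU, rfl⟩
      by_cases h0 : (J * Uᵀ).det = 0
      · simp [h0]
      refine ⟨((U * Jᵀ).adjugate *ᵥ (U *ᵥ v)) i, ?_⟩
      have h1 := congrArg ((J * U₁ᵀ).det • ·) (key U hU h0)
      have h2 := congrArg ((J * Uᵀ).det • ·) (key U₁ hm₁ hU₁)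
      rw [smul_comm, h2, ← mulVec_smul Jᵀ, ← mulVec_smul Jᵀ, ← sub_eq_zero, ← mulVec_sub] at h1
      have h3 := congrFun (hJ _ h1) i
      simp only [Pi.sub_apply, Pi.smul_apply, smul_eq_mul, Pi.zero_apply, sub_eq_zero] at h3
      exact h3
  choose c hc using hdvd
  refine ⟨c, ?_⟩
  have h1 : (J * U₁ᵀ).det • (v - Jᵀ *ᵥ c) = 0 := by
    rw [smul_sub, key U₁ hm₁ hU₁, ← mulVec_smul, sub_eq_zero]
    congr 1
    funext i
    rw [hc]
    rfl
  exact sub_eq_zero.mp ((smul_eq_zero.mp h1).resolve_left hU₁)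

end CoprimeMinors

end

end ArcInvariants

namespace ArcInvariants

open scoped Polynomial

noncomputable section

/-! ### Degeneration to the initial forms along a slice -/

section SliceDegeneration

open Matrix

/-- Scale `V` by the indeterminate and specialize it to `τ`. This is why the identity is assumed for
matrices with polynomial entries: `τ` need not lie in the image of `f`. -/
theorem det_add_map_of_polynomial {S T n m : Type*} [CommRing S] [CommRing T] [Fintype n]
    [DecidableEq n] [Fintype m] [DecidableEq m] (f : S →+* T) (τ : T) (A : Matrix n n S)
    (J : Matrix m n S) (c : S)
    (hc : ∀ U V : Matrix m n S[X], (A.map Polynomial.C + Uᵀ * V).det =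
      Polynomial.C c * (J.map Polynomial.C * Uᵀ).det * (J.map Polynomial.C * Vᵀ).det)
    (U V : Matrix m n S) :
    (A.map f + (U.map f)ᵀ * (τ • V.map f)).det =
      f c * (J.map f * (U.map f)ᵀ).det * (τ ^ Fintype.card m * (J.map f * (V.map f)ᵀ).det) := by
  let Θ : S[X] →+* T := Polynomial.eval₂RingHom f τ
  have hΘC : ∀ f' : S, Θ (Polynomial.C f') = f f' := fun f' ↦ Polynomial.eval₂_C _ _
  have hΘX : Θ Polynomial.X = τ := Polynomial.eval₂_X _ _
  have h := congrArg Θ (hc (U.map Polynomial.C) ((Polynomial.X : S[X]) • V.map Polynomial.C))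
  rw [map_mul, map_mul, hΘC, transpose_smul, Matrix.mul_smul (J.map Polynomial.C), det_smul, map_mul, map_pow, hΘX,
    RingHom.map_det, RingHom.map_det, RingHom.map_det] at h
  have e1 : ∀ V : Matrix m n S, Θ.mapMatrix (J.map Polynomial.C * (V.map Polynomial.C)ᵀ) =
      J.map f * (V.map f)ᵀ := fun V ↦ by
    ext1 i j
    simp [mul_apply, map_sum, hΘC]
  have e2 : Θ.mapMatrix (A.map Polynomial.C + (U.map Polynomial.C)ᵀ *
      ((Polynomial.X : S[X]) • V.map Polynomial.C)) = A.map f + (U.map f)ᵀ * (τ • V.map f) := by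
    ext1 i j
    simp [mul_apply, map_sum, hΘC, hΘX]
  rw [e1, e1, e2] at h
  exact h

/-- The rows through `E`, which is nonsingular at X = 0, force X^d to divide the transversal
components `w`. In the remaining row these carry one more factor X, so they disappear at X = 0 after
division by X^d. -/
theorem constantCoeff_mul_eq_zero_of_blocks {R n n' : Type*} [CommRing R] [IsDomain R]
    [Fintype n] [Fintype n'] [DecidableEq n'] {M : n → R} {B : n' → R} {B' : Matrix n' n R}
    {E : Matrix n' n' R[X]} (hE : Polynomial.constantCoeff E.det ≠ 0) {d : ℕ}
    {x Q : n → R[X]} {w : n' → R[X]} (hQ : ∀ k, Polynomial.X * x k = Polynomial.X ^ d * Q k)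
    (h1 : ∀ b, ∑ k, x k * (Polynomial.X * Polynomial.C (B' b k)) + ∑ k, w k * E b k = 0)
    (h2 : ∑ k, x k * (Polynomial.X * Polynomial.C (M k)) +
      ∑ k, w k * (Polynomial.X * Polynomial.C (B k)) = 0) :
    ∑ k, Polynomial.constantCoeff (Q k) * M k = 0 := by
  have hx : ∀ k (r : R), x k * (Polynomial.X * Polynomial.C r) =
      Polynomial.X ^ d * (Q k * Polynomial.C r) := fun k r ↦ by
    rw [← mul_assoc, ← mul_assoc, ← hQ, mul_comm Polynomial.X]
  have h3 : ∀ b, (E *ᵥ w) b = Polynomial.X ^ d * -∑ k, Q k * Polynomial.C (B' b k) := by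
    intro b
    have h4 := h1 b
    simp only [hx] at h4
    rw [← Finset.mul_sum, add_comm] at h4
    rw [mul_neg, ← eq_neg_of_add_eq_zero_left h4]
    exact Finset.sum_congr rfl fun k _ ↦ mul_comm _ _
  have h4 : ∀ k, (Polynomial.X : R[X]) ^ d ∣ w k := by
    intro k
    refine Polynomial.prime_X.pow_dvd_of_dvd_mul_left d (a := E.det) ?_ ?_
    · rw [Polynomial.X_dvd_iff]
      exact hE
    · have h5 : E.det • w = E.adjugate *ᵥ (E *ᵥ w) := by
        rw [mulVec_mulVec, adjugate_mul, smul_mulVec, one_mulVec]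
      have h6 := congrFun h5 k
      rw [Pi.smul_apply, smul_eq_mul] at h6
      rw [h6]
      refine Finset.dvd_sum fun b _ ↦ Dvd.dvd.mul_left ?_ _
      rw [h3]
      exact dvd_mul_right _ _
  choose w' hw' using h4
  have hw : ∀ k, w k * (Polynomial.X * Polynomial.C (B k)) =
      Polynomial.X ^ d * (w' k * (Polynomial.X * Polynomial.C (B k))) := fun k ↦ by
    rw [← mul_assoc (Polynomial.X ^ d), ← hw']
  simp only [hx, hw] at h2
  rw [← Finset.mul_sum, ← Finset.mul_sum, ← mul_add] at h2
  have h5 := (mul_eq_zero.mp h2).resolve_left (pow_ne_zero _ Polynomial.X_ne_zero)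
  have h6 := congrArg Polynomial.constantCoeff h5
  simpa [map_sum] using h6

/-- A count of powers of X. Scaling `V` by X lets X be extracted from all the rows indexed by `n`;
each minor of `J`, times X to the number of its rows, yields X to the sum of the `d i`. By `hd` the
total powers agree and cancel. At X = 0 the remaining block matrix is triangular. -/
theorem det_add_mul_det_of_blocks {R n n' m : Type*} [CommRing R] [IsDomain R] [Fintype n]
    [DecidableEq n] [Fintype n'] [DecidableEq n'] [Fintype m] [DecidableEq m]
    {A : Matrix (n ⊕ n') (n ⊕ n') R[X]} {M : Matrix n n R} {B : Matrix n n' R}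
    {B' : Matrix n' n R} {E : Matrix n' n' R[X]}
    (hA : A = fromBlocks ((Polynomial.X : R[X]) • M.map Polynomial.C) ((Polynomial.X : R[X]) • B.map Polynomial.C)
      ((Polynomial.X : R[X]) • B'.map Polynomial.C) E)
    {J : Matrix m (n ⊕ n') R[X]} {Q : Matrix m n R[X]} {d : m → ℕ} {c : R[X]}
    (hQ : ∀ i k, Polynomial.X * J i (.inl k) = Polynomial.X ^ d i * Q i k)
    (hd : 2 * ∑ i, d i = Fintype.card n + Fintype.card m) (U V : Matrix m n R)
    (hc : (A + (fromCols (U.map Polynomial.C) (0 : Matrix m n' R[X]))ᵀ *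
        ((Polynomial.X : R[X]) • fromCols (V.map Polynomial.C) (0 : Matrix m n' R[X]))).det =
      c * (J * (fromCols (U.map Polynomial.C) (0 : Matrix m n' R[X]))ᵀ).det *
      (Polynomial.X ^ Fintype.card m * (J * (fromCols (V.map Polynomial.C) (0 : Matrix m n' R[X]))ᵀ).det)) :
    (M + Uᵀ * V).det * Polynomial.constantCoeff E.det =
      Polynomial.constantCoeff c * (Q.map Polynomial.constantCoeff * Uᵀ).det *
        (Q.map Polynomial.constantCoeff * Vᵀ).det := by
  have hJ : ∀ U : Matrix m n R, Polynomial.X ^ Fintype.card m *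
      (J * (fromCols (U.map Polynomial.C) (0 : Matrix m n' R[X]))ᵀ).det =
      Polynomial.X ^ (∑ i, d i) * (Q * (U.map Polynomial.C)ᵀ).det := by
    intro U
    rw [← det_smul, ← Finset.prod_pow_eq_pow_sum, ← det_diagonal, ← det_mul,
      ← Matrix.mul_assoc]
    congr 1
    ext1 i j
    rw [Matrix.smul_apply, mul_apply, mul_apply, Fintype.sum_sum_type]
    simp only [transpose_apply, diagonal_mul, smul_eq_mul, fromCols_apply_inl,
      fromCols_apply_inr, Matrix.zero_apply, mul_zero, Finset.sum_const_zero, add_zero, Finset.mul_sum]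
    refine Finset.sum_congr rfl fun k _ ↦ ?_
    rw [← mul_assoc, hQ]
  have hL : A + (fromCols (U.map Polynomial.C) (0 : Matrix m n' R[X]))ᵀ *
        ((Polynomial.X : R[X]) • fromCols (V.map Polynomial.C) (0 : Matrix m n' R[X])) =
      fromBlocks ((Polynomial.X : R[X]) • (1 : Matrix n n R[X])) 0 0 (1 : Matrix n' n' R[X]) *
        fromBlocks ((M + Uᵀ * V).map Polynomial.C) (B.map Polynomial.C)
          ((Polynomial.X : R[X]) • B'.map Polynomial.C) E := by
    have h1 : (M + Uᵀ * V).map Polynomial.C = M.map Polynomial.C +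
        (U.map Polynomial.C)ᵀ * V.map Polynomial.C := by
      rw [Matrix.map_add _ (map_add _), Matrix.map_mul, transpose_map]
    rw [hA, h1, fromBlocks_multiply, transpose_fromCols, Matrix.mul_smul, fromRows_mul_fromCols,
      fromBlocks_smul, fromBlocks_add]
    simp [smul_add]
  rw [hL, det_mul, det_fromBlocks_zero₂₁, det_one, mul_one, det_smul, det_one, mul_one] at hc
  have hX : (Polynomial.X : R[X]) ^ (Fintype.card n + Fintype.card m) ≠ 0 :=
    pow_ne_zero _ Polynomial.X_ne_zero
  have h2 : (fromBlocks ((M + Uᵀ * V).map Polynomial.C) (B.map Polynomial.C)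
          ((Polynomial.X : R[X]) • B'.map Polynomial.C) E).det =
      c * (Q * (U.map Polynomial.C)ᵀ).det * (Q * (V.map Polynomial.C)ᵀ).det := by
    apply mul_left_cancel₀ hX
    generalize (fromBlocks ((M + Uᵀ * V).map Polynomial.C) (B.map Polynomial.C)
      ((Polynomial.X : R[X]) • B'.map Polynomial.C) E).det = Δ at hc ⊢
    calc _ = Polynomial.X ^ Fintype.card m * (Polynomial.X ^ Fintype.card n * Δ) := by
          rw [pow_add]; ring
      _ = c * (Polynomial.X ^ Fintype.card m * (J * (fromCols (U.map Polynomial.C) (0 : Matrix m n' R[X]))ᵀ).det) *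
          (Polynomial.X ^ Fintype.card m * (J * (fromCols (V.map Polynomial.C) (0 : Matrix m n' R[X]))ᵀ).det) := by
          rw [hc]; ring
      _ = _ := by rw [hJ, hJ, ← hd, two_mul, pow_add]; ring
  have h3 := congrArg Polynomial.constantCoeff h2
  have hq : ∀ U : Matrix m n R, Polynomial.constantCoeff (Q * (U.map Polynomial.C)ᵀ).det =
      (Q.map Polynomial.constantCoeff * Uᵀ).det := by
    intro U
    rw [RingHom.map_det]
    congr 1
    ext1 i j
    simp [mul_apply, map_sum]
  rw [map_mul, map_mul, hq, hq] at h3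
  rw [← h3, RingHom.map_det, RingHom.map_det, ← det_fromBlocks_zero₂₁ _ B]
  congr 1
  ext1 u v
  rcases u with a | a <;> rcases v with b | b <;> simp

/-! ### Restriction to a slice and its initial forms -/

variable {ι ι' κ : Type*}

/-- Restriction to an affine subspace, with values in polynomials in a scaling parameter. -/
def sliceHom (ε : ι' → ℂ) :
    MvPolynomial (ι ⊕ ι') ℂ →ₐ[ℂ] (MvPolynomial ι ℂ)[X] :=
  MvPolynomial.aeval (Sum.elim (fun k ↦ Polynomial.X * Polynomial.C (MvPolynomial.X k))
    fun k ↦ Polynomial.C (MvPolynomial.C (ε k)))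

variable (ε : ι' → ℂ)

theorem sliceHom_inl (k : ι) : sliceHom ε (MvPolynomial.X (.inl k)) =
    Polynomial.X * Polynomial.C (MvPolynomial.X k) := by
  simp [sliceHom]

theorem sliceHom_inr (k : ι') : sliceHom (ι := ι) ε (MvPolynomial.X (.inr k)) =
    Polynomial.C (MvPolynomial.C (ε k)) := by
  simp [sliceHom]

theorem sliceHom_C (r : ℂ) : sliceHom (ι := ι) ε (MvPolynomial.C r) =
    Polynomial.C (MvPolynomial.C r) := by
  simp [sliceHom]

theorem isHomogeneous_coeff_sliceHom (P : MvPolynomial (ι ⊕ ι') ℂ) (m : ℕ) :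
    ((sliceHom ε P).coeff m).IsHomogeneous m := by
  induction P using MvPolynomial.induction_on generalizing m with
  | C r =>
    rw [sliceHom_C, Polynomial.coeff_C]
    split_ifs with h
    · rw [h]; exact MvPolynomial.isHomogeneous_C _ _
    · exact MvPolynomial.isHomogeneous_zero _ _ _
  | add p q hp hq =>
    rw [map_add, Polynomial.coeff_add]
    exact (hp m).add (hq m)
  | mul_X p k hp =>
    rw [map_mul]
    rcases k with k | k
    · rw [sliceHom_inl, ← mul_assoc, Polynomial.coeff_mul_C]
      rcases m with _ | m
      · rw [Polynomial.coeff_mul_X_zero, zero_mul]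
        exact MvPolynomial.isHomogeneous_zero _ _ _
      · rw [Polynomial.coeff_mul_X]
        exact (hp m).mul (MvPolynomial.isHomogeneous_X _ _)
    · rw [sliceHom_inr, Polynomial.coeff_mul_C]
      exact (hp m).mul (MvPolynomial.isHomogeneous_C _ _)

/-- The chain rule: a slice coordinate enters multiplied by the scaling parameter. -/
theorem pderiv_coeff_sliceHom (P : MvPolynomial (ι ⊕ ι') ℂ) (k : ι) (m : ℕ) :
    MvPolynomial.pderiv k ((sliceHom ε P).coeff m) =
      (Polynomial.X * sliceHom ε (MvPolynomial.pderiv (Sum.inl k) P)).coeff m := by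
  classical
  induction P using MvPolynomial.induction_on generalizing m with
  | C r =>
    rw [sliceHom_C, MvPolynomial.pderiv_C, map_zero, mul_zero, Polynomial.coeff_C]
    split_ifs <;> simp
  | add p q hp hq => simp only [map_add, Polynomial.coeff_add, hp, hq, mul_add]
  | mul_X p j hp =>
    rw [MvPolynomial.pderiv_mul, map_mul, map_add, map_mul, map_mul, mul_add,
      Polynomial.coeff_add, ← mul_assoc, MvPolynomial.pderiv_X]
    generalize sliceHom ε p = f at hp ⊢
    generalize sliceHom ε (MvPolynomial.pderiv (Sum.inl k) p) = g at hp ⊢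
    rcases j with j | j
    · have h1 : sliceHom ε ((Pi.single (Sum.inl k) 1 : ι ⊕ ι' → MvPolynomial (ι ⊕ ι') ℂ)
          (Sum.inl j)) = Polynomial.C ((Pi.single k 1 : ι → MvPolynomial ι ℂ) j) := by
        by_cases h : j = k
        · rw [h, Pi.single_eq_same, Pi.single_eq_same, map_one, map_one]
        · rw [Pi.single_eq_of_ne h, Pi.single_eq_of_ne fun hc ↦ h (Sum.inl_injective hc),
            map_zero, map_zero]
      rw [sliceHom_inl, h1, ← mul_assoc, ← mul_assoc, ← mul_assoc, Polynomial.coeff_mul_C,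
        Polynomial.coeff_mul_C, Polynomial.coeff_mul_C, MvPolynomial.pderiv_mul,
        MvPolynomial.pderiv_X, mul_comm f Polynomial.X]
      refine congrArg₂ (· + ·) ?_ rfl
      refine congrArg₂ (· * ·) ?_ rfl
      rcases m with _ | m
      · rw [Polynomial.coeff_X_mul_zero, Polynomial.coeff_mul_X_zero, map_zero]
      · rw [Polynomial.coeff_X_mul, hp, Polynomial.coeff_mul_X]
    · rw [sliceHom_inr, Pi.single_eq_of_ne Sum.inr_ne_inl, map_zero, mul_zero, mul_zero,
        Polynomial.coeff_zero, Polynomial.coeff_mul_C, Polynomial.coeff_mul_C,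
        MvPolynomial.pderiv_mul, MvPolynomial.pderiv_C, mul_zero, hp]

/-- The initial form of the restriction to the slice. -/
def sliceLead (P : MvPolynomial (ι ⊕ ι') ℂ) : MvPolynomial ι ℂ := (sliceHom ε P).trailingCoeff

/-- The degree of the initial form. -/
def sliceOrder (P : MvPolynomial (ι ⊕ ι') ℂ) : ℕ := (sliceHom ε P).natTrailingDegree

theorem isHomogeneous_sliceLead (P : MvPolynomial (ι ⊕ ι') ℂ) :
    (sliceLead ε P).IsHomogeneous (sliceOrder ε P) :=
  isHomogeneous_coeff_sliceHom ε P _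

/-- Coefficients below the order are derivatives of zero, and the one at the order is the derivative
of the initial form. The extra X on the left avoids the exponent order - 1, which fails at order 0.
-/
theorem exists_pderiv_sliceHom (P : MvPolynomial (ι ⊕ ι') ℂ) (k : ι) :
    ∃ Q : (MvPolynomial ι ℂ)[X],
      Polynomial.X * sliceHom ε (MvPolynomial.pderiv (Sum.inl k) P) =
        Polynomial.X ^ sliceOrder ε P * Q ∧
      Polynomial.constantCoeff Q = MvPolynomial.pderiv k (sliceLead ε P) := by
  obtain ⟨Q, hQ⟩ : (Polynomial.X : (MvPolynomial ι ℂ)[X]) ^ sliceOrder ε P ∣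
      Polynomial.X * sliceHom ε (MvPolynomial.pderiv (Sum.inl k) P) := by
    rw [Polynomial.X_pow_dvd_iff]
    intro m hm
    rw [← pderiv_coeff_sliceHom, Polynomial.coeff_eq_zero_of_lt_natTrailingDegree hm, map_zero]
  refine ⟨Q, hQ, ?_⟩
  have := pderiv_coeff_sliceHom ε P k (sliceOrder ε P)
  rw [hQ, Polynomial.coeff_X_pow_mul', if_pos le_rfl, Nat.sub_self] at this
  exact this.symm

variable [Fintype ι] [DecidableEq ι] [Fintype ι'] [DecidableEq ι'] [Fintype κ] [DecidableEq κ]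

/-- A matrix whose restriction to the slice has a linear part `M` in the slice directions and is
nondegenerate transversally. -/
structure IsSliceMatrix (A : Matrix (ι ⊕ ι') (ι ⊕ ι') (MvPolynomial (ι ⊕ ι') ℂ))
    (M : Matrix ι ι (MvPolynomial ι ℂ)) (B : Matrix ι ι' (MvPolynomial ι ℂ))
    (B' : Matrix ι' ι (MvPolynomial ι ℂ)) (D : Matrix ι' ι' ℂ)
    (D' : Matrix ι' ι' (MvPolynomial ι ℂ)) : Prop where
  inl_inl : ∀ a b, sliceHom ε (A (.inl a) (.inl b)) = Polynomial.X * Polynomial.C (M a b)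
  inl_inr : ∀ a b, sliceHom ε (A (.inl a) (.inr b)) = Polynomial.X * Polynomial.C (B a b)
  inr_inl : ∀ a b, sliceHom ε (A (.inr a) (.inl b)) = Polynomial.X * Polynomial.C (B' a b)
  inr_inr : ∀ a b, sliceHom ε (A (.inr a) (.inr b)) =
    Polynomial.C (MvPolynomial.C (D a b)) + Polynomial.X * Polynomial.C (D' a b)
  det_ne_zero : D.det ≠ 0

variable {ε} {A : Matrix (ι ⊕ ι') (ι ⊕ ι') (MvPolynomial (ι ⊕ ι') ℂ)}
  {M : Matrix ι ι (MvPolynomial ι ℂ)} {B : Matrix ι ι' (MvPolynomial ι ℂ)}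
  {B' : Matrix ι' ι (MvPolynomial ι ℂ)} {D : Matrix ι' ι' ℂ}
  {D' : Matrix ι' ι' (MvPolynomial ι ℂ)}

/-- The transversal block. -/
def transversalBlock (D : Matrix ι' ι' ℂ) (D' : Matrix ι' ι' (MvPolynomial ι ℂ)) :
    Matrix ι' ι' (MvPolynomial ι ℂ)[X] :=
  Matrix.of fun a b ↦ Polynomial.C (MvPolynomial.C (D a b)) + Polynomial.X * Polynomial.C (D' a b)

omit [Fintype ι] [DecidableEq ι] in
theorem constantCoeff_det_transversalBlock :
    Polynomial.constantCoeff (transversalBlock D D').det = MvPolynomial.C D.det := by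
  rw [RingHom.map_det, RingHom.map_det]
  congr 1
  ext1 a b
  simp [transversalBlock]

omit [DecidableEq ι] in
theorem IsSliceMatrix.sum_pderiv_mul_eq_zero (h : IsSliceMatrix ε A M B B' D D')
    (P : MvPolynomial (ι ⊕ ι') ℂ) (hP : ∀ v, ∑ u, MvPolynomial.pderiv u P * A v u = 0) (a : ι) :
    ∑ k, MvPolynomial.pderiv k (sliceLead ε P) * M a k = 0 := by
  choose Q hQ hQ0 using exists_pderiv_sliceHom ε P
  simp only [← hQ0]
  have hP' : ∀ v, ∑ k, sliceHom ε (MvPolynomial.pderiv (Sum.inl k) P) *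
      sliceHom ε (A v (Sum.inl k)) + ∑ k, sliceHom ε (MvPolynomial.pderiv (Sum.inr k) P) *
      sliceHom ε (A v (Sum.inr k)) = 0 := fun v ↦ by
    have := congrArg (sliceHom ε) (hP v)
    rw [map_sum, map_zero, Fintype.sum_sum_type] at this
    simpa only [map_mul] using this
  refine constantCoeff_mul_eq_zero_of_blocks (E := transversalBlock D D') (B := B a) (B' := B')
    ?_ hQ (fun b ↦ ?_) ?_ (w := fun k ↦ sliceHom ε (MvPolynomial.pderiv (Sum.inr k) P))
  · rw [constantCoeff_det_transversalBlock]
    simpa using h.det_ne_zero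
  · have := hP' (.inr b)
    simp only [h.inr_inl, h.inr_inr] at this
    exact this
  · have := hP' (.inl a)
    simp only [h.inl_inl, h.inl_inr] at this
    exact this

/-- The factorization of the determinants of `A` survives the degeneration to the slice: `hdeg` is
the equality of X-adic orders that makes both sides have matching leading terms. -/
theorem IsSliceMatrix.det_identity (h : IsSliceMatrix ε A M B B' D D')
    (P : κ → MvPolynomial (ι ⊕ ι') ℂ) (c : MvPolynomial (ι ⊕ ι') ℂ)
    (hc : ∀ U V : Matrix κ (ι ⊕ ι') (MvPolynomial (ι ⊕ ι') ℂ)[X],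
      (A.map Polynomial.C + Uᵀ * V).det = Polynomial.C c *
        ((Matrix.of fun i u ↦ MvPolynomial.pderiv u (P i)).map Polynomial.C * Uᵀ).det *
        ((Matrix.of fun i u ↦ MvPolynomial.pderiv u (P i)).map Polynomial.C * Vᵀ).det)
    (hdeg : 2 * ∑ i, sliceOrder ε (P i) = Fintype.card ι + Fintype.card κ)
    (U V : Matrix κ ι ℂ) :
    (M + (U.map MvPolynomial.C)ᵀ * V.map MvPolynomial.C).det * MvPolynomial.C D.det =
      Polynomial.constantCoeff (sliceHom ε c) *
      ((Matrix.of fun i k ↦ MvPolynomial.pderiv k (sliceLead ε (P i))) *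
        (U.map MvPolynomial.C)ᵀ).det *
      ((Matrix.of fun i k ↦ MvPolynomial.pderiv k (sliceLead ε (P i))) *
        (V.map MvPolynomial.C)ᵀ).det := by
  choose Q hQ hQ0 using fun i ↦ exists_pderiv_sliceHom ε (P i)
  let Ψ : MvPolynomial (ι ⊕ ι') ℂ →+* (MvPolynomial ι ℂ)[X] := (sliceHom (ι := ι) ε).toRingHom
  have hU : ∀ U : Matrix κ ι ℂ,
      (fromCols (U.map MvPolynomial.C) (0 : Matrix κ ι' (MvPolynomial (ι ⊕ ι') ℂ))).map Ψ =
      fromCols ((U.map MvPolynomial.C).map Polynomial.C) 0 := fun U ↦ by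
    ext1 i u
    rcases u with k | k
    · exact sliceHom_C ε _
    · exact map_zero Ψ
  have h1 := det_add_map_of_polynomial Ψ Polynomial.X A _ c hc
    (fromCols (U.map MvPolynomial.C) 0) (fromCols (V.map MvPolynomial.C) 0)
  rw [hU, hU] at h1
  have hA : A.map Ψ = fromBlocks ((Polynomial.X : (MvPolynomial ι ℂ)[X]) • M.map Polynomial.C)
      ((Polynomial.X : (MvPolynomial ι ℂ)[X]) • B.map Polynomial.C)
      ((Polynomial.X : (MvPolynomial ι ℂ)[X]) • B'.map Polynomial.C) (transversalBlock D D') := by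
    ext1 u v
    rcases u with a | a <;> rcases v with b | b
    · exact h.inl_inl a b
    · exact h.inl_inr a b
    · exact h.inr_inl a b
    · exact h.inr_inr a b
  have h3 : (Matrix.of Q).map Polynomial.constantCoeff =
      Matrix.of fun i k ↦ MvPolynomial.pderiv k (sliceLead ε (P i)) := by
    ext1 i k
    exact hQ0 i k
  have hQ' : ∀ i k, Polynomial.X *
      ((Matrix.of fun i u ↦ MvPolynomial.pderiv u (P i)).map Ψ) i (Sum.inl k) =
      Polynomial.X ^ sliceOrder ε (P i) * Matrix.of Q i k := hQ
  have h2 := det_add_mul_det_of_blocks hA hQ' hdeg _ _ h1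
  rw [constantCoeff_det_transversalBlock, h3] at h2
  exact h2

end SliceDegeneration

end

end ArcInvariants

namespace ArcInvariants

noncomputable section

/-! ### Lifting homomorphisms to dual numbers -/

section DualNumberLift

/-- The dual numbers, as a ring without a distinguished algebra structure. -/
def TwistedDual (E : Type*) : Type _ := DualNumber E

instance (E : Type*) [CommRing E] : CommRing (TwistedDual E) :=
  inferInstanceAs (CommRing (DualNumber E))

/-- `E` is algebraic over a purely transcendental extension of `L`, and separable because the
characteristic is zero. -/
theorem formallySmooth_of_charZero (L E : Type*) [Field L] [Field E] [CharZero L] [Algebra L E] :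
    Algebra.FormallySmooth L E := by
  obtain ⟨s, hs⟩ := exists_isTranscendenceBasis L E
  have h1 := hs.isAlgebraic_field
  have : Algebra.IsSeparable (IntermediateField.adjoin L (Set.range ((↑) : s → E))) E :=
    inferInstance
  exact Algebra.FormallySmooth.of_algebraicIndependent_of_isSeparable hs.1

/-- In characteristic zero, a first order deformation of a homomorphism to a field extends to
the field. -/
theorem exists_lift_dualNumber {B E : Type*} [CommRing B] [Field E] [CharZero E] (φ : B →+* E)
    (Φ : B →+* DualNumber E) (hfst : ∀ x, (Φ x).fst = φ x) (hker : ∀ x, φ x = 0 → Φ x = 0) :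
    ∃ Θ : E →+* DualNumber E, (∀ y, (Θ y).fst = y) ∧ ∀ x, Θ (φ x) = Φ x := by
  have hdom : IsDomain (B ⧸ RingHom.ker φ) :=
    (RingHom.kerLift_injective φ).isDomain (RingHom.kerLift φ)
  let L := FractionRing (B ⧸ RingHom.ker φ)
  let j : L →+* E := IsFractionRing.lift (RingHom.kerLift_injective φ)
  have hj : ∀ x : B, j (algebraMap (B ⧸ RingHom.ker φ) L (Ideal.Quotient.mk _ x)) = φ x :=
    fun x ↦ IsFractionRing.lift_algebraMap (RingHom.kerLift_injective φ) _
  have : CharZero L := ⟨fun a b h ↦ Nat.cast_injective (R := E) (by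
    have h1 := congrArg j h
    rwa [map_natCast j, map_natCast j] at h1)⟩
  let _ : Algebra L E := j.toAlgebra
  let Φ' : (B ⧸ RingHom.ker φ) →+* TwistedDual E := Ideal.Quotient.lift (RingHom.ker φ) Φ hker
  -- A dual number with nonzero first component is a unit, so `Φ` extends to the fraction field of
  -- the image of `φ`.
  let J : L →+* TwistedDual E := IsLocalization.lift (M := nonZeroDivisors (B ⧸ RingHom.ker φ))
    (g := Φ') fun y ↦ by
      obtain ⟨x, hx⟩ := Ideal.Quotient.mk_surjective y.1
      have hne : φ x ≠ 0 := by
        intro h0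
        apply nonZeroDivisors.coe_ne_zero y
        rw [← hx, Ideal.Quotient.eq_zero_iff_mem]
        exact h0
      rw [← hx]
      change IsUnit (Φ x)
      rw [TrivSqZeroExt.isUnit_iff_isUnit_fst, hfst]
      exact isUnit_iff_ne_zero.mpr hne
  have hJ : ∀ x : B, J (algebraMap (B ⧸ RingHom.ker φ) L (Ideal.Quotient.mk _ x)) = Φ x :=
    fun x ↦ IsLocalization.lift_eq _ _
  -- Here `L` acts on the dual numbers through the deformation `J`, not through constants; an
  -- `L`-linear section of the projection to `E` is then an extension of `Φ`. It exists because the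
  -- kernel has square zero and `E` is formally smooth over `L`.
  let _ : Algebra L (TwistedDual E) := J.toAlgebra
  let fst : TwistedDual E →+* E := (TrivSqZeroExt.fstHom E E E).toRingHom
  have hfstJ : fst.comp J = j := by
    apply IsLocalization.ringHom_ext (nonZeroDivisors (B ⧸ RingHom.ker φ))
    apply Ideal.Quotient.ringHom_ext
    ext x
    change fst (J _) = j _
    rw [hJ, hj, ← hfst]
    rfl
  let g : TwistedDual E →ₐ[L] E := { fst with commutes' := fun x ↦ DFunLike.congr_fun hfstJ x }
  have hg : Function.Surjective g := fun y ↦ ⟨(TrivSqZeroExt.inl y : DualNumber E), rfl⟩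
  have hg' : IsNilpotent (RingHom.ker g) := by
    refine ⟨2, ?_⟩
    rw [Ideal.zero_eq_bot, eq_bot_iff, pow_two, Ideal.mul_le]
    intro a ha b hb
    have ha' : (show DualNumber E from a).fst = 0 := ha
    have hb' : (show DualNumber E from b).fst = 0 := hb
    have key : ∀ a b : DualNumber E, a.fst = 0 → b.fst = 0 → a * b = 0 := by
      intro a b ha hb
      ext <;> simp [ha, hb]
    exact key a b ha' hb'
  have := formallySmooth_of_charZero L E
  let Θ : E →ₐ[L] TwistedDual E :=
    Algebra.FormallySmooth.liftOfSurjective (AlgHom.id L E) g hg hg'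
  refine ⟨Θ.toRingHom, fun y ↦ ?_, fun x ↦ ?_⟩
  · exact Algebra.FormallySmooth.liftOfSurjective_apply (AlgHom.id L E) g hg hg' y
  · rw [← hj, ← hJ]
    exact Θ.commutes _

end DualNumberLift

/-! ### Polynomial rings of invariants -/

section PolynomialInvariants

open MvPolynomial

open Matrix

/-- The Jacobian matrix of a family of polynomials. -/
abbrev jacobian {σ κ R : Type*} [CommRing R] (P : κ → MvPolynomial σ R) :
    Matrix κ σ (MvPolynomial σ R) :=
  Matrix.of fun i k ↦ pderiv k (P i)

variable {σ κ L : Type*} [Fintype σ] [Fintype κ] [DecidableEq κ] [LieRing L] [LieAlgebra ℂ L]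

theorem algebraicIndependent_of_det_ne_zero {R : Type*} [CommRing R] [CharZero R] [IsDomain R]
    (P : κ → MvPolynomial σ R) (U : Matrix κ σ (MvPolynomial σ R))
    (hU : (jacobian P * Uᵀ).det ≠ 0) :
    AlgebraicIndependent R P := by
  classical
  apply algebraicIndependent_of_pderiv
  intro s c hc i hi
  have h1 : Matrix.vecMul (fun i ↦ if i ∈ s then c i else 0)
      (jacobian P * Uᵀ) = 0 := by
    rw [← Matrix.vecMul_vecMul]
    have : Matrix.vecMul (fun i ↦ if i ∈ s then c i else 0)
        (jacobian P) = 0 := by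
      funext k
      simpa [Matrix.vecMul, dotProduct] using hc k
    rw [this, Matrix.zero_vecMul]
  have h2 := Matrix.eq_zero_of_vecMul_eq_zero hU h1
  simpa [hi] using congrFun h2 i

omit [Fintype σ] [DecidableEq κ] in
theorem pderiv_aeval {R : Type*} [CommRing R] (P : κ → MvPolynomial σ R) (H : MvPolynomial κ R)
    (k : σ) : pderiv k (aeval P H) = ∑ i, aeval P (pderiv i H) * pderiv k (P i) := by
  rw [derivation_aeval]
  refine Finset.sum_subset (Finset.subset_univ _) fun i _ hi ↦ ?_
  rw [pderiv_eq_zero_of_notMem_vars hi, map_zero, zero_mul]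

/-- As `D` is linear on the variables and kills the `P i`, it turns a column of gradients paired
with a constant vector into the same with another constant vector. So the span of the minors with
constant `U` is stable under `D`. -/
theorem dvd_derivation_det (D : Derivation ℂ (MvPolynomial σ ℂ) (MvPolynomial σ ℂ))
    (N : Matrix σ σ ℂ) (hN : ∀ u k, pderiv k (D (X u)) = C (N u k)) (P : κ → MvPolynomial σ ℂ)
    (hP : ∀ i, D (P i) = 0) (q : MvPolynomial σ ℂ)
    (hq : ∀ U : Matrix κ σ ℂ,
      q ∣ (jacobian P * (U.map (C (σ := σ)))ᵀ).det)
    (U : Matrix κ σ ℂ) :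
    q ∣ D (jacobian P * (U.map (C (σ := σ)))ᵀ).det := by
  rw [derivation_det]
  refine Finset.dvd_sum fun c _ ↦ ?_
  have h1 := hq (U.updateRow c fun u ↦ -∑ k, N u k * U c k)
  convert h1 using 2
  ext1 i j
  by_cases hj : j = c
  · subst hj
    rw [Matrix.updateCol_self, Matrix.mul_apply, Matrix.mul_apply, map_sum]
    have h2 : ∀ k, D (pderiv k (P i)) = -∑ u, pderiv u (P i) * C (N u k) := fun k ↦ by
      rw [derivation_pderiv D (P i) Finset.univ (Finset.subset_univ _), hP, map_zero, zero_sub]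
      simp only [hN]
    simp only [Matrix.transpose_apply, Matrix.map_apply, Matrix.of_apply, Matrix.updateRow_self,
      Derivation.leibniz, derivation_C, smul_eq_mul, h2, map_neg, map_sum,
      map_mul, mul_neg, Finset.sum_neg_distrib, Finset.mul_sum]
    rw [Finset.sum_comm]
    simp only [mul_zero, zero_add, Finset.sum_neg_distrib]
    exact congrArg Neg.neg (Finset.sum_congr rfl fun k _ ↦ Finset.sum_congr rfl fun u _ ↦ by ring)
  · rw [Matrix.updateCol_ne hj, Matrix.mul_apply, Matrix.mul_apply]
    refine Finset.sum_congr rfl fun k _ ↦ ?_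
    rw [Matrix.transpose_apply, Matrix.transpose_apply, Matrix.map_apply, Matrix.map_apply,
      Matrix.updateRow_ne hj]

/-- A Lie algebra acting on a polynomial ring by linear derivations. -/
structure IsLinearAction (D : L →ₗ[ℂ] Derivation ℂ (MvPolynomial σ ℂ) (MvPolynomial σ ℂ)) :
    Prop where
  lie : ∀ a b f, D ⁅a, b⁆ f = D a (D b f) - D b (D a f)
  exists_matrix : ∀ a, ∃ N : Matrix σ σ ℂ, ∀ u, D a (X u) = ∑ k, C (N u k) * X k

variable {D : L →ₗ[ℂ] Derivation ℂ (MvPolynomial σ ℂ) (MvPolynomial σ ℂ)}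

theorem IsLinearAction.totalDegree_le (hD : IsLinearAction D) (a : L) (f : MvPolynomial σ ℂ) :
    (D a f).totalDegree ≤ f.totalDegree := by
  apply totalDegree_derivation_le
  intro i
  obtain ⟨N, hN⟩ := hD.exists_matrix a
  rw [hN]
  refine totalDegree_finsetSum_le fun k _ ↦ (totalDegree_mul _ _).trans ?_
  rw [totalDegree_C, totalDegree_X]

/-- A semi-invariant of a perfect Lie algebra is an invariant. -/
theorem IsLinearAction.eq_zero_of_dvd (hD : IsLinearAction D)
    (hperf : ∀ φ : L →ₗ[ℂ] ℂ, (∀ a b : L, φ ⁅a, b⁆ = 0) → φ = 0) {p : MvPolynomial σ ℂ} (hp : p ≠ 0)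
    (h : ∀ a, p ∣ D a p) (a : L) : D a p = 0 := by
  -- The action does not raise degrees, so the quotient is a constant. These constants form a
  -- character, which is zero by `hperf`.
  have h1 : ∀ a, ∃ r : ℂ, D a p = r • p := by
    intro a
    obtain ⟨q, hq⟩ := h a
    by_cases hq0 : q = 0
    · exact ⟨0, by rw [hq, hq0, mul_zero, zero_smul]⟩
    · have h2 := hD.totalDegree_le a p
      rw [hq, totalDegree_mul_of_isDomain hp hq0] at h2
      have h3 : q = C (coeff 0 q) := totalDegree_eq_zero_iff_eq_C.mp (by omega)
      refine ⟨coeff 0 q, ?_⟩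
      rw [hq, smul_eq_C_mul, ← h3, mul_comm]
  choose r hr using h1
  have hinj : ∀ x y : ℂ, x • p = y • p → x = y := fun x y hxy ↦ smul_left_injective ℂ hp hxy
  let φ : L →ₗ[ℂ] ℂ :=
    { toFun := r
      map_add' := fun a b ↦ hinj _ _ (by
        rw [← hr, map_add, Derivation.add_apply, hr, hr, add_smul])
      map_smul' := fun c a ↦ hinj _ _ (by
        rw [← hr, map_smul, Derivation.smul_apply, hr, smul_smul]; rfl) }
  have hφ := hperf φ fun a b ↦ hinj _ _ (by
    change r ⁅a, b⁆ • p = _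
    rw [← hr, hD.lie, hr b, hr a, Derivation.map_smul, Derivation.map_smul, hr, hr, smul_comm, sub_self, zero_smul])
  have := DFunLike.congr_fun hφ a
  rw [hr a, show r a = 0 from this, zero_smul]

/-- Let p^m be the exact power dividing all minors and p^m u a minor with p ∤ u. Its derivative is
again divisible by p^m, and the Leibniz rule leaves p ∣ m u D(p); in characteristic zero p ∣ D(p).
-/
theorem IsLinearAction.dvd_derivation (hD : IsLinearAction D) (P : κ → MvPolynomial σ ℂ)
    (hP : ∀ a i, D a (P i) = 0)
    (hex : ∃ U : Matrix κ σ ℂ,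
      (jacobian P * (U.map (C (σ := σ)))ᵀ).det ≠ 0)
    {p : MvPolynomial σ ℂ} (hp : Prime p)
    (h : ∀ U : Matrix κ σ ℂ,
      p ∣ (jacobian P * (U.map (C (σ := σ)))ᵀ).det) (a : L) :
    p ∣ D a p := by
  classical
  obtain ⟨N, hN⟩ := hD.exists_matrix a
  have hN' : ∀ u k, pderiv k (D a (X u)) = C (N u k) := by
    intro u k
    rw [hN, map_sum, Finset.sum_eq_single k]
    · rw [pderiv_C_mul, pderiv_X_self, mul_one]
    · intro j _ hj
      rw [pderiv_C_mul, pderiv_X_of_ne hj, mul_zero]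
    · simp
  set f : Matrix κ σ ℂ → MvPolynomial σ ℂ := fun U ↦
    (jacobian P * (U.map (C (σ := σ)))ᵀ).det with hf
  have hfin : ∃ m, ∃ U, ¬ p ^ (m + 1) ∣ f U := by
    obtain ⟨U, hU⟩ := hex
    obtain ⟨m, hm⟩ := FiniteMultiplicity.of_prime_left hp hU
    exact ⟨m, U, hm⟩
  let m := Nat.find hfin
  obtain ⟨U₁, hU₁⟩ := Nat.find_spec hfin
  have hm : ∀ U, p ^ m ∣ f U := by
    intro U
    rcases hm0 : m with _ | k
    · simp
    · have := Nat.find_min hfin (m := k) (by change k < m; omega)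
      push Not at this
      exact this U
  have hm1 : m ≠ 0 := by
    intro h0
    apply hU₁
    change p ^ (m + 1) ∣ _
    rw [h0, zero_add, pow_one]
    exact h U₁
  obtain ⟨k, hk⟩ := Nat.exists_eq_succ_of_ne_zero hm1
  obtain ⟨u, hu⟩ := hm U₁
  have hpu : ¬ p ∣ u := by
    rintro ⟨v, rfl⟩
    apply hU₁
    change p ^ (m + 1) ∣ _
    rw [hu, pow_succ, ← mul_assoc]
    exact dvd_mul_right _ _
  have h1 : p ^ m ∣ D a (f U₁) := dvd_derivation_det (D a) N hN' P (hP a) (p ^ m) hm U₁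
  rw [hu, Derivation.leibniz, Derivation.leibniz_pow, smul_eq_mul, smul_eq_mul, smul_eq_mul,
    dvd_add_right (dvd_mul_right _ _), hk, Nat.succ_sub_one, nsmul_eq_mul, pow_succ] at h1
  have h2 : p ^ k * p ∣ p ^ k * (u * (((k + 1 : ℕ) : MvPolynomial σ ℂ) * D a p)) := by
    convert h1 using 1
    push_cast
    ring
  have h3 := (hp.dvd_or_dvd ((mul_dvd_mul_iff_left (pow_ne_zero k hp.ne_zero)).mp h2)).resolve_left
    hpu
  refine (hp.dvd_or_dvd h3).resolve_left fun h4 ↦ hp.not_isUnit (isUnit_of_dvd_unit h4 ?_)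
  have : ((k + 1 : ℕ) : MvPolynomial σ ℂ) = C ((k + 1 : ℕ) : ℂ) := (map_natCast C _).symm
  rw [this]
  exact (isUnit_iff_ne_zero.mpr (by exact_mod_cast Nat.succ_ne_zero k)).map C

omit [Fintype σ] [DecidableEq κ] in
theorem ne_C_of_prime {p : MvPolynomial σ ℂ} (hp : Prime p) : p ≠ C (coeff 0 p) := by
  intro h0
  rw [h0] at hp
  have hne : coeff 0 p ≠ 0 := by
    intro h1
    rw [h1, map_zero] at hp
    exact hp.ne_zero rfl
  exact hp.not_isUnit ((isUnit_iff_ne_zero.mpr hne).map C)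

/-- If the hypersurface `p = 0` is the preimage of the hypersurface `H = 0` under a polynomial map
that generates the ideal of the image, then the Jacobian matrix has full rank along it. -/
theorem eq_zero_of_vecMul_jacobian_eq_zero {E : Type*} [Field E] [CharZero E]
    (π : MvPolynomial σ ℂ →+* E) {p : MvPolynomial σ ℂ} (hp : p ≠ C (coeff 0 p))
    (hπ : ∀ f, π f = 0 ↔ p ∣ f) (P : κ → MvPolynomial σ ℂ) {H : MvPolynomial κ ℂ}
    (hH : aeval P H = p) (hker : ∀ x, π (aeval P x) = 0 → H ∣ x) (α : κ → E)
    (hα : ∀ k, ∑ i, α i * π (pderiv k (P i)) = 0) : α = 0 := by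
  let J : κ → σ → E := fun i k ↦ π (pderiv k (P i))
  let φ : MvPolynomial κ ℂ →+* E := π.comp (aeval P).toRingHom
  have hφ : ∀ x, φ x = π (aeval P x) := fun _ ↦ rfl
  let η : κ → E := fun i ↦ φ (pderiv i H)
  -- A vector `μ` tangent to H = 0 is a first order deformation of `φ`. It vanishes on the kernel of
  -- `φ`, which is generated by `H`, so it extends to `E`; composed with `π` it is a tangent vector
  -- to p = 0 mapping to `μ`. Hence `μ` lies in the image of the Jacobian, which `α` annihilates.
  have hdual : ∀ μ : κ → E, ∑ i, μ i * η i = 0 → ∑ i, α i * μ i = 0 := by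
    intro μ hμ
    let Φ : MvPolynomial κ ℂ →+* DualNumber E := eval₂Hom
      ((TrivSqZeroExt.inlHom E E).comp (π.comp C))
      fun i ↦ TrivSqZeroExt.inl (φ (X i)) + TrivSqZeroExt.inr (μ i)
    have hΦC : ∀ r, Φ (C r) = TrivSqZeroExt.inl (π (C r)) := fun r ↦ eval₂_C _ _ _
    have hΦX : ∀ i, Φ (X i) = TrivSqZeroExt.inl (φ (X i)) + TrivSqZeroExt.inr (μ i) :=
      fun i ↦ eval₂_X _ _ _
    have hfst : ∀ x, (Φ x).fst = φ x := by
      have : (TrivSqZeroExt.fstHom E E E).toRingHom.comp Φ = φ := by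
        apply MvPolynomial.ringHom_ext
        · intro r
          change (Φ (C r)).fst = _
          rw [hΦC, hφ, aeval_C, TrivSqZeroExt.fst_inl]
          rfl
        · intro i
          change (Φ (X i)).fst = _
          rw [hΦX]
          simp
      exact fun x ↦ DFunLike.congr_fun this x
    have hsnd := snd_ringHom_dualNumber Φ fun r ↦ by rw [hΦC, TrivSqZeroExt.snd_inl]
    have hΦH : Φ H = 0 := by
      ext
      · rw [hfst, hφ, hH]
        exact (hπ p).mpr dvd_rfl
      · rw [hsnd]
        simp only [hΦX, hfst]
        simpa using hμ
    obtain ⟨Θ, hΘ1, hΘ2⟩ := exists_lift_dualNumber φ Φ hfst fun x hx ↦ by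
      obtain ⟨y, rfl⟩ := hker x hx
      rw [map_mul, hΦH, zero_mul]
    have hΘ := snd_ringHom_dualNumber (Θ.comp π) fun r ↦ by
      have h1 : π (C r) = φ (C r) := by rw [hφ, aeval_C]; rfl
      rw [RingHom.comp_apply, h1, hΘ2, hΦC, TrivSqZeroExt.snd_inl]
    have hμ' : ∀ i, μ i = ∑ k, (Θ (π (X k))).snd * J i k := by
      intro i
      have h1 := hΘ (P i)
      have h2 : π (P i) = φ (X i) := by rw [hφ, aeval_X]
      rw [RingHom.comp_apply, h2, hΘ2, hΦX] at h1
      simp only [RingHom.comp_apply, hΘ1] at h1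
      simpa [J] using h1
    simp only [hμ', Finset.mul_sum]
    rw [Finset.sum_comm]
    refine Finset.sum_eq_zero fun k _ ↦ ?_
    have h1 := hα k
    calc _ = (Θ (π (X k))).snd * ∑ i, α i * J i k := by
          rw [Finset.mul_sum]
          exact Finset.sum_congr rfl fun i _ ↦ by ring
      _ = 0 := by rw [show ∑ i, α i * J i k = 0 from h1, mul_zero]
  -- So `α` is proportional to the gradient `η` of `H`. By the chain rule the Jacobian takes `η` to
  -- dp, which does not vanish along p = 0, and it takes `α` to zero.
  have hprop : ∀ i j, α i * η j = α j * η i := by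
    intro i j
    by_cases hij : i = j
    · rw [hij]
    have h1 := hdual (Pi.single i (η j) - Pi.single j (η i)) (by
      
      simp only [Pi.sub_apply, sub_mul, Pi.single_apply, Finset.sum_sub_distrib, ite_mul, zero_mul,
        Finset.sum_ite_eq', Finset.mem_univ, if_true]
      ring)
    simp only [Pi.sub_apply, mul_sub, Finset.sum_sub_distrib, Pi.single_apply, mul_ite, mul_zero,
      Finset.sum_ite_eq', Finset.mem_univ, if_true] at h1
    exact sub_eq_zero.mp h1
  obtain ⟨k, hk⟩ := exists_pderiv_not_dvd hp
  rw [← hπ] at hk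
  have hchain : π (pderiv k p) = ∑ i, η i * J i k := by
    conv_lhs => rw [← hH, pderiv_aeval, map_sum]
    refine Finset.sum_congr rfl fun i _ ↦ ?_
    rw [map_mul]
    rfl
  have hαk : ∑ i, α i * J i k = 0 := hα k
  have hzero : ∀ i, α i = 0 := by
    intro i
    have h1 : α i * π (pderiv k p) = 0 := by
      rw [hchain, Finset.mul_sum]
      calc _ = η i * ∑ j, α j * J j k := by
            rw [Finset.mul_sum]
            refine Finset.sum_congr rfl fun j _ ↦ ?_
            rw [← mul_assoc, hprop i j]
            ring
        _ = 0 := by rw [hαk, mul_zero]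
    exact (mul_eq_zero.mp h1).resolve_right hk
  exact funext hzero

/-- If homogeneous invariants of a perfect Lie algebra generate all invariants and are
independent, the maximal minors of their Jacobian matrix have no common factor. -/
theorem IsLinearAction.exists_not_dvd_det (hD : IsLinearAction D)
    (hperf : ∀ φ : L →ₗ[ℂ] ℂ, (∀ a b : L, φ ⁅a, b⁆ = 0) → φ = 0) (P : κ → MvPolynomial σ ℂ)
    (hP : ∀ a i, D a (P i) = 0)
    (hgen : ∀ f, (∀ a, D a f = 0) → f ∈ Algebra.adjoin ℂ (Set.range P))
    (hex : ∃ U : Matrix κ σ ℂ,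
      (jacobian P * (U.map (C (σ := σ)))ᵀ).det ≠ 0)
    (p : MvPolynomial σ ℂ) (hp : Prime p) :
    ∃ U : Matrix κ σ (MvPolynomial σ ℂ),
      ¬ p ∣ (jacobian P * Uᵀ).det := by
  classical
  by_contra! hall
  -- A common prime factor of the minors is a semi-invariant, hence an invariant.
  have hDp : ∀ a, D a p = 0 := hD.eq_zero_of_dvd hperf hp.ne_zero
    (hD.dvd_derivation P hP hex hp fun U ↦ hall _)
  have hgen' : ∀ f, (∀ a, D a f = 0) → ∃ y : MvPolynomial κ ℂ, aeval P y = f := fun f hf ↦ by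
    have := hgen f hf
    rw [Algebra.adjoin_range_eq_range_aeval] at this
    exact this
  have hindep : AlgebraicIndependent ℂ P := by
    obtain ⟨U, hU⟩ := hex
    exact algebraicIndependent_of_det_ne_zero P (U.map C) hU
  have hφinv : ∀ x : MvPolynomial κ ℂ, ∀ a, D a (aeval P x) = 0 := fun x a ↦ by
    rw [derivation_aeval]
    exact Finset.sum_eq_zero fun i _ ↦ by rw [hP, mul_zero]
  obtain ⟨H, hH⟩ := hgen' p hDp
  have hprime : (Ideal.span {p}).IsPrime := (Ideal.span_singleton_prime hp.ne_zero).mpr hp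
  let S' := MvPolynomial σ ℂ ⧸ Ideal.span {p}
  let E := FractionRing S'
  let π : MvPolynomial σ ℂ →+* E := (algebraMap S' E).comp (Ideal.Quotient.mk _)
  have hπ : ∀ f, π f = 0 ↔ p ∣ f := fun f ↦ by
    rw [← Ideal.mem_span_singleton, ← Ideal.Quotient.eq_zero_iff_mem]
    exact map_eq_zero_iff _ (IsFractionRing.injective S' E)
  have : CharZero E := by
    refine ⟨fun a b hab ↦ ?_⟩
    have h1 : π (C ((a : ℂ) - b)) = 0 := by
      rw [map_sub, map_sub, map_natCast, map_natCast, map_natCast, map_natCast, hab, sub_self]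
    rw [hπ] at h1
    by_contra hne
    refine hp.not_isUnit (isUnit_of_dvd_unit h1 ((isUnit_iff_ne_zero.mpr ?_).map C))
    rw [sub_ne_zero]
    exact_mod_cast hne
  let J : Matrix κ σ E := Matrix.of fun i k ↦ π (pderiv k (P i))
  -- If the Jacobian over the function field of p = 0 had a right inverse `W`, clearing the
  -- denominators of `W` would give a minor that is a power of a nonzero `b` there, hence not
  -- divisible by p.
  obtain ⟨α, hα0, hα⟩ : ∃ α : κ → E, α ≠ 0 ∧ Matrix.vecMul α J = 0 := by
    by_contra! hinj
    have hinj' : Function.Injective J.vecMulLinear := by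
      rw [injective_iff_map_eq_zero]
      intro α h0
      by_contra hne
      exact hinj α hne h0
    obtain ⟨g, hg⟩ := LinearMap.exists_leftInverse_of_injective _
      (LinearMap.ker_eq_bot.mpr hinj')
    let W : Matrix σ κ E := Matrix.of fun k i ↦ g (Pi.single k 1) i
    have hW : ∀ v : σ → E, Matrix.vecMul v W = g v := by
      intro v
      conv_rhs => rw [pi_eq_sum_univ' v, map_sum]
      funext i
      rw [Finset.sum_apply]
      refine Finset.sum_congr rfl fun k _ ↦ ?_
      rw [map_smul]
      rfl
    have hJW : J * W = 1 := by
      ext1 i j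
      have h1 := congrFun (DFunLike.congr_fun hg (Pi.single i 1)) j
      rw [LinearMap.comp_apply, ← hW, Matrix.vecMulLinear_apply, Matrix.vecMul_vecMul,
        Matrix.single_one_vecMul] at h1
      rw [LinearMap.id_apply] at h1
      rw [Matrix.one_apply, ← Pi.single_apply]
      rw [Matrix.row] at h1
      rw [h1, Pi.single_apply, Pi.single_apply]
      simp [eq_comm]
    obtain ⟨b, hb⟩ := IsLocalization.exist_integer_multiples_of_finite (nonZeroDivisors S')
      (fun x : σ × κ ↦ W x.1 x.2)
    choose w hw using hb
    choose w' hw' using fun x ↦ Ideal.Quotient.mk_surjective (w x)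
    have hdet := (hπ _).mpr (hall (Matrix.of fun i k ↦ w' (k, i)))
    rw [RingHom.map_det] at hdet
    have h2 : π.mapMatrix (jacobian P *
        (Matrix.of fun i k ↦ w' (k, i))ᵀ) = algebraMap S' E b • (J * W) := by
      ext1 i j
      rw [RingHom.mapMatrix_apply, Matrix.map_apply, Matrix.mul_apply, map_sum, Matrix.smul_apply,
        Matrix.mul_apply, Finset.smul_sum]
      refine Finset.sum_congr rfl fun k _ ↦ ?_
      rw [map_mul]
      have h3 : π (w' (k, j)) = algebraMap S' E b * W k j := by
        have h4 := hw (k, j)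
        rw [← hw', Algebra.smul_def] at h4
        exact h4
      simp only [Matrix.of_apply, Matrix.transpose_apply, h3, J, smul_eq_mul]
      ring
    rw [h2, hJW, Matrix.det_smul, Matrix.det_one, mul_one] at hdet
    exact nonZeroDivisors.coe_ne_zero b ((map_eq_zero_iff _ (IsFractionRing.injective S' E)).mp
      (eq_zero_of_pow_eq_zero hdet))
  refine hα0 (eq_zero_of_vecMul_jacobian_eq_zero π (ne_C_of_prime hp) hπ P hH (fun x hx ↦ ?_) α
    fun k ↦ congrFun hα k)
  rw [hπ] at hx
  obtain ⟨s, hs⟩ := hx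
  -- The quotient of an invariant by the invariant p is an invariant, so divisibility by p descends
  -- to divisibility by `H`.
  obtain ⟨y, hy⟩ := hgen' s fun a ↦ by
    have h1 := hφinv x a
    rw [hs, Derivation.leibniz, hDp, smul_zero, add_zero, smul_eq_mul] at h1
    exact (mul_eq_zero.mp h1).resolve_left hp.ne_zero
  refine ⟨y, hindep ?_⟩
  change aeval P x = aeval P (H * y)
  rw [map_mul, hH, hy, hs]

end PolynomialInvariants

end

end ArcInvariants

namespace ArcInvariants

noncomputable section

/-! ### Linear forms and derivations in coordinates -/

section Coordinates

open MvPolynomial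

variable {σ M : Type*} [AddCommGroup M] [Module ℂ M]

/-- A vector as a linear form in the coordinates of a basis. -/
def linForm (b : Module.Basis σ ℂ M) : M →ₗ[ℂ] MvPolynomial σ ℂ :=
  b.constr ℂ X

@[simp]
theorem linForm_basis (b : Module.Basis σ ℂ M) (k : σ) : linForm b (b k) = X k :=
  b.constr_basis ℂ _ k

theorem linForm_apply [Fintype σ] (b : Module.Basis σ ℂ M) (x : M) :
    linForm b x = ∑ k, C (b.repr x k) * X k := by
  rw [linForm, b.constr_apply_fintype ℂ]
  exact Finset.sum_congr rfl fun k _ ↦ by rw [MvPolynomial.smul_eq_C_mul, Module.Basis.equivFun_apply]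

theorem isHomogeneous_linForm (b : Module.Basis σ ℂ M) (x : M) : (linForm b x).IsHomogeneous 1 := by
  rw [linForm, Module.Basis.constr_apply]
  refine IsHomogeneous.sum _ _ _ fun k _ ↦ ?_
  change (b.repr x k • X k : MvPolynomial σ ℂ).IsHomogeneous 1
  rw [MvPolynomial.smul_eq_C_mul, ← zero_add 1]
  exact (isHomogeneous_C _ _).mul (isHomogeneous_X _ _)

/-- The derivation that extends a linear endomorphism. -/
def linDerivation (b : Module.Basis σ ℂ M) :
    Module.End ℂ M →ₗ[ℂ] Derivation ℂ (MvPolynomial σ ℂ) (MvPolynomial σ ℂ) where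
  toFun φ := mkDerivation ℂ fun k ↦ linForm b (φ (b k))
  map_add' φ ψ := by
    apply derivation_ext
    intro k
    simp [mkDerivation_X]
  map_smul' c φ := by
    apply derivation_ext
    intro k
    simp [mkDerivation_X]

theorem linDerivation_X (b : Module.Basis σ ℂ M) (φ : Module.End ℂ M) (k : σ) :
    linDerivation b φ (X k) = linForm b (φ (b k)) :=
  mkDerivation_X _ _ _

theorem linDerivation_linForm (b : Module.Basis σ ℂ M) (φ : Module.End ℂ M) (x : M) :
    linDerivation b φ (linForm b x) = linForm b (φ x) := by
  have : (linDerivation b φ).toLinearMap ∘ₗ linForm b = linForm b ∘ₗ φ := by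
    apply b.ext
    intro k
    simp [linDerivation_X]
  exact DFunLike.congr_fun this x

theorem linDerivation_commutator (b : Module.Basis σ ℂ M) (φ ψ : Module.End ℂ M)
    (f : MvPolynomial σ ℂ) :
    linDerivation b (φ * ψ - ψ * φ) f =
      linDerivation b φ (linDerivation b ψ f) - linDerivation b ψ (linDerivation b φ f) := by
  have : linDerivation b (φ * ψ - ψ * φ) = ⁅linDerivation b φ, linDerivation b ψ⁆ := by
    apply derivation_ext
    intro k
    rw [Derivation.commutator_apply]
    simp only [linDerivation_X, linDerivation_linForm, ← map_sub]
    rfl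
  rw [this, Derivation.commutator_apply]

theorem ad_lie {g : Type*} [LieRing g] [LieAlgebra ℂ g] (x y : g) :
    LieAlgebra.ad ℂ g ⁅x, y⁆ =
      LieAlgebra.ad ℂ g x * LieAlgebra.ad ℂ g y - LieAlgebra.ad ℂ g y * LieAlgebra.ad ℂ g x :=
  LinearMap.ext fun z ↦ lie_lie x y z

theorem isLinearAction_linDerivation {g : Type*} [LieRing g] [LieAlgebra ℂ g] [Fintype σ]
    (b : Module.Basis σ ℂ g) :
    IsLinearAction (linDerivation b ∘ₗ (LieAlgebra.ad ℂ g : g →ₗ[ℂ] Module.End ℂ g)) where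
  lie x y f := by
    rw [LinearMap.comp_apply, LinearMap.comp_apply, LinearMap.comp_apply,
      ← linDerivation_commutator]
    congr 2
    exact ad_lie x y
  exists_matrix x := ⟨Matrix.of fun u k ↦ b.repr ⁅x, b u⁆ k, fun u ↦ by
    rw [LinearMap.comp_apply, linDerivation_X, linForm_apply]
    rfl⟩

end Coordinates

/-! ### Invariants restricted to a Cartan subalgebra -/

section Cartan

open MvPolynomial

/-- Cyclicity of the trace. The factor `X` commuting with `M` is what the induction needs: it
absorbs one power of `M` at each step. -/
theorem trace_mul_derivation_pow {A : Type*} [CommRing A] [Algebra ℂ A] (D : Derivation ℂ A A)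
    {n : Type*} [Fintype n] [DecidableEq n] (M : Matrix n n A) (m : ℕ) (X : Matrix n n A)
    (hX : Commute X M) :
    (X * (M ^ (m + 1)).map D).trace = ((m : A) + 1) * (X * M ^ m * M.map D).trace := by
  have hmul : ∀ B C : Matrix n n A, (B * C).map D = B.map D * C + B * C.map D := by
    intro B C
    ext i j
    simp only [Matrix.map_apply, Matrix.add_apply, Matrix.mul_apply, map_sum, Derivation.leibniz,
      smul_eq_mul, ← Finset.sum_add_distrib]
    exact Finset.sum_congr rfl fun k _ ↦ by ring
  induction m generalizing X with
  | zero => simp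
  | succ m ih =>
    rw [pow_succ M (m + 1), hmul, mul_add, Matrix.trace_add, ← mul_assoc, Matrix.trace_mul_comm,
      ← mul_assoc, ← hX.eq, ih _ (hX.mul_left (Commute.refl M)), mul_assoc X M, ← pow_succ',
      ← mul_assoc]
    push_cast
    ring

variable {g : Type*} [LieRing g] [LieAlgebra ℂ g] [FiniteDimensional ℂ g]
  {σ : Type*} [Fintype σ]

omit [FiniteDimensional ℂ g] [Fintype σ] in
theorem eval_linForm (b : Module.Basis σ ℂ g) (x y : g) :
    eval (fun k ↦ killingForm ℂ g (b k) y) (linForm b x) = killingForm ℂ g x y := by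
  have : (aeval fun k ↦ killingForm ℂ g (b k) y).toLinearMap ∘ₗ linForm b =
      (killingForm ℂ g).flip y := by
    apply b.ext
    intro k
    simp
  have h1 := DFunLike.congr_fun this x
  rw [LinearMap.comp_apply, AlgHom.toLinearMap_apply, aeval_eq_eval] at h1
  exact h1

variable [LieAlgebra.IsKilling ℂ g]

theorem exists_killingForm_eq (φ : Module.Dual ℂ g) : ∃ x, ∀ y, killingForm ℂ g x y = φ y := by
  have hnd := LieAlgebra.IsKilling.killingForm_nondegenerate ℂ g
  obtain ⟨x, hx⟩ := (LinearMap.BilinForm.toDual (killingForm ℂ g) hnd).surjective φ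
  exact ⟨x, fun y ↦ by rw [← hx]; rfl⟩

/-- The invariants `y ↦ tr (ad y) ^ (m + 1)` and their differentials. -/
theorem exists_trace_polynomial (b : Module.Basis σ ℂ g) (m : ℕ) :
    ∃ T : MvPolynomial σ ℂ, ∀ y z : g,
      ∑ k, eval (fun k ↦ killingForm ℂ g (b k) y) (pderiv k T) * killingForm ℂ g (b k) z =
        ((m : ℂ) + 1) * LinearMap.trace ℂ g (LieAlgebra.ad ℂ g y ^ m * LieAlgebra.ad ℂ g z) := by
  classical
  -- Each entry of the matrix of ad y is linear in y, hence of the form κ(x_rs, y); this makes ad a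
  -- matrix of linear forms.
  choose x hx using fun r s ↦ exists_killingForm_eq (g := g)
    (LinearMap.proj s ∘ₗ LinearMap.proj r ∘ₗ (LinearMap.toMatrix b b).toLinearMap ∘ₗ
      (LieAlgebra.ad ℂ g : g →ₗ[ℂ] Module.End ℂ g) : Module.Dual ℂ g)
  have hx : ∀ r s y, killingForm ℂ g (x r s) y =
      LinearMap.toMatrix b b (LieAlgebra.ad ℂ g y) r s := hx
  let M : Matrix σ σ (MvPolynomial σ ℂ) := Matrix.of fun r s ↦ linForm b (x r s)
  refine ⟨(M ^ (m + 1)).trace, fun y z ↦ ?_⟩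
  let D : Derivation ℂ (MvPolynomial σ ℂ) (MvPolynomial σ ℂ) :=
    mkDerivation ℂ fun k ↦ C (killingForm ℂ g (b k) z)
  have hD : ∀ x, D (linForm b x) = C (killingForm ℂ g x z) := by
    intro x
    have : D.toLinearMap ∘ₗ linForm b =
        (Algebra.linearMap ℂ (MvPolynomial σ ℂ)) ∘ₗ (killingForm ℂ g).flip z := by
      apply b.ext
      intro k
      simp [D, mkDerivation_X, MvPolynomial.algebraMap_eq]
    exact DFunLike.congr_fun this x
  let ev := eval (fun k ↦ killingForm ℂ g (b k) y)
  have h1 : ∑ k, ev (pderiv k (M ^ (m + 1)).trace) * killingForm ℂ g (b k) z =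
      ev (D (M ^ (m + 1)).trace) := by
    rw [derivation_eq_sum_pderiv D _ Finset.univ (Finset.subset_univ _), map_sum]
    refine Finset.sum_congr rfl fun k _ ↦ ?_
    rw [smul_eq_mul, map_mul, mkDerivation_X, eval_C]
  have h2 : D (M ^ (m + 1)).trace = ((1 : Matrix σ σ _) * (M ^ (m + 1)).map D).trace := by
    rw [one_mul, Matrix.trace, Matrix.trace, map_sum]
    rfl
  have h3 : M.map ev = LinearMap.toMatrix b b (LieAlgebra.ad ℂ g y) := by
    ext r s
    rw [Matrix.map_apply, ← hx]
    exact eval_linForm b _ y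
  have h4 : (M.map D).map ev = LinearMap.toMatrix b b (LieAlgebra.ad ℂ g z) := by
    ext r s
    rw [Matrix.map_apply, Matrix.map_apply, ← hx]
    change ev (D (linForm b _)) = _
    rw [hD]
    exact eval_C _
  rw [h1, h2, trace_mul_derivation_pow D M m 1 (Commute.one_left M), one_mul, map_mul, map_add,
    map_natCast, map_one]
  congr 1
  rw [LinearMap.trace_eq_matrix_trace ℂ b, LinearMap.toMatrix_mul, ← LinearMap.toMatrix_pow, ← h3,
    ← h4, ← Matrix.map_pow, ← Matrix.map_mul]
  exact AddMonoidHom.map_trace ev.toAddMonoidHom _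

/-- At y the derivative along [a, y] is a multiple of the trace of (ad y)^m [ad a, ad y], which
vanishes by cyclicity. -/
theorem linDerivation_ad_eq_zero (b : Module.Basis σ ℂ g) (m : ℕ) {T : MvPolynomial σ ℂ}
    (hT : ∀ y z : g,
      ∑ k, eval (fun k ↦ killingForm ℂ g (b k) y) (pderiv k T) * killingForm ℂ g (b k) z =
        ((m : ℂ) + 1) * LinearMap.trace ℂ g (LieAlgebra.ad ℂ g y ^ m * LieAlgebra.ad ℂ g z))
    (a : g) : linDerivation b (LieAlgebra.ad ℂ g a) T = 0 := by
  apply MvPolynomial.funext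
  intro v
  obtain ⟨y, rfl⟩ : ∃ y, v = fun k ↦ killingForm ℂ g (b k) y := by
    obtain ⟨y, hy⟩ := exists_killingForm_eq (b.constr ℂ v)
    refine ⟨y, funext fun k ↦ ?_⟩
    rw [LieModule.traceForm_comm, hy, b.constr_basis]
  have h1 := hT y ⁅a, y⁆
  rw [map_zero, derivation_eq_sum_pderiv _ _ Finset.univ (Finset.subset_univ _), map_sum]
  have h2 : LinearMap.trace ℂ g (LieAlgebra.ad ℂ g y ^ m * LieAlgebra.ad ℂ g ⁅a, y⁆) = 0 := by
    rw [ad_lie, mul_sub, map_sub, ← mul_assoc, ← mul_assoc, ← pow_succ,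
      LinearMap.trace_mul_comm, ← mul_assoc, ← pow_succ', sub_self]
  rw [h2, mul_zero] at h1
  rw [← neg_eq_zero, ← Finset.sum_neg_distrib, ← h1]
  refine Finset.sum_congr rfl fun k _ ↦ ?_
  rw [smul_eq_mul, map_mul, linDerivation_X, eval_linForm, ← mul_neg]
  congr 1
  have := LieModule.traceForm_apply_lie_apply' ℂ g g a (b k) y
  exact neg_eq_iff_eq_neg.mpr this

/-- Some element of a Cartan subalgebra generates, through polynomials in its adjoint action, the
adjoint action of the whole Cartan subalgebra. -/
theorem exists_forall_ad_eq_aeval (H : LieSubalgebra ℂ g) [H.IsCartanSubalgebra] :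
    ∃ y ∈ H, ∀ z ∈ H, ∃ p : Polynomial ℂ,
      LieAlgebra.ad ℂ g z = Polynomial.aeval (LieAlgebra.ad ℂ g y) p := by
  classical
  let W := LieModule.Weight ℂ H g
  let S := {q : W × W // q.1 ≠ q.2}
  -- A point of the Cartan subalgebra off the finitely many hyperplanes where two weights agree.
  -- Lagrange interpolation at the distinct weight values then produces ad z from ad y, since both
  -- act by scalars on the weight spaces.
  obtain ⟨y, hy⟩ := Module.Dual.exists_forall_ne_zero_of_forall_exists
    (fun q : S ↦ (LieModule.Weight.toLinear ℂ H g q.1.1 - LieModule.Weight.toLinear ℂ H g q.1.2))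
    fun q ↦ by
      by_contra! h0
      apply q.2
      apply LieModule.Weight.ext
      intro x
      exact sub_eq_zero.mp (h0 x)
  have hinj : Function.Injective fun α : W ↦ α y := by
    intro α β h0
    by_contra hne
    exact hy ⟨(α, β), hne⟩ (sub_eq_zero.mpr h0)
  refine ⟨y, y.2, fun z hz ↦ ⟨Lagrange.interpolate Finset.univ (fun α : W ↦ α y)
    fun α : W ↦ α (⟨z, hz⟩ : H), ?_⟩⟩
  apply LinearMap.ext
  intro x
  have hx : x ∈ ⨆ α : W, LieModule.genWeightSpace g α := by
    rw [LieModule.iSup_genWeightSpace_eq_top' ℂ H g]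
    trivial
  induction hx using LieSubmodule.iSup_induction' with
  | mem α x hx =>
    have h1 : LieAlgebra.ad ℂ g z x = α (⟨z, hz⟩ : H) • x :=
      LieAlgebra.IsKilling.lie_eq_smul_of_mem_rootSpace hx ⟨z, hz⟩
    have h2 : LieAlgebra.ad ℂ g y x = α y • x :=
      LieAlgebra.IsKilling.lie_eq_smul_of_mem_rootSpace hx y
    by_cases hx0 : x = 0
    · rw [hx0, map_zero, map_zero]
    rw [h1, Module.End.aeval_apply_of_hasEigenvector ⟨Module.End.mem_eigenspace_iff.mpr h2, hx0⟩,
      Lagrange.eval_interpolate_at_node _ hinj.injOn (Finset.mem_univ α)]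
  | zero => simp
  | add x₁ x₂ _ _ h₁ h₂ => rw [map_add, map_add, h₁, h₂]

/-- Generators of the algebra of invariants have independent differentials along a Cartan
subalgebra. -/
theorem exists_det_jacobian_ne_zero (b : Module.Basis σ ℂ g)
    (P : Fin (LieAlgebra.rank ℂ g) → MvPolynomial σ ℂ)
    (hgen : ∀ f, (∀ a, linDerivation b (LieAlgebra.ad ℂ g a) f = 0) →
      f ∈ Algebra.adjoin ℂ (Set.range P)) :
    ∃ U : Matrix (Fin (LieAlgebra.rank ℂ g)) σ ℂ,
      (jacobian P * (U.map (C (σ := σ))).transpose).det ≠ 0 := by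
  obtain ⟨x, hx⟩ := LieAlgebra.exists_isRegular ℂ g
  -- The Engel subalgebra of a regular element has minimal dimension, which makes it a Cartan
  -- subalgebra of dimension equal to the rank.
  have hH : (LieSubalgebra.engel ℂ x).IsCartanSubalgebra := by
    refine ⟨?_, LieSubalgebra.normalizer_engel _ _⟩
    apply LieSubalgebra.isNilpotent_of_forall_le_engel
    intro y hy
    set Ex : {LieSubalgebra.engel ℂ z | z ∈ LieSubalgebra.engel ℂ x} :=
      ⟨LieSubalgebra.engel ℂ x, x, LieSubalgebra.self_mem_engel _ _, rfl⟩
    suffices IsBot Ex from @this ⟨LieSubalgebra.engel ℂ y, y, hy, rfl⟩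
    apply LieAlgebra.engel_isBot_of_isMin _ (LieSubalgebra.engel ℂ x) Ex le_rfl
    · rintro ⟨_, y, hy, rfl⟩ hyx
      suffices LieSubalgebra.engel ℂ y = LieSubalgebra.engel ℂ x from this.ge
      apply LieSubalgebra.toSubmodule_injective
      refine Submodule.eq_of_le_of_finrank_le hyx ?_
      refine ((LieAlgebra.isRegular_iff_finrank_engel_eq_rank ℂ x).mp hx).le.trans ?_
      exact LieAlgebra.rank_le_finrank_engel ℂ y
    · exact Cardinal.natCast_le_aleph0.trans (Cardinal.infinite_iff.mp inferInstance)
  let H := LieSubalgebra.engel ℂ x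
  have hrank : Module.finrank ℂ H = LieAlgebra.rank ℂ g :=
    (LieAlgebra.isRegular_iff_finrank_engel_eq_rank ℂ x).mp hx
  let v := Module.finBasisOfFinrankEq ℂ H hrank
  obtain ⟨y, hy, hpoly⟩ := exists_forall_ad_eq_aeval H
  let U : Matrix (Fin (LieAlgebra.rank ℂ g)) σ ℂ :=
    Matrix.of fun j k ↦ killingForm ℂ g (b k) (v j)
  refine ⟨U, fun h0 ↦ ?_⟩
  let ev := eval (fun k ↦ killingForm ℂ g (b k) y)
  have h1 := congrArg ev h0
  rw [map_zero, RingHom.map_det] at h1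
  obtain ⟨w, hw0, hw⟩ := Matrix.exists_mulVec_eq_zero_iff.mpr h1
  -- If the minor vanished at y, some nonzero z in the Cartan subalgebra would be killed by every
  -- dP_i at y, hence by the differentials at y of all invariants. The trace invariants and the
  -- choice of y then give κ(z', z) = 0 for all z' in the Cartan subalgebra, against nondegeneracy.
  let z : H := ∑ j, w j • v j
  have hz0 : z ≠ 0 := fun h ↦ hw0 (funext (Fintype.linearIndependent_iff.mp v.linearIndependent w h))
  have hκ : ∀ k, killingForm ℂ g (b k) z = ∑ j, w j * killingForm ℂ g (b k) (v j) := fun k ↦ by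
    simp [z]
  have hdP : ∀ i, ∑ k, ev (pderiv k (P i)) * killingForm ℂ g (b k) z = 0 := by
    intro i
    have h2 := congrFun hw i
    simp only [Matrix.mulVec, dotProduct, RingHom.mapMatrix_apply, Matrix.map_apply,
      Matrix.mul_apply, Matrix.transpose_apply, Matrix.of_apply, map_sum, map_mul, Pi.zero_apply,
      Finset.sum_mul, U] at h2
    rw [Finset.sum_comm] at h2
    rw [← h2]
    refine Finset.sum_congr rfl fun k _ ↦ ?_
    rw [hκ, Finset.mul_sum]
    refine Finset.sum_congr rfl fun j _ ↦ ?_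
    rw [eval_C]
    ring
  have hdf : ∀ f ∈ Algebra.adjoin ℂ (Set.range P),
      ∑ k, ev (pderiv k f) * killingForm ℂ g (b k) z = 0 := by
    intro f hf
    induction hf using Algebra.adjoin_induction with
    | mem f hf => obtain ⟨i, rfl⟩ := hf; exact hdP i
    | algebraMap r => simp [MvPolynomial.algebraMap_eq]
    | add f₁ f₂ _ _ h₁ h₂ => simp only [map_add, add_mul, Finset.sum_add_distrib, h₁, h₂, add_zero]
    | mul f₁ f₂ _ _ h₁ h₂ =>
      simp only [Derivation.leibniz, smul_eq_mul, map_add, map_mul, add_mul,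
        Finset.sum_add_distrib, mul_assoc, ← Finset.mul_sum, h₁, h₂, mul_zero, add_zero]
  have htr : ∀ m : ℕ,
      LinearMap.trace ℂ g (LieAlgebra.ad ℂ g y ^ m * LieAlgebra.ad ℂ g (z : g)) = 0 := by
    intro m
    obtain ⟨T, hT⟩ := exists_trace_polynomial b m
    have h2 := hT y z
    rw [hdf T (hgen T (linDerivation_ad_eq_zero b m hT))] at h2
    exact (mul_eq_zero.mp h2.symm).resolve_left (by exact_mod_cast Nat.succ_ne_zero m)
  have hpol : ∀ p : Polynomial ℂ, LinearMap.trace ℂ g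
      (Polynomial.aeval (LieAlgebra.ad ℂ g y) p * LieAlgebra.ad ℂ g (z : g)) = 0 := by
    intro p
    rw [Polynomial.aeval_eq_sum_range, Finset.sum_mul, map_sum]
    exact Finset.sum_eq_zero fun m _ ↦ by rw [smul_mul_assoc, map_smul, htr, smul_zero]
  apply hz0
  apply (LieAlgebra.IsKilling.traceForm_cartan_nondegenerate ℂ g H).2
  intro z'
  obtain ⟨p, hp⟩ := hpoly z' z'.2
  have h3 := hpol p
  rw [← hp] at h3
  exact h3

end Cartan

end

end ArcInvariants

namespace ArcInvariants

open scoped Polynomial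

noncomputable section

/-! ### The free kernel of the degenerate matrix -/

section FreeKernel

open Matrix

variable {ι ι' κ : Type*} [Fintype ι] [DecidableEq ι] [Fintype ι'] [DecidableEq ι'] [Fintype κ]
  [DecidableEq κ] {ε : ι' → ℂ} {A : Matrix (ι ⊕ ι') (ι ⊕ ι') (MvPolynomial (ι ⊕ ι') ℂ)}
  {M : Matrix ι ι (MvPolynomial ι ℂ)} {B : Matrix ι ι' (MvPolynomial ι ℂ)}
  {B' : Matrix ι' ι (MvPolynomial ι ℂ)} {D : Matrix ι' ι' ℂ}
  {D' : Matrix ι' ι' (MvPolynomial ι ℂ)}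

/-- The kernel of the degeneration of a skew matrix is freely generated by the differentials of
the initial forms. -/
theorem IsSliceMatrix.hasFreeKernel (h : IsSliceMatrix ε A M B B' D D') (hA : Aᵀ = -A)
    (P : κ → MvPolynomial (ι ⊕ ι') ℂ)
    (hP : ∀ i v, ∑ u, MvPolynomial.pderiv u (P i) * A v u = 0)
    (hex : ∃ U : Matrix κ (ι ⊕ ι') (MvPolynomial (ι ⊕ ι') ℂ), (jacobian P * Uᵀ).det ≠ 0)
    (hcop : ∀ p, Prime p → ∃ U : Matrix κ (ι ⊕ ι') (MvPolynomial (ι ⊕ ι') ℂ),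
      ¬ p ∣ (jacobian P * Uᵀ).det)
    (hdeg : 2 * ∑ i, sliceOrder ε (P i) = Fintype.card ι + Fintype.card κ)
    (hreg : ∀ p, Prime p → ∃ U V : Matrix κ ι ℂ,
      ¬ p ∣ (M + (U.map (MvPolynomial.C (σ := ι)))ᵀ * V.map (MvPolynomial.C (σ := ι))).det) :
    HasFreeKernel (fun a k ↦ M a k) fun i ↦ sliceLead ε (P i) := by
  have hr : A * (jacobian P)ᵀ = 0 := by
    ext1 v i
    rw [Matrix.mul_apply, Matrix.zero_apply, ← hP i v]
    exact Finset.sum_congr rfl fun u _ ↦ mul_comm _ _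
  have hl : jacobian P * A = 0 := by
    rw [← transpose_eq_zero, transpose_mul, hA, Matrix.neg_mul, hr, neg_zero]
  obtain ⟨c, hc⟩ := exists_det_add_eq_mul A (jacobian P) hl hr hex hcop
  have hdet := h.det_identity P c hc hdeg
  set F : κ → MvPolynomial ι ℂ := fun i ↦ sliceLead ε (P i) with hF
  have hdet : ∀ U V : Matrix κ ι ℂ,
      (M + (U.map (MvPolynomial.C (σ := ι)))ᵀ * V.map (MvPolynomial.C (σ := ι))).det *
        MvPolynomial.C D.det = Polynomial.constantCoeff (sliceHom ε c) *
        (jacobian F * (U.map (MvPolynomial.C (σ := ι)))ᵀ).det *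
        (jacobian F * (V.map (MvPolynomial.C (σ := ι)))ᵀ).det := hdet
  have hD : IsUnit (MvPolynomial.C D.det : MvPolynomial ι ℂ) :=
    (isUnit_iff_ne_zero.mpr h.det_ne_zero).map MvPolynomial.C
  -- Any prime serves, for instance a variable; with no variables the determinant is empty and
  -- equals 1. This shows that the constant of the identity and one minor are nonzero.
  obtain ⟨U₀, V₀, hUV⟩ : ∃ U V : Matrix κ ι ℂ,
      (M + (U.map (MvPolynomial.C (σ := ι)))ᵀ * V.map (MvPolynomial.C (σ := ι))).det ≠ 0 := by
    rcases isEmpty_or_nonempty ι with hι | ⟨⟨k⟩⟩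
    · exact ⟨0, 0, by rw [det_isEmpty]; exact one_ne_zero⟩
    · obtain ⟨U, V, hUV⟩ := hreg _ (MvPolynomial.X_prime (i := k))
      exact ⟨U, V, fun h0 ↦ hUV (h0 ▸ dvd_zero _)⟩
  have hne : (M + (U₀.map (MvPolynomial.C (σ := ι)))ᵀ * V₀.map (MvPolynomial.C (σ := ι))).det *
      MvPolynomial.C D.det ≠ 0 := mul_ne_zero hUV hD.ne_zero
  rw [hdet] at hne
  have hc0 := left_ne_zero_of_mul (left_ne_zero_of_mul hne)
  have hU₀ := right_ne_zero_of_mul (left_ne_zero_of_mul hne)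
  have hMJ : M * (jacobian F)ᵀ = 0 := by
    ext1 a i
    rw [Matrix.mul_apply, Matrix.zero_apply, ← h.sum_pderiv_mul_eq_zero (P i) (hP i) a]
    exact Finset.sum_congr rfl fun u _ ↦ mul_comm _ _
  refine ⟨fun v hv ↦ ?_, fun d hd ↦ ?_⟩
  · obtain ⟨d, rfl⟩ := exists_eq_mulVec_of_mulVec_eq_zero M (jacobian F) hMJ
      (Set.range fun U : Matrix κ ι ℂ ↦ U.map (MvPolynomial.C (σ := ι)))
      (by
        rintro _ ⟨U, rfl⟩ hU h0
        have h1 := hdet U U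
        rw [h0, zero_mul, eq_comm] at h1
        exact mul_ne_zero (mul_ne_zero hc0 hU) hU h1)
      ⟨_, ⟨U₀, rfl⟩, hU₀⟩
      -- A prime dividing all minors of the initial forms would divide every det(M + Uᵀ V), up to
      -- the unit det D.
      (by
        intro p hp
        by_contra! hall
        obtain ⟨U, V, hUV⟩ := hreg p hp
        apply hUV
        have h1 : p ∣ _ := Dvd.dvd.mul_left (hall _ ⟨V, rfl⟩)
          (Polynomial.constantCoeff (sliceHom ε c) *
            (jacobian F * (U.map (MvPolynomial.C (σ := ι)))ᵀ).det)
        rw [← hdet] at h1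
        exact hD.dvd_mul_right.mp h1)
      v (by
        funext a
        rw [Pi.zero_apply, ← hv a]
        exact Finset.sum_congr rfl fun u _ ↦ mul_comm _ _)
    exact ⟨d, fun k ↦ Finset.sum_congr rfl fun i _ ↦ mul_comm _ _⟩
  · apply eq_zero_of_vecMul_eq_zero hU₀
    rw [← vecMul_vecMul]
    have : d ᵥ* jacobian F = 0 := funext hd
    rw [this, zero_vecMul]

omit [DecidableEq ι] in
-- A constant has zero differential, which independence forbids.
theorem HasFreeKernel.pos_of_isHomogeneous {M : ι → ι → MvPolynomial ι ℂ}
    {F : κ → MvPolynomial ι ℂ} (h : HasFreeKernel M F) {i : κ} {n : ℕ}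
    (hF : (F i).IsHomogeneous n) : 0 < n := by
  by_contra h0
  obtain rfl : n = 0 := by omega
  have h1 : F i = MvPolynomial.C (MvPolynomial.coeff 0 (F i)) :=
    MvPolynomial.totalDegree_eq_zero_iff_eq_C.mp (Nat.le_zero.mp hF.totalDegree_le)
  have h2 := h.independent (Pi.single i 1) fun k ↦ by
    rw [Finset.sum_eq_single i]
    · rw [h1, MvPolynomial.pderiv_C, mul_zero]
    · intro j _ hj
      rw [Pi.single_eq_of_ne hj, zero_mul]
    · simp
  have h3 := congrFun h2 i
  rw [Pi.single_eq_same] at h3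
  exact one_ne_zero h3

/-- A square matrix becomes invertible after a perturbation of rank its corank. -/
theorem exists_det_add_ne_zero {K : Type*} [Field K] (N : Matrix ι ι K)
    (hN : Module.finrank K (LinearMap.ker N.mulVecLin) = Fintype.card κ) :
    ∃ U V : Matrix κ ι K, (N + Uᵀ * V).det ≠ 0 := by
  -- `U` parametrizes a complement of the range and `V` extends an isomorphism of the kernel with
  -- the same space, so a null vector of the sum lies in the kernel and has zero image there.
  obtain ⟨W, hW⟩ := Submodule.exists_isCompl (LinearMap.range N.mulVecLin)
  have h1 := LinearMap.finrank_range_add_finrank_ker N.mulVecLin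
  have h2 := Submodule.finrank_add_eq_of_isCompl hW
  have e₁ : (κ → K) ≃ₗ[K] W := LinearEquiv.ofFinrankEq _ _ (by
    rw [Module.finrank_fintype_fun_eq_card]; omega)
  have e₂ : LinearMap.ker N.mulVecLin ≃ₗ[K] (κ → K) := LinearEquiv.ofFinrankEq _ _ (by
    rw [Module.finrank_fintype_fun_eq_card]; omega)
  obtain ⟨β, hβ⟩ := LinearMap.exists_extend e₂.toLinearMap
  refine ⟨(LinearMap.toMatrix' (W.subtype ∘ₗ e₁.toLinearMap))ᵀ, LinearMap.toMatrix' β, fun h0 ↦ ?_⟩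
  obtain ⟨x, hx0, hx⟩ := exists_mulVec_eq_zero_iff.mpr h0
  rw [transpose_transpose, add_mulVec, ← mulVec_mulVec, LinearMap.toMatrix'_mulVec,
    LinearMap.toMatrix'_mulVec] at hx
  have hx1 : N *ᵥ x = -(e₁ (β x) : ι → K) := eq_neg_of_add_eq_zero_left hx
  have hx2 : N *ᵥ x = 0 := by
    refine Submodule.disjoint_def.mp hW.disjoint _ ⟨x, rfl⟩ ?_
    rw [hx1]
    exact W.neg_mem (e₁ (β x)).2
  rw [hx2, eq_comm, neg_eq_zero] at hx1
  have hβx : β x = 0 := by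
    have : e₁ (β x) = 0 := Subtype.ext hx1
    exact (LinearEquiv.map_eq_zero_iff e₁).mp this
  have h3 : e₂ ⟨x, hx2⟩ = 0 := by
    rw [← hβx]
    exact (DFunLike.congr_fun hβ ⟨x, hx2⟩).symm
  exact hx0 (congrArg Subtype.val ((LinearEquiv.map_eq_zero_iff e₂).mp h3))

end FreeKernel

/-! ### Symmetric algebras in coordinates -/

section SymmetricCoordinates

open MvPolynomial SymmetricAlgebra

variable {σ M : Type*} [AddCommGroup M] [Module ℂ M] (b : Module.Basis σ ℂ M)

theorem equivMvPolynomial_ι (x : M) :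
    equivMvPolynomial b (SymmetricAlgebra.ι ℂ M x) = linForm b x := by
  have : (equivMvPolynomial b).toLinearMap ∘ₗ SymmetricAlgebra.ι ℂ M = linForm b := by
    apply b.ext
    intro k
    simp
  exact DFunLike.congr_fun this x

theorem equivMvPolynomial_symDer (φ : M →ₗ[ℂ] M) (F : SymmetricAlgebra ℂ M) :
    equivMvPolynomial b (symDer φ F) = linDerivation b φ (equivMvPolynomial b F) := by
  induction F using SymmetricAlgebra.induction with
  | algebraMap r => simp
  | ι x => rw [symDer_ι, equivMvPolynomial_ι, equivMvPolynomial_ι, linDerivation_linForm]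
  | mul f g hf hg => simp only [Derivation.leibniz, map_add, map_mul, smul_eq_mul, hf, hg]
  | add f g hf hg => simp only [map_add, hf, hg]

theorem mem_symInvariants_iff {A : Type*} (ρ : A → M →ₗ[ℂ] M) (F : SymmetricAlgebra ℂ M) :
    F ∈ symInvariants ρ ↔ ∀ a, linDerivation b (ρ a) (equivMvPolynomial b F) = 0 := by
  refine forall_congr' fun a ↦ ?_
  rw [← equivMvPolynomial_symDer]
  exact (map_eq_zero_iff _ (equivMvPolynomial b).injective).symm

theorem lift_eq_eval (χ : Module.Dual ℂ M) (F : SymmetricAlgebra ℂ M) :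
    SymmetricAlgebra.lift χ F = eval (fun k ↦ χ (b k)) (equivMvPolynomial b F) := by
  have : (SymmetricAlgebra.lift χ : SymmetricAlgebra ℂ M →ₐ[ℂ] ℂ) =
      (aeval fun k ↦ χ (b k)).comp (equivMvPolynomial b).toAlgHom := by
    apply SymmetricAlgebra.algHom_ext
    apply b.ext
    intro k
    simp
  have h1 := DFunLike.congr_fun this F
  rw [AlgHom.comp_apply, aeval_eq_eval] at h1
  exact h1

theorem lift_ι_linForm (χ : Module.Dual ℂ M) (x : M) :
    eval (fun k ↦ χ (b k)) (linForm b x) = χ x := by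
  rw [← equivMvPolynomial_ι, ← lift_eq_eval, SymmetricAlgebra.lift_ι_apply]

/-! ### Codimension and the singular set -/

/-- If a polynomial vanishes only on points of `Z`, then `Z` has codimension at most `1`. -/
theorem codim_le_one_of_forall_eval {q ι : Type*} [LieRing q] [LieAlgebra ℂ q] [Fintype ι]
    (b : Module.Basis ι ℂ q) (Z : Set (Module.Dual ℂ q)) {p : MvPolynomial ι ℂ} (hp : Prime p)
    (h : ∀ χ : Module.Dual ℂ q, eval (fun k ↦ χ (b k)) p = 0 → χ ∈ Z) : codim Z ≤ 1 := by
  let E := equivMvPolynomial b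
  have : IsNoetherianRing (SymmetricAlgebra ℂ q) := isNoetherianRing_of_ringEquiv _ E.symm.toRingEquiv
  have hp' : Prime (E.symm p) := (MulEquiv.prime_iff E.symm.toMulEquiv).mpr hp
  have hprime := (Ideal.span_singleton_prime hp'.ne_zero).mpr hp'
  have hmin : Ideal.span {E.symm p} ∈ (Ideal.span {E.symm p}).minimalPrimes := by
    rw [Ideal.minimalPrimes_eq_subsingleton_self]
    rfl
  refine le_trans (Ideal.height_mono ?_)
    (Ideal.height_le_one_of_isPrincipal_of_mem_minimalPrimes (Ideal.span {E.symm p}) _ hmin)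
  intro F hF
  have hprime' : (Ideal.span {p}).IsPrime := (Ideal.span_singleton_prime hp.ne_zero).mpr hp
  -- By the Nullstellensatz, a function that vanishes on `Z`, hence on the hypersurface p = 0, is
  -- divisible by the prime p. Krull's theorem bounds the height of (p).
  have h1 : E F ∈ MvPolynomial.vanishingIdeal ℂ (zeroLocus ℂ (Ideal.span {p})) := by
    intro v hv
    have hv' : aeval v p = 0 := hv p (Ideal.mem_span_singleton_self p)
    let χ : Module.Dual ℂ q := b.constr ℂ v
    have hχ : (fun k ↦ χ (b k)) = v := funext fun k ↦ b.constr_basis ℂ v k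
    have h2 : χ ∈ Z := h χ (by rw [hχ, ← aeval_eq_eval]; exact hv')
    have h3 : (SymmetricAlgebra.lift χ : SymmetricAlgebra ℂ q →ₐ[ℂ] ℂ) F = 0 := by
      have := hF
      rw [ArcInvariants.vanishingIdeal, Ideal.mem_iInf] at this
      have := this χ
      rw [Ideal.mem_iInf] at this
      exact this h2
    rw [lift_eq_eval b, hχ, ← aeval_eq_eval] at h3
    exact h3
  rw [vanishingIdeal_zeroLocus_eq_radical, hprime'.radical, Ideal.mem_span_singleton] at h1
  rw [Ideal.mem_span_singleton]
  have := map_dvd E.symm h1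
  rwa [AlgEquiv.symm_apply_apply] at this

/-- The matrix of the Poisson bracket on linear forms. -/
abbrev poissonMatrix {q ι : Type*} [LieRing q] [LieAlgebra ℂ q] (b : Module.Basis ι ℂ q) :
    Matrix ι ι (MvPolynomial ι ℂ) :=
  Matrix.of fun i j ↦ linForm b ⁅b i, b j⁆

/-- At a regular χ the Poisson matrix has corank ℓ, and some perturbation of rank ℓ makes it
invertible. If p divided all these determinants, every zero of p would be singular, and the singular
set would have codimension at most 1. -/
theorem exists_not_dvd_det_poissonMatrix {q ι κ : Type*} [LieRing q] [LieAlgebra ℂ q] [Fintype ι]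
    [DecidableEq ι] [Fintype κ] [DecidableEq κ] (b : Module.Basis ι ℂ q)
    (hq : 2 ≤ codim (singularSet q (Fintype.card κ))) (p : MvPolynomial ι ℂ) (hp : Prime p) :
    ∃ U V : Matrix κ ι ℂ,
      ¬ p ∣ (poissonMatrix b + (U.map (C (σ := ι))).transpose * V.map (C (σ := ι))).det := by
  by_contra! hall
  refine absurd (hq.trans (codim_le_one_of_forall_eval b _ hp fun χ hχ hstab ↦ ?_)) (by decide)
  let ev := eval fun k ↦ χ (b k)
  have hev : ∀ x, ev (linForm b x) = χ x := lift_ι_linForm b χ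
  let N : Matrix ι ι ℂ := Matrix.of fun i j ↦ χ ⁅b i, b j⁆
  have hker : Module.finrank ℂ (LinearMap.ker N.mulVecLin) = Fintype.card κ := by
    rw [← hstab]
    refine LinearEquiv.finrank_eq (LinearEquiv.symm ?_)
    refine LinearEquiv.ofSubmodules b.equivFun _ _ ?_
    ext v
    rw [Submodule.mem_map_equiv, LinearMap.mem_ker, coadjointStabilizer, LinearMap.mem_ker]
    have hx : ∀ i, ((LieAlgebra.ad ℂ q : q →ₗ[ℂ] q →ₗ[ℂ] q).compr₂ χ) (b.equivFun.symm v) (b i) =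
        -(N.mulVec v i) := by
      intro i
      change χ ⁅b.equivFun.symm v, b i⁆ = _
      rw [b.equivFun_symm_apply, sum_lie, map_sum, Matrix.mulVec, dotProduct,
        ← Finset.sum_neg_distrib]
      refine Finset.sum_congr rfl fun j _ ↦ ?_
      rw [smul_lie, map_smul, ← lie_skew, map_neg, smul_eq_mul, show N i j = χ ⁅b i, b j⁆ from rfl]
      ring
    constructor
    · intro h0
      funext i
      have := hx i
      rw [h0, LinearMap.zero_apply, eq_comm, neg_eq_zero] at this
      exact this
    · intro h0
      apply b.ext
      intro i
      rw [hx, show N.mulVec v = 0 from h0]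
      simp
  obtain ⟨U, V, hUV⟩ := exists_det_add_ne_zero (κ := κ) N hker
  apply hUV
  have h1 : ev (poissonMatrix b + (U.map (C (σ := ι))).transpose * V.map (C (σ := ι))).det =
      (N + U.transpose * V).det := by
    rw [RingHom.map_det]
    congr 1
    ext i j
    simp [N, hev, Matrix.mul_apply, ev]
  rw [← h1]
  obtain ⟨r, hr⟩ := hall U V
  rw [hr, map_mul, show ev p = 0 from hχ, zero_mul]

end SymmetricCoordinates

end

end ArcInvariants

namespace ArcInvariants

open scoped Polynomial

noncomputable section

/-! ### The Slodowy slice in coordinates -/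

section SliceCoordinates

open MvPolynomial SymmetricAlgebra

/-! ### Degrees in coordinates -/

section Grading

variable {σ M : Type*} [AddCommGroup M] [Module ℂ M] (b : Module.Basis σ ℂ M)

theorem gradingHom_ι (x : M) :
    gradingHom M (SymmetricAlgebra.ι ℂ M x) =
      Polynomial.X * Polynomial.C (SymmetricAlgebra.ι ℂ M x) := by
  rw [gradingHom, SymmetricAlgebra.lift_ι_apply, mul_comm, Polynomial.C_mul_X_eq_monomial]
  rfl

theorem map_gradingHom (F : SymmetricAlgebra ℂ M) :
    (gradingHom M F).map (equivMvPolynomial b : SymmetricAlgebra ℂ M →+* MvPolynomial σ ℂ) =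
      aeval (fun k ↦ (Polynomial.X * Polynomial.C (X k) : (MvPolynomial σ ℂ)[X]))
        (equivMvPolynomial b F) := by
  have : (Polynomial.mapAlgHom (equivMvPolynomial b).toAlgHom).comp (gradingHom M) =
      (aeval fun k ↦ (Polynomial.X * Polynomial.C (X k) : (MvPolynomial σ ℂ)[X])).comp
        (equivMvPolynomial b).toAlgHom := by
    apply SymmetricAlgebra.algHom_ext
    apply b.ext
    intro k
    simp [gradingHom_ι]
  exact DFunLike.congr_fun this F

theorem aeval_X_mul_C_of_isHomogeneous {f : MvPolynomial σ ℂ} {n : ℕ} (hf : f.IsHomogeneous n) :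
    aeval (fun k ↦ (Polynomial.X * Polynomial.C (X k) : (MvPolynomial σ ℂ)[X])) f =
      Polynomial.C f * Polynomial.X ^ n := by
  conv_lhs => rw [f.as_sum]
  conv_rhs => rw [f.as_sum]
  rw [map_sum, map_sum, Finset.sum_mul]
  refine Finset.sum_congr rfl fun d hd ↦ ?_
  have hn : d.degree = n := by
    rw [← hf (mem_support_iff.mp hd), Finsupp.degree_eq_weight_one]
    rfl
  rw [aeval_monomial, monomial_eq, map_mul, Finsupp.prod, Finsupp.prod, map_prod]
  simp only [mul_pow, Finset.prod_mul_distrib, map_pow]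
  rw [Finset.prod_pow_eq_pow_sum, ← Finsupp.degree_apply, hn]
  rw [IsScalarTower.algebraMap_apply ℂ (MvPolynomial σ ℂ) (MvPolynomial σ ℂ)[X],
    MvPolynomial.algebraMap_eq, Polynomial.algebraMap_eq]
  ring

theorem symDegree_eq_of_isHomogeneous {F : SymmetricAlgebra ℂ M} {n : ℕ}
    (hF : (equivMvPolynomial b F).IsHomogeneous n) (h0 : F ≠ 0) : symDegree F = n := by
  have h1 := map_gradingHom b F
  rw [aeval_X_mul_C_of_isHomogeneous hF] at h1
  rw [symDegree, ← Polynomial.natDegree_map_eq_of_injective (equivMvPolynomial b).injective]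
  refine (congrArg Polynomial.natDegree h1).trans (Polynomial.natDegree_C_mul_X_pow n _ ?_)
  exact (map_ne_zero_iff _ (equivMvPolynomial b).injective).mpr h0

theorem symDegree_zero : symDegree (0 : SymmetricAlgebra ℂ M) = 0 := by
  rw [symDegree, map_zero, Polynomial.natDegree_zero]

end Grading

/-! ### The decomposition of g along the slice -/

variable {g : Type*} [LieRing g] [LieAlgebra ℂ g] [FiniteDimensional ℂ g]

/-- The intersection is trivial by sl₂-theory, and the dimensions add up because g^e and g^f are
dual to each other. -/
theorem IsTriple.isCompl [LieAlgebra.IsSimple ℂ g] {e h f : g} (t : IsTriple e h f) :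
    IsCompl (centralizer e).toSubmodule (LinearMap.range (LieAlgebra.ad ℂ g f)) := by
  have hdisj : Disjoint (centralizer e).toSubmodule (LinearMap.range (LieAlgebra.ad ℂ g f)) := by
    rw [Submodule.disjoint_def]
    rintro _ hx ⟨z, rfl⟩
    exact t.eq_zero_of_lie_eq_zero z hx
  refine ⟨hdisj, ?_⟩
  rw [codisjoint_iff]
  apply Submodule.eq_top_of_finrank_eq
  have h1 := Submodule.finrank_sup_add_finrank_inf_eq (centralizer e).toSubmodule
    (LinearMap.range (LieAlgebra.ad ℂ g f))
  rw [hdisj.eq_bot, finrank_bot, add_zero] at h1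
  have h2 := LinearMap.finrank_range_add_finrank_ker (LieAlgebra.ad ℂ g f)
  have h3 : Module.finrank ℂ (centralizer e) = Module.finrank ℂ (centralizer f) := by
    rw [(killingEquiv t).finrank_eq, Subspace.dual_finrank_eq]
  have h4 : LinearMap.ker (LieAlgebra.ad ℂ g f) = (centralizer f).toSubmodule := rfl
  rw [h4] at h2
  rw [h1, ← h2, add_comm]
  exact congrArg _ h3

omit [FiniteDimensional ℂ g] in
theorem killingForm_lie_left (x y z : g) : killingForm ℂ g ⁅x, y⁆ z = -killingForm ℂ g y ⁅x, z⁆ :=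
  LieModule.traceForm_apply_lie_apply' ℂ g g x y z

omit [FiniteDimensional ℂ g] in
-- Since 2e = [h, e], invariance of κ moves e onto x, where it acts by zero. So the slice
-- coordinates have no constant term at e.
theorem IsTriple.killingForm_eq_zero {e h f : g} (t : IsTriple e h f) {x : g}
    (hx : ⁅e, x⁆ = 0) : killingForm ℂ g x e = 0 := by
  have h1 : (2 : ℂ) * killingForm ℂ g x e = 0 := by
    rw [← smul_eq_mul, ← map_smul, ← t.lie_h_e, ← lie_skew, map_neg, ← killingForm_lie_left, hx,
      map_zero, LinearMap.zero_apply]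
  exact (mul_eq_zero.mp h1).resolve_left two_ne_zero

/-- A basis of `g` adapted to `g = g^e ⊕ [f, g]`. -/
structure IsSliceBasis {ι ι' : Type*} (e f : g) (bq : Module.Basis ι ℂ (centralizer e))
    (b : Module.Basis (ι ⊕ ι') ℂ g) : Prop where
  inl : ∀ k, b (.inl k) = bq k
  inr : ∀ k, ∃ z, b (.inr k) = ⁅f, z⁆

theorem IsTriple.exists_isSliceBasis [LieAlgebra.IsSimple ℂ g] {e h f : g} (t : IsTriple e h f)
    {ι ι' : Type*} (bq : Module.Basis ι ℂ (centralizer e))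
    (br : Module.Basis ι' ℂ (LinearMap.range (LieAlgebra.ad ℂ g f))) :
    ∃ b : Module.Basis (ι ⊕ ι') ℂ g, IsSliceBasis e f bq b := by
  refine ⟨(Module.Basis.prod (R := ℂ) (M := (centralizer e).toSubmodule) bq br).map
    (Submodule.prodEquivOfIsCompl _ _ t.isCompl), fun k ↦ ?_, fun k ↦ ?_⟩
  · rw [Module.Basis.map_apply, Module.Basis.prod_apply]
    simp
  · obtain ⟨z, hz⟩ := (br k).2
    refine ⟨z, ?_⟩
    rw [Module.Basis.map_apply, Module.Basis.prod_apply]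
    simp [← hz]

variable {ι ι' : Type*} {e h f : g} {bq : Module.Basis ι ℂ (centralizer e)}
  {b : Module.Basis (ι ⊕ ι') ℂ g}

omit [FiniteDimensional ℂ g] in
theorem IsSliceBasis.repr_inl (hb : IsSliceBasis e f bq b) (x : centralizer e) (k : ι) :
    b.repr x (.inl k) = bq.repr x k := by
  have : (b.coord (.inl k)) ∘ₗ (centralizer e).toSubmodule.subtype = bq.coord k := by
    apply bq.ext
    intro j
    have h1 : b.repr (bq j : g) = Finsupp.single (.inl j) 1 := by rw [← hb.inl, b.repr_self]
    change b.repr (bq j : g) (.inl k) = bq.repr (bq j) k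
    classical
    rw [h1, bq.repr_self, Finsupp.single_apply, Finsupp.single_apply]
    simp
  exact DFunLike.congr_fun this x

omit [FiniteDimensional ℂ g] in
theorem IsSliceBasis.repr_inr (hb : IsSliceBasis e f bq b) (x : centralizer e) (k : ι') :
    b.repr x (.inr k) = 0 := by
  have : (b.coord (.inr k)) ∘ₗ (centralizer e).toSubmodule.subtype = 0 := by
    apply bq.ext
    intro j
    have h1 : b.repr (bq j : g) = Finsupp.single (.inl j) 1 := by rw [← hb.inl, b.repr_self]
    change b.repr (bq j : g) (.inr k) = 0
    classical
    rw [h1, Finsupp.single_apply]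
    simp
  exact DFunLike.congr_fun this x

/-- The coordinates of the value at `e` of the linear functions transversal to the slice. -/
abbrev sliceValue (e : g) (b : Module.Basis (ι ⊕ ι') ℂ g) (k : ι') : ℂ :=
  killingForm ℂ g (b (.inr k)) e

omit [FiniteDimensional ℂ g] in
theorem IsSliceBasis.sliceHom_linForm [Fintype ι] [Fintype ι'] (t : IsTriple e h f)
    (hb : IsSliceBasis e f bq b) (x : g) :
    sliceHom (sliceValue e b) (linForm b x) = Polynomial.C (C (killingForm ℂ g x e)) +
      Polynomial.X * Polynomial.C (∑ k, C (b.repr x (.inl k)) * X k) := by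
  have hx : killingForm ℂ g x e = ∑ k, b.repr x (.inr k) * sliceValue e b k := by
    conv_lhs => rw [← b.sum_repr x]
    rw [map_sum, LinearMap.sum_apply, Fintype.sum_sum_type]
    have h0 : ∀ k, killingForm ℂ g (b (.inl k)) e = 0 := fun k ↦ by
      rw [hb.inl]
      exact t.killingForm_eq_zero (bq k).2
    simp only [map_smul, LinearMap.smul_apply, smul_eq_mul, h0, mul_zero, Finset.sum_const_zero,
      zero_add]
  rw [hx, linForm_apply, map_sum, Fintype.sum_sum_type, add_comm]
  congr 1
  · rw [map_sum, map_sum]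
    refine Finset.sum_congr rfl fun k _ ↦ ?_
    rw [map_mul, sliceHom_inr, sliceHom_C, ← map_mul, ← map_mul]
  · rw [map_sum, Finset.mul_sum]
    refine Finset.sum_congr rfl fun k _ ↦ ?_
    rw [map_mul, sliceHom_inl, sliceHom_C, map_mul]
    ring

omit [FiniteDimensional ℂ g] in
theorem poissonMatrix_apply {σ : Type*} (b : Module.Basis σ ℂ g) (i j : σ) :
    poissonMatrix b i j = linForm b ⁅b i, b j⁆ := rfl

/-- The constant term at e is the skew form κ([x, y], e), whose radical is g^e. It therefore
vanishes in every block that involves g^e and is nondegenerate on the complement [f, g]. -/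
theorem IsSliceBasis.isSliceMatrix [LieAlgebra.IsSimple ℂ g] [Fintype ι] [Fintype ι'] [DecidableEq ι] [DecidableEq ι']
    (t : IsTriple e h f) (hb : IsSliceBasis e f bq b) :
    IsSliceMatrix (sliceValue e b) (poissonMatrix b) (poissonMatrix bq)
      (Matrix.of fun i j ↦ ∑ k, C (b.repr ⁅b (.inl i), b (.inr j)⁆ (.inl k)) * X k)
      (Matrix.of fun i j ↦ ∑ k, C (b.repr ⁅b (.inr i), b (.inl j)⁆ (.inl k)) * X k)
      (Matrix.of fun i j ↦ killingForm ℂ g ⁅b (.inr i), b (.inr j)⁆ e)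
      (Matrix.of fun i j ↦ ∑ k, C (b.repr ⁅b (.inr i), b (.inr j)⁆ (.inl k)) * X k) := by
  have hl : ∀ (k : ι) (x : g), killingForm ℂ g ⁅b (.inl k), x⁆ e = 0 := fun k x ↦ by
    have h1 : ⁅e, b (.inl k)⁆ = 0 := by rw [hb.inl]; exact (bq k).2
    rw [killingForm_lie_left, ← lie_skew, h1, neg_zero, map_zero, neg_zero]
  have hr : ∀ (k : ι) (x : g), killingForm ℂ g ⁅x, b (.inl k)⁆ e = 0 := fun k x ↦ by
    rw [← lie_skew, map_neg, LinearMap.neg_apply, hl, neg_zero]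
  refine ⟨fun i j ↦ ?_, fun i j ↦ ?_, fun i j ↦ ?_, fun i j ↦ ?_, fun h0 ↦ ?_⟩
  · rw [poissonMatrix_apply, hb.sliceHom_linForm t, hl, map_zero, map_zero, zero_add,
      poissonMatrix_apply, linForm_apply, hb.inl, hb.inl]
    congr 2
    refine Finset.sum_congr rfl fun k _ ↦ ?_
    rw [← hb.repr_inl]
    rfl
  · rw [poissonMatrix_apply, hb.sliceHom_linForm t, hl, map_zero, map_zero, zero_add,
      Matrix.of_apply]
  · rw [poissonMatrix_apply, hb.sliceHom_linForm t, hr, map_zero, map_zero, zero_add,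
      Matrix.of_apply]
  · rw [poissonMatrix_apply, hb.sliceHom_linForm t, Matrix.of_apply, Matrix.of_apply]
  · obtain ⟨w, hw0, hw⟩ := Matrix.exists_mulVec_eq_zero_iff.mpr h0
    -- A null vector would give an element of [f, g] commuting with e, hence zero.
    let y : g := ∑ j, w j • b (.inr j)
    have hκ : ∀ x, killingForm ℂ g ⁅x, y⁆ e = killingForm ℂ g x ⁅y, e⁆ := fun x ↦ by
      rw [← lie_skew, map_neg, LinearMap.neg_apply, killingForm_lie_left, neg_neg]
    have h1 : (killingForm ℂ g).flip ⁅y, e⁆ = 0 := by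
      apply b.ext
      rintro (i | i)
      · change killingForm ℂ g (b (.inl i)) ⁅y, e⁆ = 0
        rw [← hκ, hl]
      · have h2 := congrFun hw i
        change killingForm ℂ g (b (.inr i)) ⁅y, e⁆ = 0
        rw [← hκ, lie_sum, map_sum, LinearMap.sum_apply]
        rw [Pi.zero_apply, Matrix.mulVec, dotProduct] at h2
        rw [← h2]
        refine Finset.sum_congr rfl fun j _ ↦ ?_
        rw [lie_smul, map_smul, LinearMap.smul_apply, smul_eq_mul, Matrix.of_apply, mul_comm]
    have h2 : ⁅y, e⁆ = 0 := by
      apply (LieAlgebra.IsKilling.killingForm_nondegenerate ℂ g).2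
      exact fun x ↦ DFunLike.congr_fun h1 x
    have h3 : ⁅e, y⁆ = 0 := by rw [← lie_skew, h2, neg_zero]
    apply hw0
    funext k
    have h4 : b.repr y (.inr k) = 0 := hb.repr_inr ⟨y, h3⟩ k
    have h5 : b.repr y (.inr k) = w k := by
      simp [y, Finsupp.single_apply]
    rw [← h5, h4, Pi.zero_apply]

theorem _root_.Polynomial.natTrailingDegree_map_of_injective {R S : Type*} [Semiring R]
    [Semiring S] {φ : R →+* S} (hφ : Function.Injective φ) (p : R[X]) :
    (p.map φ).natTrailingDegree = p.natTrailingDegree := by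
  by_cases hp : p = 0
  · rw [hp, Polynomial.map_zero, Polynomial.natTrailingDegree_zero,
      Polynomial.natTrailingDegree_zero]
  have hp' : p.map φ ≠ 0 := (Polynomial.map_ne_zero_iff hφ).mpr hp
  rw [Polynomial.natTrailingDegree_eq_support_min' hp,
    Polynomial.natTrailingDegree_eq_support_min' hp']
  simp only [Polynomial.support_map_of_injective p hφ]

theorem trailingCoeff_mapAlgHom {R S : Type*} [CommRing R] [Algebra ℂ R] [CommRing S] [Algebra ℂ S]
    {φ : R →ₐ[ℂ] S} (hφ : Function.Injective φ) (p : R[X]) :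
    (Polynomial.mapAlgHom φ p).trailingCoeff = φ p.trailingCoeff := by
  rw [Polynomial.coe_mapAlgHom, Polynomial.trailingCoeff, Polynomial.coeff_map,
    Polynomial.natTrailingDegree_map_of_injective (φ := (φ : R →+* S)) hφ]
  rfl

/-- As κ([f, g], g^f) = 0, the transversal linear functions are constant on the slice; so `sliceHom`
is the restriction followed by the grading. Injective coefficient maps commute with taking the
lowest coefficient. -/
theorem IsSliceBasis.equivMvPolynomial_sliceInitial [LieAlgebra.IsSimple ℂ g]
    (t : IsTriple e h f) (hb : IsSliceBasis e f bq b) (P : SymmetricAlgebra ℂ g) :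
    equivMvPolynomial bq (sliceInitial t P) =
      sliceLead (sliceValue e b) (equivMvPolynomial b P) := by
  let Λ₁ := SymmetricAlgebra.lift
    (SymmetricAlgebra.ι ℂ (centralizer e) ∘ₗ (killingEquiv t).symm.toLinearMap)
  let Λ₂ := SymmetricAlgebra.lift
    (SymmetricAlgebra.ι ℂ (Module.Dual ℂ (centralizer f)) ∘ₗ (killingEquiv t).toLinearMap)
  have hΛ : Λ₂.comp Λ₁ = AlgHom.id ℂ _ := by
    apply SymmetricAlgebra.algHom_ext
    ext x
    simp [Λ₁, Λ₂]
  let Λ := (equivMvPolynomial bq).toAlgHom.comp Λ₁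
  have hinj : Function.Injective Λ :=
    (equivMvPolynomial bq).injective.comp
      (Function.LeftInverse.injective (g := Λ₂) fun x ↦ DFunLike.congr_fun hΛ x)
  have hmap : (Polynomial.mapAlgHom Λ).comp ((gradingHom _).comp (sliceRestriction e f)) =
      (sliceHom (sliceValue e b)).comp (equivMvPolynomial b).toAlgHom := by
    apply SymmetricAlgebra.algHom_ext
    apply b.ext
    rintro (k | k)
    · have h1 : (killingForm ℂ g).domRestrict₂ (centralizer f).toSubmodule (b (.inl k)) =
          killingEquiv t (bq k) := by rw [hb.inl]; rfl
      have h2 : killingForm ℂ g (b (.inl k)) e = 0 := by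
        rw [hb.inl]
        exact t.killingForm_eq_zero (bq k).2
      simp [sliceRestriction, h1, h2, gradingHom_ι, Λ, Λ₁, sliceHom_inl]
    · have h1 : (killingForm ℂ g).domRestrict₂ (centralizer f).toSubmodule (b (.inr k)) = 0 := by
        obtain ⟨z, hz⟩ := hb.inr k
        ext y
        have hy : ⁅f, (y : g)⁆ = 0 := y.2
        change killingForm ℂ g (b (.inr k)) y = 0
        rw [hz, killingForm_lie_left, hy, map_zero, neg_zero]
      simp [sliceRestriction, h1, sliceHom_inr]
  have hP : Polynomial.mapAlgHom Λ (gradingHom _ (sliceRestriction e f P)) =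
      sliceHom (sliceValue e b) (equivMvPolynomial b P) := DFunLike.congr_fun hmap P
  calc equivMvPolynomial bq (sliceInitial t P) = Λ (initialForm (sliceRestriction e f P)) := rfl
    _ = (Polynomial.mapAlgHom Λ (gradingHom _ (sliceRestriction e f P))).trailingCoeff :=
      (trailingCoeff_mapAlgHom hinj _).symm
    _ = _ := congrArg Polynomial.trailingCoeff hP

theorem IsSliceBasis.symDegree_sliceInitial [LieAlgebra.IsSimple ℂ g]
    (t : IsTriple e h f) (hb : IsSliceBasis e f bq b) (P : SymmetricAlgebra ℂ g) :
    symDegree (sliceInitial t P) = sliceOrder (sliceValue e b) (equivMvPolynomial b P) := by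
  have h1 := hb.equivMvPolynomial_sliceInitial t P
  -- If the restriction vanishes, degree and order are both 0 by convention.
  by_cases h0 : sliceInitial t P = 0
  · rw [h0, map_zero, eq_comm, sliceLead, Polynomial.trailingCoeff_eq_zero] at h1
    rw [h0, symDegree_zero, sliceOrder, h1, Polynomial.natTrailingDegree_zero]
  · apply symDegree_eq_of_isHomogeneous bq _ h0
    rw [h1]
    exact isHomogeneous_sliceLead _ _

end SliceCoordinates

end

end ArcInvariants

namespace ArcInvariants

noncomputable section

/-! ### The affine action in coordinates -/

section AffineCoordinates

open MvPolynomial SymmetricAlgebra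

variable {q : Type*} [LieRing q] [LieAlgebra ℂ q] {ι : Type*} (b : Module.Basis ι ℂ q)

/-- The basis `b i t^(-(k + 1))` of `q ⊗ t⁻¹ℂ[t⁻¹]`. -/
def affineBasis : Module.Basis (ℕ × ι) ℂ (AffineNeg q) :=
  (Finsupp.basis fun _ : ℕ ↦ b).reindex (Equiv.sigmaEquivProd ℕ ι)

theorem affineBasis_apply (s : ℕ × ι) : affineBasis b s = Finsupp.single s.1 (b s.2) := by
  rw [affineBasis, Module.Basis.reindex_apply, Finsupp.coe_basis]
  rfl

theorem linForm_affineBasis_single_zero (x : q) :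
    linForm (affineBasis b) (Finsupp.single 0 x) = arcBase ι (linForm b x) := by
  have : linForm (affineBasis b) ∘ₗ Finsupp.lsingle 0 =
      (arcBase ι).toLinearMap ∘ₗ linForm b := by
    apply b.ext
    intro k
    have h1 : (Finsupp.single 0 (b k) : AffineNeg q) = affineBasis b (0, k) :=
      (affineBasis_apply b (0, k)).symm
    simp [h1, arcBase]
  exact DFunLike.congr_fun this x

theorem equivMvPolynomial_arcEmbedding (F : SymmetricAlgebra ℂ q) :
    equivMvPolynomial (affineBasis b) (arcEmbedding q F) = arcBase ι (equivMvPolynomial b F) := by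
  have : (equivMvPolynomial (affineBasis b)).toAlgHom.comp (arcEmbedding q) =
      (arcBase ι).comp (equivMvPolynomial b).toAlgHom := by
    apply SymmetricAlgebra.algHom_ext
    refine LinearMap.ext fun x ↦ ?_
    change equivMvPolynomial (affineBasis b) (arcEmbedding q (SymmetricAlgebra.ι ℂ q x)) =
      arcBase ι (equivMvPolynomial b (SymmetricAlgebra.ι ℂ q x))
    rw [arcEmbedding, SymmetricAlgebra.lift_ι_apply, equivMvPolynomial_ι,
      ← linForm_affineBasis_single_zero, LinearMap.comp_apply, equivMvPolynomial_ι]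
    rfl
  exact DFunLike.congr_fun this F

theorem linDerivation_translationLin :
    linDerivation (affineBasis b) (translationLin q) = arcShift ι := by
  apply derivation_ext
  intro s
  rw [linDerivation_X, arcShift_X, affineBasis_apply, translationLin_single, map_smul,
    smul_eq_C_mul, ← affineBasis_apply b (s.1 + 1, s.2), linForm_basis]

theorem equivMvPolynomial_translation_iterate (j : ℕ) (F : SymmetricAlgebra ℂ q) :
    equivMvPolynomial (affineBasis b) ((translation q)^[j] (arcEmbedding q F)) =
      (arcShift ι)^[j] (arcBase ι (equivMvPolynomial b F)) := by
  induction j with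
  | zero => exact equivMvPolynomial_arcEmbedding b F
  | succ j ih =>
    rw [Function.iterate_succ_apply', Function.iterate_succ_apply', translation,
      equivMvPolynomial_symDer, linDerivation_translationLin]
    exact congrArg _ ih

/-- The derivative of an element of `q[[t]]`. -/
def AffinePos.derivative (a : AffinePos q) : AffinePos q :=
  (fun n ↦ ((n : ℂ) + 1) • a.1 (n + 1), 0)

/-- The translation is -d/dt, so its commutator with multiplication by a(t) is the action of the
derivative of a(t). -/
theorem affineAction_commutator (a : AffinePos q) :
    affineAction a * translationLin q - translationLin q * affineAction a =
      affineAction (AffinePos.derivative a) := by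
  apply Finsupp.lhom_ext
  intro k x
  rw [LinearMap.sub_apply, Module.End.mul_apply, Module.End.mul_apply, translationLin_single,
    map_smul, affineAction_single, affineAction_single, affineAction_single, map_sum,
    sub_eq_iff_eq_add]
  let f : ℕ → AffineNeg q := fun n ↦ Finsupp.single (k + 1 - n) ⁅a.1 n, x⁆
  -- Both sums are extended to n ≤ k + 1 by a term with zero coefficient, n = 0 here and n = k + 1
  -- below; the coefficients n and k + 1 - n then add up to k + 1.
  have h1 : ∑ n ∈ Finset.range (k + 1), Finsupp.single (k - n) ⁅(AffinePos.derivative a).1 n, x⁆ =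
      ∑ n ∈ Finset.range (k + 1 + 1), (n : ℂ) • f n := by
    rw [Finset.sum_range_succ' fun n : ℕ ↦ (n : ℂ) • f n, Nat.cast_zero, zero_smul, add_zero]
    refine Finset.sum_congr rfl fun n _ ↦ ?_
    simp only [AffinePos.derivative, f, smul_lie, Nat.add_sub_add_right, Finsupp.smul_single]
    push_cast
    rfl
  have h2 : ∑ n ∈ Finset.range (k + 1), translationLin q (Finsupp.single (k - n) ⁅a.1 n, x⁆) =
      ∑ n ∈ Finset.range (k + 1 + 1), ((k : ℂ) + 1 - n) • f n := by
    rw [Finset.sum_range_succ fun n : ℕ ↦ ((k : ℂ) + 1 - n) • f n]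
    push_cast
    rw [sub_self, zero_smul, add_zero]
    refine Finset.sum_congr rfl fun n hn ↦ ?_
    have hn' : n ≤ k := Nat.lt_succ_iff.mp (Finset.mem_range.mp hn)
    rw [translationLin_single, Nat.cast_sub hn', ← Nat.sub_add_comm hn']
    congr 1
    ring
  rw [h1, h2, ← Finset.sum_add_distrib, Finset.smul_sum]
  refine Finset.sum_congr rfl fun n _ ↦ ?_
  rw [← add_smul]
  congr 1
  ring

theorem linDerivation_affineAction_arcBase (a : AffinePos q) (f : MvPolynomial ι ℂ) :
    linDerivation (affineBasis b) (affineAction a) (arcBase ι f) =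
      arcBase ι (linDerivation b (LieAlgebra.ad ℂ q (a.1 0)) f) := by
  induction f using MvPolynomial.induction_on with
  | C r => simp [arcBase]
  | add f₁ f₂ h₁ h₂ => simp only [map_add, h₁, h₂]
  | mul_X f k h =>
    have h1 : linDerivation (affineBasis b) (affineAction a) (arcBase ι (X k)) =
        arcBase ι (linDerivation b (LieAlgebra.ad ℂ q (a.1 0)) (X k)) := by
      rw [arcBase, rename_X, linDerivation_X, linDerivation_X, affineBasis_apply,
        affineAction_single]
      simp only [zero_add, Finset.range_one, Finset.sum_singleton, Nat.sub_zero]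
      exact linForm_affineBasis_single_zero b _
    simp only [map_mul, Derivation.leibniz, map_add, smul_eq_mul, h, h1]

/-- Moving the action past one translation replaces a(t) by its derivative, so the induction runs
over all a(t) at once. At j = 0 only the constant term of a(t) acts. -/
theorem linDerivation_affineAction_iterate (f : MvPolynomial ι ℂ)
    (hf : ∀ x, linDerivation b (LieAlgebra.ad ℂ q x) f = 0) (j : ℕ) (a : AffinePos q) :
    linDerivation (affineBasis b) (affineAction a) ((arcShift ι)^[j] (arcBase ι f)) = 0 := by
  induction j generalizing a with
  | zero =>
    rw [Function.iterate_zero_apply, linDerivation_affineAction_arcBase, hf, map_zero]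
  | succ j ih =>
    have h1 := linDerivation_commutator (affineBasis b) (affineAction a) (translationLin q)
      ((arcShift ι)^[j] (arcBase ι f))
    rw [affineAction_commutator, ih, ih, map_zero, sub_zero, linDerivation_translationLin] at h1
    rw [Function.iterate_succ_apply', ← h1]

theorem isArcAction_affineAction {κ : Type*} [Fintype ι] [Fintype κ] (F : κ → MvPolynomial ι ℂ)
    (hF : ∀ i x, linDerivation b (LieAlgebra.ad ℂ q x) (F i) = 0) :
    IsArcAction (fun i j ↦ poissonMatrix b i j) F fun n i ↦
      linDerivation (affineBasis b) (affineAction (Pi.single n (b i), 0)) where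
  homogeneous n i s := by
    rw [linDerivation_X]
    exact isHomogeneous_linForm _ _
  eq_zero n i p k hp := by
    rw [linDerivation_X, affineBasis_apply, affineAction_single, Finset.sum_eq_zero, map_zero]
    intro m hm
    rw [Finset.mem_range] at hm
    change Finsupp.single (p - m) ⁅(Pi.single n (b i) : ℕ → q) m, b k⁆ = 0
    rw [Pi.single_eq_of_ne (by omega), zero_lie, Finsupp.single_zero]
  leading n i k := by
    rw [linDerivation_X, affineBasis_apply, affineAction_single, Finset.sum_eq_single n]
    · change linForm (affineBasis b)
        (Finsupp.single (n - n) ⁅(Pi.single n (b i) : ℕ → q) n, b k⁆) = _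
      rw [Pi.single_eq_same, Nat.sub_self, linForm_affineBasis_single_zero]
      rfl
    · intro m _ hm
      change Finsupp.single (n - m) ⁅(Pi.single n (b i) : ℕ → q) m, b k⁆ = 0
      rw [Pi.single_eq_of_ne hm, zero_lie, Finsupp.single_zero]
    · simp
  invariant n i k j := linDerivation_affineAction_iterate b _ (hF _) _ _

end AffineCoordinates

end

end ArcInvariants

namespace ArcInvariants

noncomputable section

/-! ### The main theorem -/

section Main

open SymmetricAlgebra

variable {g : Type*} [LieRing g] [LieAlgebra ℂ g] [FiniteDimensional ℂ g]

/-- A Lie algebra with nondegenerate Killing form is perfect. -/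
theorem eq_zero_of_forall_lie [LieAlgebra.IsKilling ℂ g] (φ : g →ₗ[ℂ] ℂ)
    (h : ∀ a b : g, φ ⁅a, b⁆ = 0) : φ = 0 := by
  obtain ⟨x, hx⟩ := exists_killingForm_eq (g := g) φ
  have h1 : ∀ a, ⁅a, x⁆ = 0 := fun a ↦ by
    apply (LieAlgebra.IsKilling.killingForm_nondegenerate ℂ g).1
    intro b
    rw [killingForm_lie_left, hx, h, neg_zero]
  have h2 : LieAlgebra.ad ℂ g x = 0 := by
    ext a
    rw [LieAlgebra.ad_apply, ← lie_skew, h1, neg_zero, LinearMap.zero_apply]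
  ext y
  rw [← hx, killingForm_apply_apply, h2, LinearMap.zero_comp, map_zero, LinearMap.zero_apply]

theorem equivMvPolynomial_mem_adjoin {M σ κ : Type*} [AddCommGroup M] [Module ℂ M]
    (b : Module.Basis σ ℂ M) (P : κ → SymmetricAlgebra ℂ M) (F : SymmetricAlgebra ℂ M) :
    equivMvPolynomial b F ∈ Algebra.adjoin ℂ (Set.range fun i ↦ equivMvPolynomial b (P i)) ↔
      F ∈ Algebra.adjoin ℂ (Set.range P) := by
  have h1 : Algebra.adjoin ℂ (Set.range fun i ↦ equivMvPolynomial b (P i)) =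
      (Algebra.adjoin ℂ (Set.range P)).map (equivMvPolynomial b).toAlgHom := by
    rw [AlgHom.map_adjoin, ← Set.range_comp]
    rfl
  rw [h1, Subalgebra.mem_map]
  exact ⟨fun ⟨G, hG, hGF⟩ ↦ (equivMvPolynomial b).injective hGF ▸ hG, fun hF ↦ ⟨F, hF, rfl⟩⟩

variable [LieAlgebra.IsSimple ℂ g] {e h f : g}

theorem IsGoodGeneratingSystem.linDerivation_eq_zero {t : IsTriple e h f}
    {P : Fin (LieAlgebra.rank ℂ g) → SymmetricAlgebra ℂ g} (hP : IsGoodGeneratingSystem t P)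
    {σ : Type*} (b : Module.Basis σ ℂ g) (a : g) (i : Fin (LieAlgebra.rank ℂ g)) :
    linDerivation b (LieAlgebra.ad ℂ g a) (equivMvPolynomial b (P i)) = 0 := by
  have h1 : P i ∈ adjointInvariants g :=
    hP.generates ▸ Algebra.subset_adjoin (Set.mem_range_self i)
  exact (mem_symInvariants_iff b _ _).mp h1 a

theorem linDerivation_ad_basis {q σ : Type*} [LieRing q] [LieAlgebra ℂ q] [Fintype σ]
    (b : Module.Basis σ ℂ q) (v : σ) (F : MvPolynomial σ ℂ) :
    linDerivation b (LieAlgebra.ad ℂ q (b v)) F =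
      ∑ u, MvPolynomial.pderiv u F * poissonMatrix b v u := by
  rw [derivation_eq_sum_pderiv _ _ Finset.univ (Finset.subset_univ _)]
  refine Finset.sum_congr rfl fun u _ ↦ ?_
  rw [linDerivation_X, smul_eq_mul, poissonMatrix_apply]
  rfl

/-- The initial forms of invariants are invariants of the centralizer. -/
theorem IsGoodGeneratingSystem.linDerivation_sliceLead {t : IsTriple e h f}
    {P : Fin (LieAlgebra.rank ℂ g) → SymmetricAlgebra ℂ g} (hP : IsGoodGeneratingSystem t P)
    {ι ι' : Type*} [Fintype ι] [Fintype ι'] [DecidableEq ι] [DecidableEq ι']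
    {bq : Module.Basis ι ℂ (centralizer e)} {b : Module.Basis (ι ⊕ ι') ℂ g}
    (hb : IsSliceBasis e f bq b) (i : Fin (LieAlgebra.rank ℂ g)) (x : centralizer e) :
    linDerivation bq (LieAlgebra.ad ℂ (centralizer e) x)
      (sliceLead (sliceValue e b) (equivMvPolynomial b (P i))) = 0 := by
  have h1 : ∀ a, linDerivation bq (LieAlgebra.ad ℂ (centralizer e) (bq a))
      (sliceLead (sliceValue e b) (equivMvPolynomial b (P i))) = 0 := fun a ↦ by
    rw [linDerivation_ad_basis]
    refine (hb.isSliceMatrix t).sum_pderiv_mul_eq_zero _ (fun v ↦ ?_) a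
    rw [← linDerivation_ad_basis]
    exact hP.linDerivation_eq_zero b _ i
  let ψ : centralizer e →ₗ[ℂ] MvPolynomial ι ℂ :=
    { toFun := fun x ↦ linDerivation bq (LieAlgebra.ad ℂ (centralizer e) x)
        (sliceLead (sliceValue e b) (equivMvPolynomial b (P i)))
      map_add' := fun x y ↦ by rw [map_add, map_add, Derivation.add_apply]
      map_smul' := fun r x ↦ by rw [map_smul, map_smul, Derivation.smul_apply]; rfl }
  exact DFunLike.congr_fun (bq.ext h1 : ψ = 0) x

/-- For a good generating system, the kernel of the Poisson matrix of `g^e` is freely generated by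
the differentials of the initial forms. -/
theorem IsGoodGeneratingSystem.hasFreeKernel (t : IsTriple e h f)
    {P : Fin (LieAlgebra.rank ℂ g) → SymmetricAlgebra ℂ g} (hP : IsGoodGeneratingSystem t P)
    (hsing : 2 ≤ codim (singularSet (centralizer e) (LieAlgebra.rank ℂ g)))
    {ι ι' : Type*} [Fintype ι] [Fintype ι'] [DecidableEq ι] [DecidableEq ι']
    {bq : Module.Basis ι ℂ (centralizer e)} {b : Module.Basis (ι ⊕ ι') ℂ g}
    (hb : IsSliceBasis e f bq b) :
    HasFreeKernel (fun i j ↦ poissonMatrix bq i j) fun i ↦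
      sliceLead (sliceValue e b) (equivMvPolynomial b (P i)) := by
  have hgen : ∀ F, (∀ a, linDerivation b (LieAlgebra.ad ℂ g a) F = 0) →
      F ∈ Algebra.adjoin ℂ (Set.range fun i ↦ equivMvPolynomial b (P i)) := by
    intro F hF
    obtain ⟨F, rfl⟩ := (equivMvPolynomial b).surjective F
    rw [equivMvPolynomial_mem_adjoin, hP.generates]
    exact (mem_symInvariants_iff b _ F).mpr hF
  have hinv := fun a i ↦ hP.linDerivation_eq_zero b a i
  have hex := exists_det_jacobian_ne_zero b _ hgen
  refine (hb.isSliceMatrix t).hasFreeKernel ?_ _ (fun i v ↦ ?_) ?_ ?_ ?_ ?_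
  · ext1 u v
    rw [Matrix.transpose_apply, Matrix.neg_apply, poissonMatrix_apply, poissonMatrix_apply,
      ← lie_skew, map_neg]
  · rw [← linDerivation_ad_basis]
    exact hinv (b v) i
  · obtain ⟨U, hU⟩ := hex
    exact ⟨_, hU⟩
  -- Perfectness of g enters here; it excludes semi-invariants that are not invariants.
  · exact (isLinearAction_linDerivation b).exists_not_dvd_det eq_zero_of_forall_lie _ hinv hgen hex
  · have h1 := hP.good
    rw [Finset.sum_congr rfl fun i _ ↦ hb.symDegree_sliceInitial t (P i), eq_div_iff two_ne_zero,
      mul_comm, Module.finrank_eq_card_basis bq] at h1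
    rw [Fintype.card_fin]
    exact_mod_cast h1
  · exact exists_not_dvd_det_poissonMatrix bq (by rwa [Fintype.card_fin])

end Main

end

end ArcInvariants

theorem mainTheorem4 {g : Type*} [LieRing g] [LieAlgebra ℂ g] [FiniteDimensional ℂ g]
    [LieAlgebra.IsSimple ℂ g] {e h f : g}
    (he : IsNilpotent (LieAlgebra.ad ℂ g e)) (t : ArcInvariants.IsTriple e h f)
    (P : Fin (LieAlgebra.rank ℂ g) → SymmetricAlgebra ℂ g)
    (hP : ArcInvariants.IsGoodGeneratingSystem t P)
    (hsing : 2 ≤ ArcInvariants.codim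
      (ArcInvariants.singularSet (ArcInvariants.centralizer e) (LieAlgebra.rank ℂ g))) :
    AlgebraicIndependent ℂ (fun p : Fin (LieAlgebra.rank ℂ g) × ℕ ↦
        (ArcInvariants.translation (ArcInvariants.centralizer e))^[p.2]
          (ArcInvariants.arcEmbedding (ArcInvariants.centralizer e)
            (ArcInvariants.sliceInitial t (P p.1)))) ∧
      Algebra.adjoin ℂ (Set.range fun p : Fin (LieAlgebra.rank ℂ g) × ℕ ↦
        (ArcInvariants.translation (ArcInvariants.centralizer e))^[p.2]
          (ArcInvariants.arcEmbedding (ArcInvariants.centralizer e)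
            (ArcInvariants.sliceInitial t (P p.1)))) =
        ArcInvariants.affineInvariants (ArcInvariants.centralizer e) := by
  classical
  let bq := Module.finBasis ℂ (ArcInvariants.centralizer e)
  obtain ⟨b, hb⟩ := t.exists_isSliceBasis bq
    (Module.finBasis ℂ (LinearMap.range (LieAlgebra.ad ℂ g f)))
  have hfree := hP.hasFreeKernel t hsing hb
  let F := fun i ↦ ArcInvariants.sliceLead (ArcInvariants.sliceValue e b)
    (SymmetricAlgebra.equivMvPolynomial b (P i))
  have hF : ∀ i, (F i).IsHomogeneous _ := fun i ↦ ArcInvariants.isHomogeneous_sliceLead _ _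
  have hinv : ∀ i x, ArcInvariants.linDerivation bq
      (LieAlgebra.ad ℂ (ArcInvariants.centralizer e) x) (F i) = 0 :=
    fun i x ↦ hP.linDerivation_sliceLead hb i x
  let E := SymmetricAlgebra.equivMvPolynomial (ArcInvariants.affineBasis bq)
  have hE : ∀ p : Fin (LieAlgebra.rank ℂ g) × ℕ,
      E ((ArcInvariants.translation (ArcInvariants.centralizer e))^[p.2]
          (ArcInvariants.arcEmbedding (ArcInvariants.centralizer e)
            (ArcInvariants.sliceInitial t (P p.1)))) =
        (ArcInvariants.arcShift _)^[p.2] (ArcInvariants.arcBase _ (F p.1)) := fun p ↦ by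
    rw [ArcInvariants.equivMvPolynomial_translation_iterate,
      hb.equivMvPolynomial_sliceInitial t]
  refine ⟨?_, le_antisymm (Algebra.adjoin_le ?_) fun G hG ↦ ?_⟩
  · rw [← AlgHom.algebraicIndependent_iff E.toAlgHom E.injective]
    convert hfree.arc_algebraicIndependent using 1
    exact funext hE
  · rintro _ ⟨p, rfl⟩
    refine (ArcInvariants.mem_symInvariants_iff (ArcInvariants.affineBasis bq) _ _).mpr fun a ↦ ?_
    exact (hE p).symm ▸
      ArcInvariants.linDerivation_affineAction_iterate bq (F p.1) (hinv p.1) p.2 a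
  · rw [← ArcInvariants.equivMvPolynomial_mem_adjoin (ArcInvariants.affineBasis bq)]
    have hG' := (ArcInvariants.mem_symInvariants_iff (ArcInvariants.affineBasis bq) _ G).mp hG
    -- Annihilation by the elements b_i t^n alone already forces membership in the generated
    -- algebra.
    have h1 := hfree.arc_mem_adjoin (ArcInvariants.isArcAction_affineAction bq F hinv) _ hF
      (fun i ↦ hfree.pos_of_isHomogeneous (hF i)) (E G) fun n i ↦ hG' _
    exact (funext hE : _ = fun p : Fin (LieAlgebra.rank ℂ g) × ℕ ↦
      (ArcInvariants.arcShift _)^[p.2] (ArcInvariants.arcBase _ (F p.1))) ▸ h1
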